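/- **Theorem (probabilistic error analysis of Shifted CholeskyQR3).** *Algorithm and arithmetic.* Let $T\in\mathbb R^{m\times n}$, $n\ge1$, $\operatorname{rank}T=n$, and let $s>0$. Shifted CholeskyQR3 computes $U=T^\top T$, $V=\mathrm{Cholesky}(U+sI)$, $Q=TV^{-1}$; $U_1=Q^\top Q$, $V_1=\mathrm{Cholesky}(U_1)$, $Q_1=QV_1^{-1}$; $V_2=V_1V$; $U_2=Q_1^\top Q_1$, $V_3=\mathrm{Cholesky}(U_2)$, $Q_2=Q_1V_3^{-1}$; $V_4=V_3V_2$, where the Cholesky factors are upper triangular, $XV^{-1}$ is computed row by row by substitution, and sums are accumulated from left to right. Every elementary operation is performed as $\mathrm{fl}(a\ \mathrm{op}\ b)=(a\ \mathrm{op}\ b)(1+\delta)$, $\mathrm{fl}(\sqrt a)=\sqrt a\,(1+\delta)$, where the rounding errors $\delta$ of all the operations of the algorithm are mutually independent real random variables of mean zero on one probability space, bounded in absolute value by the unit roundoff ${\bf u}>0$. From here on $Q,Q_1,Q_2,V_4$ are the computed (random) matrices. *Notation.* $\|\cdot\|_2$ and $\|\cdot\|_F$ are the spectral and the Frobenius norm,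 $\|X\|_g$ is the largest Euclidean norm of a column of $X$, $\kappa_2(T)=\sigma_1(T)/\sigma_n(T)$, $$p_1=\frac{\|T\|_g}{\|T\|_2},\qquad p_2=\frac{\|Q\|_g}{\|Q\|_2},\qquad p_3=\frac{\|Q_1\|_g}{\|Q_1\|_2},$$ $$P(\lambda)=1-2\exp\!\Big(-\frac{\lambda^2(1-{\bf u})^2}{2}\Big),\qquad \mathcal Q(\lambda,N)=1-N\,(1-P(\lambda)),$$ $$\phi_1(p_1,p_2,p_3)=1.67p_1+2.18p_2+2.20p_1p_2+2.70p_3+2.71p_1p_3 .$$ *Assumptions.* $\lambda>0$, $$\max(\lambda\sqrt m\,n{\bf u},\,mn{\bf u})\le\tfrac1{2200},\qquad \max(\lambda\sqrt{n+1}\,n{\bf u},\,n(n+1){\bf u})\le\tfrac1{2200},\qquad \mathcal Q(\lambda,mn^2)>0,$$ and $s=11\lambda(\sqrt m\,n{\bf u}+\sqrt{n+1}\,n{\bf u})\|T\|_g^2$. *Conclusion.* With probability at least $$\Big(\mathcal Q(\lambda,mn^2)\,\mathcal Q\big(\lambda,\tfrac{n^3}{6}+\tfrac{n^2}{2}+\tfrac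 n3\big)\,\mathcal Q\big(\lambda,\tfrac{n(n+1)}2\big)\Big)^3\,\mathcal Q(\lambda,n^3)^2$$ the following holds: the first Cholesky factorization runs to completion, and if $$\kappa_2(T)\le\frac1{86\,\lambda\, p_1p_2(\sqrt m\,n{\bf u}+\sqrt{n+1}\,n{\bf u})},$$ then the other two Cholesky factorizations run to completion as well and $$\|Q_2^\top Q_2-I\|_F\le 6\lambda\,p_3^2(\sqrt m\,n{\bf u}+\sqrt{n+1}\,n{\bf u}),$$ $$\|Q_2V_4-T\|_F\le\phi_1(p_1,p_2,p_3)\,\lambda\,n\sqrt n\,{\bf u}\,\|T\|_2 .$$ -/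

import Mathlib

noncomputable section

namespace CholQR

/-! ### Norms, condition number, column ratio -/

open scoped Matrix.Norms.L2Operator in
/-- The spectral norm of a real matrix. -/
def norm2 {m n : ℕ} (A : Matrix (Fin m) (Fin n) ℝ) : ℝ := ‖A‖

open scoped Matrix.Norms.Frobenius in
/-- The Frobenius norm of a real matrix. -/
def normF {m n : ℕ} (A : Matrix (Fin m) (Fin n) ℝ) : ℝ := ‖A‖

/-- The `g`-norm of a real matrix: the largest Euclidean norm of a column. -/
def gNorm {m n : ℕ} (A : Matrix (Fin m) (Fin n) ℝ) : ℝ :=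
  ⨆ j : Fin n, Real.sqrt (∑ i : Fin m, A i j ^ 2)

/-- The smallest (`n`-th largest) singular value of an `m × n` matrix. -/
def sigmaMin {m n : ℕ} (A : Matrix (Fin m) (Fin n) ℝ) : ℝ :=
  (Matrix.toEuclideanLin A).singularValues (n - 1)

/-- The condition number `σ₁(A) / σₙ(A)`, meaningful for `A` of full column rank. -/
def kappa2 {m n : ℕ} (A : Matrix (Fin m) (Fin n) ℝ) : ℝ := norm2 A / sigmaMin A

/-- The ratio `‖A‖_g / ‖A‖₂`. -/
def pRatio {m n : ℕ} (A : Matrix (Fin m) (Fin n) ℝ) : ℝ := gNorm A / norm2 A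

/-! ### Floating-point kernels

Every elementary operation `a op b` is evaluated as `(a op b) * (1 + δ)`, and a square root as
`√a * (1 + δ)`.  The relative errors `δ` are arguments of the kernels. -/

/-- Computed sum `x₀ + x₁ + ⋯`, from left to right; `α k` is the error of the addition of the
term `k` (the term `0` is not added to anything, so `α 0` is not used). -/
def flSum : {k : ℕ} → (x α : Fin k → ℝ) → ℝ
  | 0, _, _ => 0
  | 1, x, _ => x 0
  | k + 2, x, α =>
      (flSum (k := k + 1) (fun l => x l.castSucc) (fun l => α l.castSucc)
        + x (Fin.last (k + 1))) * (1 + α (Fin.last (k + 1)))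

/-- Computed value of `a - x₀ y₀ - x₁ y₁ - ⋯`, from left to right; `ε k` is the error of the
`k`-th multiplication and `η k` the error of the `k`-th subtraction. -/
def flSubDot (a : ℝ) : {k : ℕ} → (x y ε η : Fin k → ℝ) → ℝ
  | 0, _, _, _, _ => a
  | k + 1, x, y, ε, η =>
      (flSubDot a (k := k) (fun l => x l.castSucc) (fun l => y l.castSucc)
          (fun l => ε l.castSucc) (fun l => η l.castSucc)
        - x (Fin.last k) * y (Fin.last k) * (1 + ε (Fin.last k))) * (1 + η (Fin.last k))

/-- Computed matrix product: entry `(i, j)` is a recursively summed inner product, with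
multiplication errors `ε i j k` and addition errors `α i j k`. -/
def flMul {a b c : ℕ} (X : Matrix (Fin a) (Fin b) ℝ) (Y : Matrix (Fin b) (Fin c) ℝ)
    (ε α : Fin a → Fin c → Fin b → ℝ) : Matrix (Fin a) (Fin c) ℝ :=
  Matrix.of fun i j => flSum (fun k => X i k * Y k j * (1 + ε i j k)) (fun k => α i j k)

/-- Entry `(i, j)` of the computed upper triangular Cholesky factor `V` of `A`
(only the upper triangle of `A` is read):
`V i i = √(A i i - ∑ k < i, V k i ^ 2)` and
`V i j = (A i j - ∑ k < i, V k i * V k j) / V i i` for `i < j`.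
The multiplications have errors `ε i j k`, the subtractions `η i j k`, the square root `ζ i i`
and the divisions `ζ i j`. -/
def flCholEntry {n : ℕ} (A : Matrix (Fin n) (Fin n) ℝ) (ε η : Fin n → Fin n → Fin n → ℝ)
    (ζ : Fin n → Fin n → ℝ) (i j : Fin n) : ℝ :=
  if i = j then
    Real.sqrt (flSubDot (A i i) (k := i.val)
      (fun k => flCholEntry A ε η ζ (k.castLE i.isLt.le) i)
      (fun k => flCholEntry A ε η ζ (k.castLE i.isLt.le) i)
      (fun k => ε i i (k.castLE i.isLt.le)) (fun k => η i i (k.castLE i.isLt.le))) * (1 + ζ i i)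
  else if _h : i < j then
    flSubDot (A i j) (k := i.val)
      (fun k => flCholEntry A ε η ζ (k.castLE i.isLt.le) i)
      (fun k => flCholEntry A ε η ζ (k.castLE i.isLt.le) j)
      (fun k => ε i j (k.castLE i.isLt.le)) (fun k => η i j (k.castLE i.isLt.le))
      / flCholEntry A ε η ζ i i * (1 + ζ i j)
  else 0
termination_by (i.val, j.val)
decreasing_by
  all_goals first
    | exact Prod.Lex.left _ _ k.isLt
    | exact Prod.Lex.right _ _h

/-- The computed Cholesky factor. -/
def flChol {n : ℕ} (A : Matrix (Fin n) (Fin n) ℝ) (ε η : Fin n → Fin n → Fin n → ℝ)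
    (ζ : Fin n → Fin n → ℝ) : Matrix (Fin n) (Fin n) ℝ :=
  Matrix.of (flCholEntry A ε η ζ)

/-- The Cholesky factorization runs to completion: every computed number whose square root is
taken is positive. -/
def CholCompletes {n : ℕ} (A : Matrix (Fin n) (Fin n) ℝ) (ε η : Fin n → Fin n → Fin n → ℝ)
    (ζ : Fin n → Fin n → ℝ) : Prop :=
  ∀ i : Fin n, 0 < flSubDot (A i i) (k := i.val)
    (fun k => flChol A ε η ζ (k.castLE i.isLt.le) i)
    (fun k => flChol A ε η ζ (k.castLE i.isLt.le) i)
    (fun k => ε i i (k.castLE i.isLt.le)) (fun k => η i i (k.castLE i.isLt.le))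

/-- Entry `(i, j)` of the computed `X V⁻¹`, `V` upper triangular: every row `q` of the result is
obtained from `q V = x` by substitution, `q j = (x j - ∑ k < j, q k * V k j) / V j j`. -/
def flSolveEntry {m n : ℕ} (X : Matrix (Fin m) (Fin n) ℝ) (V : Matrix (Fin n) (Fin n) ℝ)
    (ε η : Fin m → Fin n → Fin n → ℝ) (ζ : Fin m → Fin n → ℝ) (i : Fin m) (j : Fin n) : ℝ :=
  flSubDot (X i j) (k := j.val)
    (fun k => flSolveEntry X V ε η ζ i (k.castLE j.isLt.le))
    (fun k => V (k.castLE j.isLt.le) j)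
    (fun k => ε i j (k.castLE j.isLt.le)) (fun k => η i j (k.castLE j.isLt.le))
    / V j j * (1 + ζ i j)
termination_by j.val
decreasing_by exact k.isLt

/-- The computed `X V⁻¹`. -/
def flSolve {m n : ℕ} (X : Matrix (Fin m) (Fin n) ℝ) (V : Matrix (Fin n) (Fin n) ℝ)
    (ε η : Fin m → Fin n → Fin n → ℝ) (ζ : Fin m → Fin n → ℝ) : Matrix (Fin m) (Fin n) ℝ :=
  Matrix.of (flSolveEntry X V ε η ζ)

/-! ### The algorithm -/

/-- The elementary operations of Shifted CholeskyQR3 on an `m × n` matrix.  The argument `c`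
numbers the three (Shifted) CholeskyQR sweeps, or the two products of triangular factors; the
other arguments are those of the error families of the kernels above.  (Some indices, such as
`cholMul c i j k` with `k ≥ i`, occur in no operation; their errors are not used.) -/
inductive Op (m n : ℕ) : Type
  | gramMul (c : Fin 3) (i j : Fin n) (k : Fin m)
  | gramAdd (c : Fin 3) (i j : Fin n) (k : Fin m)
  | shiftAdd (i : Fin n)
  | cholMul (c : Fin 3) (i j k : Fin n)
  | cholSub (c : Fin 3) (i j k : Fin n)
  | cholRootDiv (c : Fin 3) (i j : Fin n)
  | solveMul (c : Fin 3) (i : Fin m) (j k : Fin n)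
  | solveSub (c : Fin 3) (i : Fin m) (j k : Fin n)
  | solveDiv (c : Fin 3) (i : Fin m) (j : Fin n)
  | triMul (c : Fin 2) (i j k : Fin n)
  | triAdd (c : Fin 2) (i j k : Fin n)

variable {m n : ℕ}

/-- Computed Gram matrix `Xᵀ X` in the sweep `c`. -/
def gram (e : Op m n → ℝ) (c : Fin 3) (X : Matrix (Fin m) (Fin n) ℝ) :
    Matrix (Fin n) (Fin n) ℝ :=
  flMul X.transpose X (fun i j k => e (.gramMul c i j k)) (fun i j k => e (.gramAdd c i j k))

/-- Computed `U + s I`. -/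
def addShift (e : Op m n → ℝ) (s : ℝ) (U : Matrix (Fin n) (Fin n) ℝ) :
    Matrix (Fin n) (Fin n) ℝ :=
  Matrix.of fun i j => if i = j then (U i i + s) * (1 + e (.shiftAdd i)) else U i j

/-- Computed Cholesky factor in the sweep `c`. -/
def chol (e : Op m n → ℝ) (c : Fin 3) (A : Matrix (Fin n) (Fin n) ℝ) :
    Matrix (Fin n) (Fin n) ℝ :=
  flChol A (fun i j k => e (.cholMul c i j k)) (fun i j k => e (.cholSub c i j k))
    (fun i j => e (.cholRootDiv c i j))

/-- The Cholesky factorization of the sweep `c` runs to completion. -/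
def Completes (e : Op m n → ℝ) (c : Fin 3) (A : Matrix (Fin n) (Fin n) ℝ) : Prop :=
  CholCompletes A (fun i j k => e (.cholMul c i j k)) (fun i j k => e (.cholSub c i j k))
    (fun i j => e (.cholRootDiv c i j))

/-- Computed `X V⁻¹` in the sweep `c`. -/
def solve (e : Op m n → ℝ) (c : Fin 3) (X : Matrix (Fin m) (Fin n) ℝ)
    (V : Matrix (Fin n) (Fin n) ℝ) : Matrix (Fin m) (Fin n) ℝ :=
  flSolve X V (fun i j k => e (.solveMul c i j k)) (fun i j k => e (.solveSub c i j k))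
    (fun i j => e (.solveDiv c i j))

/-- Computed product of two triangular factors. -/
def triProd (e : Op m n → ℝ) (c : Fin 2) (X Y : Matrix (Fin n) (Fin n) ℝ) :
    Matrix (Fin n) (Fin n) ℝ :=
  flMul X Y (fun i j k => e (.triMul c i j k)) (fun i j k => e (.triAdd c i j k))

/-- All matrices computed by Shifted CholeskyQR3.  `A` is the computed `U + s I`. -/
structure Run (m n : ℕ) where
  (U A V : Matrix (Fin n) (Fin n) ℝ)
  Q : Matrix (Fin m) (Fin n) ℝ
  (U₁ V₁ : Matrix (Fin n) (Fin n) ℝ)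
  Q₁ : Matrix (Fin m) (Fin n) ℝ
  V₂ : Matrix (Fin n) (Fin n) ℝ
  (U₂ V₃ : Matrix (Fin n) (Fin n) ℝ)
  Q₂ : Matrix (Fin m) (Fin n) ℝ
  V₄ : Matrix (Fin n) (Fin n) ℝ

/-- Shifted CholeskyQR3 with input `T`, shift `s` and rounding errors `e`:
`[Q, V] = SCholeskyQR(T)`, `[Q₁, V₁] = CholeskyQR(Q)`, `V₂ = V₁ V`, `[Q₂, V₃] = CholeskyQR(Q₁)`,
`V₄ = V₃ V₂`. -/
def sCholeskyQR3 (T : Matrix (Fin m) (Fin n) ℝ) (s : ℝ) (e : Op m n → ℝ) : Run m n :=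
  let U := gram e 0 T
  let A := addShift e s U
  let V := chol e 0 A
  let Q := solve e 0 T V
  let U₁ := gram e 1 Q
  let V₁ := chol e 1 U₁
  let Q₁ := solve e 1 Q V₁
  let V₂ := triProd e 0 V₁ V
  let U₂ := gram e 2 Q₁
  let V₃ := chol e 2 U₂
  let Q₂ := solve e 2 Q₁ V₃
  let V₄ := triProd e 1 V₃ V₂
  ⟨U, A, V, Q, U₁, V₁, Q₁, V₂, U₂, V₃, Q₂, V₄⟩

/-! ### Probabilities and constants -/

/-- `P(λ) = 1 - 2 exp(-λ² (1 - u)² / 2)`. -/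
def probP (u lam : ℝ) : ℝ := 1 - 2 * Real.exp (-(lam ^ 2 * (1 - u) ^ 2) / 2)

/-- `Q(λ, N) = 1 - N (1 - P(λ))`. -/
def probQ (u lam N : ℝ) : ℝ := 1 - N * (1 - probP u lam)

/-- The constant `φ₁(p₁, p₂, p₃)` of the residual bound. -/
def phi1 (p₁ p₂ p₃ : ℝ) : ℝ :=
  1.67 * p₁ + 2.18 * p₂ + 2.20 * (p₁ * p₂) + 2.70 * p₃ + 2.71 * (p₁ * p₃)

end CholQR

end

/-!
The rounding errors enter the computed matrices only through products of factors `1 + δ`.  In an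
inner product the term `k` carries the errors of its multiplication and of all the later
additions, and in a substitution step the subtraction errors before the term `k`; so the size of
the product is governed by the *sum* of these errors, since `exp (δ - δ²) ≤ 1 + δ ≤ exp δ` for
`|δ| ≤ 1 / 2`.  A sum of `N` independent centred errors exceeds `λ (1 - u) √N u` in absolute value
with probability at most `2 exp (-λ² (1 - u)² / 2)`, by Hoeffding's inequality.  This is why the
error constants have `√m` and `√(n + 1)` in place of `m` and `n`.

The sums that have to be small are collected in eight groups: for each of the three sweeps, the
Gram matrix together with the triangular solve (`m n²` sums), and the Cholesky factorization (at
most `n³/6 + n²/2 + n/3` sums); and the two products of triangular factors (`n³` sums each).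
Inside a group the failure probabilities are added; different groups involve different operations
and are independent, so their success probabilities are multiplied
(`prod_le_measureReal_forall`).

On the resulting event (`GoodErrors`) everything is deterministic.

* A Cholesky factorization of a perturbation of a positive definite matrix `M` completes as soon as
  the smallest eigenvalue of `M` exceeds the accumulated error (`cholPivot_pos`): a pivot that is
  not positive yields a null vector of the rows computed so far, at which the quadratic form of `M`
  would be too small.  The computed factor `V` then has `Vᵀ V` close to `M`
  (`abs_transpose_mul_flChol_sub_le`), and the computed solution of `Q V = X` has a small residual
  (`abs_flSolve_mul_sub_le`).
* In the first sweep the shift dominates the errors, so the factorization completes for any `T` of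
  full rank; the condition on `κ₂(T)` makes `‖Q y‖` large against the errors of the second sweep
  (`shifted_lower_bound`).  The second sweep gives singular values between `0.99` and `1.01`
  (`second_sweep_bounds`), and after the third one only its own errors are left in `Q₂ᵀ Q₂ - I`
  (`third_sweep_bounds`).
* The residual `Q₂ V₄ - T` is the sum of the residuals of the three triangular solves and of the
  two products of triangular factors, each multiplied by matrices of controlled norm
  (`residual_le`).

The hypotheses force `λ ≥ 1`, which turns the accumulated errors into multiples of
`A = λ √m n u`, `B = λ √(n + 1) n u` and `w = λ √n n u` (`errorConstants_of_size_le`).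
-/

namespace CholQR

/-! ### The Euclidean norm of vectors -/

section norms

open Matrix

variable {a b c : ℕ}

/-- The Euclidean norm of a vector. -/
noncomputable def vnorm (v : Fin a → ℝ) : ℝ := ‖WithLp.toLp 2 v‖

lemma vnorm_nonneg (v : Fin a → ℝ) : 0 ≤ vnorm v := norm_nonneg _

lemma vnorm_sq (v : Fin a → ℝ) : vnorm v ^ 2 = ∑ i, v i ^ 2 := by
  simp [vnorm, EuclideanSpace.norm_sq_eq]

lemma vnorm_eq_sqrt (v : Fin a → ℝ) : vnorm v = √(∑ i, v i ^ 2) := by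
  rw [← vnorm_sq, Real.sqrt_sq (vnorm_nonneg v)]

lemma vnorm_sq_eq_dotProduct (v : Fin a → ℝ) : vnorm v ^ 2 = v ⬝ᵥ v := by
  rw [vnorm_sq]; simp only [dotProduct, sq]

lemma vnorm_add_le (v w : Fin a → ℝ) : vnorm (v + w) ≤ vnorm v + vnorm w := by
  simpa [vnorm] using norm_add_le (WithLp.toLp 2 v) (WithLp.toLp 2 w)

lemma vnorm_pos {v : Fin a → ℝ} (hv : v ≠ 0) : 0 < vnorm v := by
  unfold vnorm
  rw [norm_pos_iff]
  simpa using hv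

/-- The Cauchy–Schwarz inequality with absolute values on the entries. -/
lemma sum_abs_mul_abs_le (v w : Fin a → ℝ) : ∑ i, |v i| * |w i| ≤ vnorm v * vnorm w := by
  have h := Finset.sum_mul_sq_le_sq_mul_sq Finset.univ (fun i => |v i|) (fun i => |w i|)
  simp only [sq_abs, ← vnorm_sq, ← mul_pow] at h
  exact (abs_le_of_sq_le_sq' h (mul_nonneg (vnorm_nonneg _) (vnorm_nonneg _))).2

lemma sq_sum_abs_le (v : Fin a → ℝ) : (∑ i, |v i|) ^ 2 ≤ a * vnorm v ^ 2 := by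
  have h := sq_sum_le_card_mul_sum_sq (s := Finset.univ) (f := fun i => |v i|)
  simpa [← vnorm_sq] using h

/-! ### The spectral norm -/

open scoped Matrix.Norms.L2Operator in
lemma norm2_nonneg (A : Matrix (Fin a) (Fin b) ℝ) : 0 ≤ norm2 A := by
  unfold norm2; exact norm_nonneg _

lemma vnorm_mulVec_le (A : Matrix (Fin a) (Fin b) ℝ) (v : Fin b → ℝ) :
    vnorm (A *ᵥ v) ≤ norm2 A * vnorm v := by
  unfold norm2 vnorm
  exact Matrix.l2_opNorm_mulVec A (WithLp.toLp 2 v)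

lemma norm2_le {A : Matrix (Fin a) (Fin b) ℝ} {C : ℝ} (hC : 0 ≤ C)
    (h : ∀ v, vnorm (A *ᵥ v) ≤ C * vnorm v) : norm2 A ≤ C := by
  unfold norm2
  rw [Matrix.l2_opNorm_def]
  refine ContinuousLinearMap.opNorm_le_bound _ hC fun x => ?_
  exact h x.ofLp

lemma norm2_transpose (A : Matrix (Fin a) (Fin b) ℝ) : norm2 Aᵀ = norm2 A := by
  unfold norm2
  rw [← Matrix.conjTranspose_eq_transpose_of_trivial]
  exact Matrix.l2_opNorm_conjTranspose A

lemma norm2_mul_le (A : Matrix (Fin a) (Fin b) ℝ) (B : Matrix (Fin b) (Fin c) ℝ) :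
    norm2 (A * B) ≤ norm2 A * norm2 B := by
  unfold norm2; exact Matrix.l2_opNorm_mul A B

open scoped Matrix.Norms.L2Operator in
lemma norm2_add_le (A B : Matrix (Fin a) (Fin b) ℝ) : norm2 (A + B) ≤ norm2 A + norm2 B := by
  unfold norm2; exact norm_add_le A B

/-! ### The Frobenius norm -/

open scoped Matrix.Norms.Frobenius in
lemma normF_nonneg (A : Matrix (Fin a) (Fin b) ℝ) : 0 ≤ normF A := by
  unfold normF; exact norm_nonneg _

lemma normF_sq (A : Matrix (Fin a) (Fin b) ℝ) : normF A ^ 2 = ∑ i, ∑ j, A i j ^ 2 := by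
  unfold normF
  rw [Matrix.frobenius_norm_def, ← Real.sqrt_eq_rpow, Real.sq_sqrt (by positivity)]
  simp

lemma normF_sq_eq_sum_col (A : Matrix (Fin a) (Fin b) ℝ) :
    normF A ^ 2 = ∑ j, vnorm (A.col j) ^ 2 := by
  rw [normF_sq, Finset.sum_comm]
  simp [vnorm_sq]

open scoped Matrix.Norms.Frobenius in
lemma normF_add_le (A B : Matrix (Fin a) (Fin b) ℝ) : normF (A + B) ≤ normF A + normF B := by
  unfold normF; exact norm_add_le A B

open scoped Matrix.Norms.Frobenius in
lemma normF_neg (A : Matrix (Fin a) (Fin b) ℝ) : normF (-A) = normF A := by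
  unfold normF; exact norm_neg A

lemma normF_transpose (A : Matrix (Fin a) (Fin b) ℝ) : normF Aᵀ = normF A := by
  unfold normF; exact Matrix.frobenius_norm_transpose A

lemma normF_mul_le (A : Matrix (Fin a) (Fin b) ℝ) (B : Matrix (Fin b) (Fin c) ℝ) :
    normF (A * B) ≤ normF A * normF B := by
  unfold normF; exact Matrix.frobenius_norm_mul A B

lemma normF_mul_le_norm2_mul (A : Matrix (Fin a) (Fin b) ℝ) (B : Matrix (Fin b) (Fin c) ℝ) :
    normF (A * B) ≤ norm2 A * normF B := by
  refine le_of_sq_le_sq ?_ (mul_nonneg (norm2_nonneg _) (normF_nonneg _))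
  rw [mul_pow, normF_sq_eq_sum_col, normF_sq_eq_sum_col, Finset.mul_sum]
  refine Finset.sum_le_sum fun j _ => ?_
  rw [← mul_pow]
  refine pow_le_pow_left₀ (vnorm_nonneg _) ?_ 2
  exact vnorm_mulVec_le A (B.col j)

lemma normF_mul_le_mul_norm2 (A : Matrix (Fin a) (Fin b) ℝ) (B : Matrix (Fin b) (Fin c) ℝ) :
    normF (A * B) ≤ normF A * norm2 B := by
  have h := normF_mul_le_norm2_mul Bᵀ Aᵀ
  rwa [← Matrix.transpose_mul, normF_transpose, normF_transpose, norm2_transpose, mul_comm] at h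

lemma vnorm_mulVec_le_normF (A : Matrix (Fin a) (Fin b) ℝ) (v : Fin b → ℝ) :
    vnorm (A *ᵥ v) ≤ normF A * vnorm v := by
  refine le_of_sq_le_sq ?_ (mul_nonneg (normF_nonneg _) (vnorm_nonneg _))
  rw [mul_pow, vnorm_sq, normF_sq, Finset.sum_mul]
  refine Finset.sum_le_sum fun i _ => ?_
  rw [vnorm_sq]
  exact Finset.sum_mul_sq_le_sq_mul_sq Finset.univ (A i) v

lemma norm2_le_normF (A : Matrix (Fin a) (Fin b) ℝ) : norm2 A ≤ normF A :=
  norm2_le (normF_nonneg A) (vnorm_mulVec_le_normF A)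

lemma normF_le_of_forall_abs_le {A : Matrix (Fin a) (Fin a) ℝ} {κ : ℝ}
    (h : ∀ i j, |A i j| ≤ κ) (hκ : 0 ≤ κ) : normF A ≤ a * κ := by
  refine le_of_sq_le_sq ?_ (by positivity)
  rw [normF_sq]
  calc ∑ i, ∑ j, A i j ^ 2 ≤ ∑ _i : Fin a, ∑ _j : Fin a, κ ^ 2 :=
        Finset.sum_le_sum fun i _ => Finset.sum_le_sum fun j _ => by
          rw [← sq_abs]; exact pow_le_pow_left₀ (abs_nonneg _) (h i j) 2
    _ = (a * κ) ^ 2 := by simp; ring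

/-- A componentwise bound `|D| ≤ d |X| |Y|` turned into a bound in the Frobenius norm. -/
lemma normF_le_of_abs_le_mul {D : Matrix (Fin a) (Fin c) ℝ} {X : Matrix (Fin a) (Fin b) ℝ}
    {Y : Matrix (Fin b) (Fin c) ℝ} {d : ℝ} (hd : 0 ≤ d)
    (h : ∀ i j, |D i j| ≤ d * ∑ k, |X i k| * |Y k j|) : normF D ≤ d * (normF X * normF Y) := by
  have hX : normF (X.map abs) = normF X := by
    rw [← sq_eq_sq₀ (normF_nonneg _) (normF_nonneg _), normF_sq, normF_sq]; simp
  have hY : normF (Y.map abs) = normF Y := by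
    rw [← sq_eq_sq₀ (normF_nonneg _) (normF_nonneg _), normF_sq, normF_sq]; simp
  have h1 : normF D ≤ d * normF (X.map abs * Y.map abs) := by
    refine le_of_sq_le_sq ?_ (mul_nonneg hd (normF_nonneg _))
    rw [mul_pow, normF_sq, normF_sq, Finset.mul_sum]
    refine Finset.sum_le_sum fun i _ => ?_
    rw [Finset.mul_sum]
    refine Finset.sum_le_sum fun j _ => ?_
    rw [← mul_pow, ← sq_abs (D i j)]
    refine pow_le_pow_left₀ (abs_nonneg _) ?_ 2
    simpa [Matrix.mul_apply] using h i j
  refine h1.trans (mul_le_mul_of_nonneg_left ?_ hd)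
  exact (normF_mul_le _ _).trans_eq (by rw [hX, hY])

/-! ### The largest column norm -/

lemma gNorm_nonneg (A : Matrix (Fin a) (Fin b) ℝ) : 0 ≤ gNorm A :=
  Real.iSup_nonneg fun _ => Real.sqrt_nonneg _

lemma vnorm_col_le_gNorm (A : Matrix (Fin a) (Fin b) ℝ) (j : Fin b) :
    vnorm (A.col j) ≤ gNorm A := by
  rw [vnorm_eq_sqrt]
  exact le_ciSup (f := fun j => √(∑ i, A i j ^ 2)) (Set.finite_range _).bddAbove j

lemma gNorm_le {A : Matrix (Fin a) (Fin b) ℝ} {C : ℝ} (hC : 0 ≤ C)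
    (h : ∀ j, vnorm (A.col j) ≤ C) : gNorm A ≤ C := by
  refine Real.iSup_le (fun j => ?_) hC
  rw [← show _ = √(∑ i, A i j ^ 2) from vnorm_eq_sqrt (A.col j)]
  exact h j

lemma vnorm_single (j : Fin b) : vnorm (Pi.single j (1 : ℝ)) = 1 := by
  simp [vnorm]

lemma vnorm_col_eq (A : Matrix (Fin a) (Fin b) ℝ) (j : Fin b) :
    vnorm (A.col j) = vnorm (A *ᵥ Pi.single j 1) := by
  rw [Matrix.mulVec_single_one]

lemma gNorm_le_norm2 (A : Matrix (Fin a) (Fin b) ℝ) : gNorm A ≤ norm2 A := by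
  refine gNorm_le (norm2_nonneg A) fun j => ?_
  rw [vnorm_col_eq]
  simpa [vnorm_single] using vnorm_mulVec_le A (Pi.single j 1)

lemma gNorm_mul_le (A : Matrix (Fin a) (Fin b) ℝ) (B : Matrix (Fin b) (Fin c) ℝ) :
    gNorm (A * B) ≤ norm2 A * gNorm B := by
  refine gNorm_le (mul_nonneg (norm2_nonneg A) (gNorm_nonneg B)) fun j => ?_
  calc vnorm ((A * B).col j) = vnorm (A *ᵥ B.col j) := rfl
    _ ≤ norm2 A * vnorm (B.col j) := vnorm_mulVec_le _ _
    _ ≤ norm2 A * gNorm B := mul_le_mul_of_nonneg_left (vnorm_col_le_gNorm B j) (norm2_nonneg A)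

lemma gNorm_add_le (A B : Matrix (Fin a) (Fin b) ℝ) : gNorm (A + B) ≤ gNorm A + gNorm B :=
  gNorm_le (add_nonneg (gNorm_nonneg A) (gNorm_nonneg B)) fun j =>
    (vnorm_add_le (A.col j) (B.col j)).trans
      (add_le_add (vnorm_col_le_gNorm A j) (vnorm_col_le_gNorm B j))

lemma normF_sq_le_gNorm (A : Matrix (Fin a) (Fin b) ℝ) : normF A ^ 2 ≤ b * gNorm A ^ 2 := by
  rw [normF_sq_eq_sum_col]
  calc ∑ j, vnorm (A.col j) ^ 2 ≤ ∑ _j : Fin b, gNorm A ^ 2 :=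
        Finset.sum_le_sum fun j _ => pow_le_pow_left₀ (vnorm_nonneg _) (vnorm_col_le_gNorm A j) 2
    _ = b * gNorm A ^ 2 := by simp

lemma normF_mul_normF_le (A : Matrix (Fin a) (Fin c) ℝ) (B : Matrix (Fin b) (Fin c) ℝ) :
    normF A * normF B ≤ c * (gNorm A * gNorm B) := by
  refine le_of_sq_le_sq ?_
    (mul_nonneg (Nat.cast_nonneg _) (mul_nonneg (gNorm_nonneg A) (gNorm_nonneg B)))
  calc (normF A * normF B) ^ 2 = normF A ^ 2 * normF B ^ 2 := mul_pow ..
    _ ≤ (c * gNorm A ^ 2) * (c * gNorm B ^ 2) :=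
        mul_le_mul (normF_sq_le_gNorm A) (normF_sq_le_gNorm B) (sq_nonneg _) (by positivity)
    _ = (c * (gNorm A * gNorm B)) ^ 2 := by ring

/-- A componentwise bound `|D| ≤ d |X| |Y|` turned into a bound in the Frobenius norm, with the
column norms of the factors on the right. -/
lemma normF_le_gNorm_of_abs_le_mul {D : Matrix (Fin a) (Fin c) ℝ} {X : Matrix (Fin a) (Fin c) ℝ}
    {Y : Matrix (Fin c) (Fin c) ℝ} {d : ℝ} (hd : 0 ≤ d)
    (h : ∀ i j, |D i j| ≤ d * ∑ k, |X i k| * |Y k j|) :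
    normF D ≤ c * d * (gNorm X * gNorm Y) := by
  refine (normF_le_of_abs_le_mul hd h).trans ?_
  calc d * (normF X * normF Y) ≤ d * (c * (gNorm X * gNorm Y)) :=
        mul_le_mul_of_nonneg_left (normF_mul_normF_le X Y) hd
    _ = c * d * (gNorm X * gNorm Y) := by ring

lemma gNorm_le_normF (A : Matrix (Fin a) (Fin b) ℝ) : gNorm A ≤ normF A :=
  (gNorm_le_norm2 A).trans (norm2_le_normF A)

lemma gNorm_eq_pRatio_mul (A : Matrix (Fin a) (Fin b) ℝ) : gNorm A = pRatio A * norm2 A := by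
  unfold pRatio
  rcases eq_or_ne (norm2 A) 0 with h | h
  · rw [h, mul_zero]
    exact le_antisymm (h ▸ gNorm_le_norm2 A) (gNorm_nonneg A)
  · field_simp

lemma pRatio_nonneg (A : Matrix (Fin a) (Fin b) ℝ) : 0 ≤ pRatio A :=
  div_nonneg (gNorm_nonneg A) (norm2_nonneg A)

lemma pRatio_le_one (A : Matrix (Fin a) (Fin b) ℝ) : pRatio A ≤ 1 :=
  div_le_one_of_le₀ (gNorm_le_norm2 A) (norm2_nonneg A)

/-! ### The smallest singular value -/

lemma sigmaMin_mul_vnorm_le (A : Matrix (Fin a) (Fin b) ℝ) (v : Fin b → ℝ) :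
    sigmaMin A * vnorm v ≤ vnorm (A *ᵥ v) := by
  rcases Nat.eq_zero_or_pos b with rfl | hb
  · have h : vnorm v = 0 := by simp [vnorm_eq_sqrt]
    rw [h, mul_zero]; exact vnorm_nonneg _
  set L := Matrix.toEuclideanLin A with hL
  have hn : Module.finrank ℝ (EuclideanSpace ℝ (Fin b)) = b := by simp
  have hS := L.isSymmetric_adjoint_comp_self
  set x : EuclideanSpace ℝ (Fin b) := WithLp.toLp 2 v with hx
  have hsig : 0 ≤ sigmaMin A := L.singularValues_nonneg _
  refine le_of_sq_le_sq ?_ (vnorm_nonneg _)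
  have h1 : vnorm (A *ᵥ v) ^ 2 = inner ℝ ((LinearMap.adjoint L ∘ₗ L) x) x := by
    rw [LinearMap.comp_apply, LinearMap.adjoint_inner_left, real_inner_self_eq_norm_sq]
    rfl
  have h2 : inner ℝ ((LinearMap.adjoint L ∘ₗ L) x) x
      = ∑ i, hS.eigenvalues hn i * (hS.eigenvectorBasis hn).repr x i ^ 2 := by
    rw [← (hS.eigenvectorBasis hn).repr.inner_map_map, PiLp.inner_apply]
    refine Finset.sum_congr rfl fun i _ => ?_
    rw [hS.eigenvectorBasis_apply_self_apply hn x i]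
    simp; ring
  have h3 : vnorm v ^ 2 = ∑ i, (hS.eigenvectorBasis hn).repr x i ^ 2 := by
    have : vnorm v = ‖(hS.eigenvectorBasis hn).repr x‖ := by
      rw [LinearIsometryEquiv.norm_map]; rfl
    rw [this, EuclideanSpace.norm_sq_eq]; simp
  rw [mul_pow, h1, h2, h3, Finset.mul_sum]
  refine Finset.sum_le_sum fun i _ => mul_le_mul_of_nonneg_right ?_ (sq_nonneg _)
  rw [← L.sq_singularValues_fin hn i]
  refine pow_le_pow_left₀ hsig ?_ 2
  exact L.singularValues_antitone (by have := i.isLt; omega)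

lemma sigmaMin_pos {A : Matrix (Fin a) (Fin b) ℝ} (hb : 1 ≤ b) (hA : A.rank = b) :
    0 < sigmaMin A := by
  unfold sigmaMin
  rw [LinearMap.singularValues_pos_iff_lt_finrank_range]
  have : Module.finrank ℝ (LinearMap.range (Matrix.toEuclideanLin A)) = A.rank := by
    rw [Matrix.rank_eq_finrank_range_toLin A (EuclideanSpace.basisFun _ ℝ).toBasis
      (EuclideanSpace.basisFun _ ℝ).toBasis]
    congr 2
  omega

end norms

/-! ### Products of rounding factors -/

section kernels

open Matrix Finset

lemma exp_sub_sq_le_one_add {δ : ℝ} (h : |δ| ≤ 1 / 2) : Real.exp (δ - δ ^ 2) ≤ 1 + δ := by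
  obtain ⟨h1, h2⟩ := abs_le.1 h
  have hpos : 0 < Real.exp (δ ^ 2 - δ) := Real.exp_pos _
  have key : 1 ≤ (1 + δ) * Real.exp (δ ^ 2 - δ) := by
    rcases le_total 0 δ with h0 | h0
    · have := Real.add_one_le_exp (δ ^ 2 - δ)
      nlinarith [pow_nonneg h0 3]
    · have h3 := Real.quadratic_le_exp_of_nonneg (x := δ ^ 2 - δ) (by nlinarith)
      have h4 : 0 ≤ δ + (1 + δ) * (1 - δ) ^ 2 / 2 := by nlinarith [sq_nonneg (δ + 1 / 2)]
      nlinarith [mul_nonneg (sq_nonneg δ) h4]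
  have : Real.exp (δ - δ ^ 2) * Real.exp (δ ^ 2 - δ) = 1 := by
    rw [← Real.exp_add]; simp
  nlinarith

lemma prod_one_add_le_exp {ι : Type*} (S : Finset ι) {η : ι → ℝ} {u : ℝ} (hu : u ≤ 1 / 2)
    (hη : ∀ i, |η i| ≤ u) : ∏ i ∈ S, (1 + η i) ≤ Real.exp (∑ i ∈ S, η i) := by
  rw [Real.exp_sum]
  refine Finset.prod_le_prod (fun i _ => ?_) fun i _ => ?_
  · linarith [(abs_le.1 (hη i)).1]
  · linarith [Real.add_one_le_exp (η i)]

lemma exp_le_prod_one_add {ι : Type*} (S : Finset ι) {η : ι → ℝ} {u : ℝ} (hu : u ≤ 1 / 2)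
    (hη : ∀ i, |η i| ≤ u) :
    Real.exp (∑ i ∈ S, η i - #S * u ^ 2) ≤ ∏ i ∈ S, (1 + η i) := by
  have : ∑ i ∈ S, η i - #S * u ^ 2 = ∑ i ∈ S, (η i - u ^ 2) := by
    simp [Finset.sum_sub_distrib]
  rw [this, Real.exp_sum]
  refine Finset.prod_le_prod (fun i _ => (Real.exp_pos _).le) fun i _ => ?_
  refine le_trans (Real.exp_le_exp.2 ?_) (exp_sub_sq_le_one_add ((hη i).trans hu))
  have := pow_le_pow_left₀ (abs_nonneg _) (hη i) 2
  rw [sq_abs] at this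
  linarith

lemma abs_sub_one_le_exp_sub_one {z y : ℝ} (h1 : Real.exp (-y) ≤ z) (h2 : z ≤ Real.exp y) :
    |z - 1| ≤ Real.exp y - 1 := by
  have h3 : Real.exp (-y) * Real.exp y = 1 := by rw [← Real.exp_add]; simp
  rw [abs_le]
  refine ⟨?_, by linarith⟩
  nlinarith [sq_nonneg (Real.exp y - 1), Real.exp_pos y, Real.exp_pos (-y),
    sq_nonneg (Real.exp y - Real.exp (-y)), sq_nonneg (Real.exp y + Real.exp (-y) - 2)]

lemma exp_le_one_add {δ u : ℝ} (hu : u ≤ 1 / 2) (hδ : |δ| ≤ u) :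
    Real.exp (-(u + u ^ 2)) ≤ 1 + δ ∧ 1 + δ ≤ Real.exp u := by
  have h := abs_le.1 hδ
  constructor
  · refine le_trans (Real.exp_le_exp.2 ?_) (exp_sub_sq_le_one_add (hδ.trans hu))
    nlinarith
  · exact le_trans (by linarith) (Real.add_one_le_exp u)

/-! ### Sums -/

lemma flSum_eq : ∀ {k : ℕ} (x α : Fin k → ℝ),
    flSum x α = ∑ l, x l * ∏ i with l ≤ i ∧ 0 < i.val, (1 + α i)
  | 0, _, _ => by simp [flSum]
  | 1, x, α => by simp [flSum]
  | k + 2, x, α => by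
    rw [flSum, flSum_eq, Fin.sum_univ_castSucc (n := k + 1), add_mul, Finset.sum_mul]
    congr 1
    · refine Finset.sum_congr rfl fun l _ => ?_
      rw [mul_assoc]
      congr 1
      simp_rw [Finset.prod_filter]
      rw [Fin.prod_univ_castSucc (n := k + 1)]
      have hl : l.castSucc ≤ Fin.last (k + 1) := Fin.le_last _
      simp [hl]
    · congr 1
      rw [Finset.prod_filter, Fin.prod_univ_castSucc]
      have h : ∀ i : Fin (k + 1), ¬ (Fin.last (k + 1) ≤ i.castSucc) := fun i =>
        not_le.2 (Fin.castSucc_lt_last i)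
      simp [h]

/-- Backward error of a computed matrix product, in terms of a bound on the tail sums of the
addition errors. -/
lemma abs_flMul_sub_le {a b c : ℕ} (X : Matrix (Fin a) (Fin b) ℝ) (Y : Matrix (Fin b) (Fin c) ℝ)
    (ε α : Fin a → Fin c → Fin b → ℝ) {u t : ℝ} (hu : u ≤ 1 / 2) (i : Fin a) (j : Fin c)
    (hε : ∀ k, |ε i j k| ≤ u) (hα : ∀ k, |α i j k| ≤ u)
    (ht : ∀ k : Fin b, |∑ l with k ≤ l ∧ 0 < l.val, α i j l| ≤ t) :
    |flMul X Y ε α i j - (X * Y) i j|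
      ≤ (Real.exp (t + u + (b + 1) * u ^ 2) - 1) * ∑ k, |X i k| * |Y k j| := by
  have heq : flMul X Y ε α i j - (X * Y) i j = ∑ k, X i k * Y k j *
      ((1 + ε i j k) * ∏ l with k ≤ l ∧ 0 < l.val, (1 + α i j l) - 1) := by
    simp only [flMul, Matrix.of_apply, flSum_eq, Matrix.mul_apply, ← Finset.sum_sub_distrib]
    exact Finset.sum_congr rfl fun k _ => by ring
  rw [heq, Finset.mul_sum]
  refine (Finset.abs_sum_le_sum_abs _ _).trans (Finset.sum_le_sum fun k _ => ?_)
  rw [abs_mul, abs_mul, mul_comm]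
  refine mul_le_mul_of_nonneg_right ?_ (by positivity)
  set S : Finset (Fin b) := {l | k ≤ l ∧ 0 < l.val}
  have h1 := exp_le_prod_one_add S hu hα
  have h2 := prod_one_add_le_exp S hu hα
  have h3 := abs_le.1 (ht k)
  obtain ⟨h4, h5⟩ := exp_le_one_add hu (hε k)
  have hcard : (#S : ℝ) ≤ b := by
    have := Finset.card_le_univ S
    rw [Fintype.card_fin] at this
    exact_mod_cast this
  have hcu : (#S : ℝ) * u ^ 2 ≤ b * u ^ 2 := mul_le_mul_of_nonneg_right hcard (sq_nonneg u)
  have hb : 0 ≤ (b : ℝ) * u ^ 2 := by positivity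
  apply abs_sub_one_le_exp_sub_one
  · calc Real.exp (-(t + u + (b + 1) * u ^ 2))
        ≤ Real.exp (-(u + u ^ 2)) * Real.exp (∑ i_1 ∈ S, α i j i_1 - #S * u ^ 2) := by
          rw [← Real.exp_add]; exact Real.exp_le_exp.2 (by linarith)
      _ ≤ _ := mul_le_mul h4 h1 (Real.exp_pos _).le ((Real.exp_pos _).le.trans h4)
  · calc _ ≤ Real.exp u * Real.exp (∑ i_1 ∈ S, α i j i_1) :=
          mul_le_mul h5 h2 ((Real.exp_pos _).le.trans h1) (Real.exp_pos _).le
      _ ≤ Real.exp (t + u + (b + 1) * u ^ 2) := by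
          rw [← Real.exp_add]
          exact Real.exp_le_exp.2 (by nlinarith [sq_nonneg u])

/-! ### Substitution steps -/

lemma flSubDot_eq (a : ℝ) : ∀ {k : ℕ} (x y ε η : Fin k → ℝ), (∀ i, 1 + η i ≠ 0) →
    flSubDot a x y ε η = (∏ i, (1 + η i)) *
      (a - ∑ l, x l * y l * ((1 + ε l) / ∏ i with i.val < l.val, (1 + η i)))
  | 0, _, _, _, _, _ => by simp [flSubDot]
  | k + 1, x, y, ε, η, h => by
    rw [flSubDot, flSubDot_eq a _ _ _ _ fun i => h i.castSucc, Fin.prod_univ_castSucc,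
      Fin.sum_univ_castSucc]
    have e1 : ∀ l : Fin k, ∏ i : Fin (k + 1) with i.val < l.castSucc.val, (1 + η i)
        = ∏ i : Fin k with i.val < l.val, (1 + η i.castSucc) := fun l => by
      simp_rw [Finset.prod_filter]
      rw [Fin.prod_univ_castSucc]
      have : ¬ k < l.val := by have := l.isLt; omega
      simp [this]
    have e2 : ∏ i : Fin (k + 1) with i.val < (Fin.last k).val, (1 + η i)
        = ∏ i : Fin k, (1 + η i.castSucc) := by
      simp_rw [Finset.prod_filter]
      rw [Fin.prod_univ_castSucc]
      simp
    simp_rw [e1, e2]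
    have : ∏ i : Fin k, (1 + η i.castSucc) ≠ 0 := Finset.prod_ne_zero_iff.2 fun i _ => h _
    field_simp
    ring

/-- Backward error of `flSubDot`: up to the factor `ρ`, the computed value is the exact value for
slightly perturbed products.  The hypothesis bounds the initial sums of the subtraction errors. -/
lemma flSubDot_backward (a : ℝ) {k : ℕ} (x y ε η : Fin k → ℝ) {u t : ℝ} (hu : u ≤ 1 / 2)
    (hε : ∀ i, |ε i| ≤ u) (hη : ∀ i, |η i| ≤ u)
    (ht : ∀ l ≤ k, |∑ i : Fin k with i.val < l, η i| ≤ t) :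
    ∃ (ρ : ℝ) (θ : Fin k → ℝ), Real.exp (-t) ≤ ρ ∧ ρ ≤ Real.exp (t + k * u ^ 2) ∧
      (∀ l, |θ l| ≤ Real.exp (t + u + (k + 1) * u ^ 2) - 1) ∧
      flSubDot a x y ε η * ρ = a - ∑ l, x l * y l * (1 + θ l) := by
  have hpos : ∀ i, 0 < 1 + η i := fun i => by linarith [(abs_le.1 (hη i)).1]
  have hprod : ∀ l ≤ k, Real.exp (-t) ≤ (∏ i : Fin k with i.val < l, (1 + η i))⁻¹ ∧
      (∏ i : Fin k with i.val < l, (1 + η i))⁻¹ ≤ Real.exp (t + k * u ^ 2) := by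
    intro l hl
    set S : Finset (Fin k) := {i | i.val < l}
    have h1 := exp_le_prod_one_add S hu hη
    have h2 := prod_one_add_le_exp S hu hη
    have h3 := abs_le.1 (ht l hl)
    have hP : 0 < ∏ i ∈ S, (1 + η i) := Finset.prod_pos fun i _ => hpos i
    have hcard : (#S : ℝ) ≤ k := by
      have := Finset.card_le_univ S
      rw [Fintype.card_fin] at this
      exact_mod_cast this
    have hcu : (#S : ℝ) * u ^ 2 ≤ k * u ^ 2 := mul_le_mul_of_nonneg_right hcard (sq_nonneg u)
    constructor
    · rw [Real.exp_neg]
      exact inv_anti₀ hP (h2.trans (Real.exp_le_exp.2 h3.2))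
    · rw [← neg_neg (t + k * u ^ 2), Real.exp_neg]
      exact inv_anti₀ (Real.exp_pos _) (le_trans (Real.exp_le_exp.2 (by linarith)) h1)
  have huniv : ({i | i.val < k} : Finset (Fin k)) = Finset.univ := by
    ext i; simp
  refine ⟨(∏ i : Fin k with i.val < k, (1 + η i))⁻¹,
    fun l => (1 + ε l) / (∏ i with i.val < l.val, (1 + η i)) - 1, (hprod k le_rfl).1,
    (hprod k le_rfl).2, fun l => ?_, ?_⟩
  · obtain ⟨h1, h2⟩ := hprod l.val l.isLt.le
    obtain ⟨h4, h5⟩ := exp_le_one_add hu (hε l)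
    have hk : 0 ≤ (k : ℝ) * u ^ 2 := by positivity
    beta_reduce
    rw [div_eq_mul_inv]
    apply abs_sub_one_le_exp_sub_one
    · calc Real.exp (-(t + u + (k + 1) * u ^ 2)) ≤ Real.exp (-(u + u ^ 2)) * Real.exp (-t) := by
            rw [← Real.exp_add]; exact Real.exp_le_exp.2 (by linarith)
        _ ≤ _ := mul_le_mul h4 h1 (Real.exp_pos _).le ((Real.exp_pos _).le.trans h4)
    · calc _ ≤ Real.exp u * Real.exp (t + k * u ^ 2) :=
            mul_le_mul h5 h2 ((Real.exp_pos _).le.trans h1) (Real.exp_pos _).le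
        _ ≤ Real.exp (t + u + (k + 1) * u ^ 2) := by
            rw [← Real.exp_add]
            exact Real.exp_le_exp.2 (by nlinarith [sq_nonneg u])
  · rw [flSubDot_eq a x y ε η fun i => (hpos i).ne', huniv, mul_comm, ← mul_assoc,
      inv_mul_cancel₀ (Finset.prod_ne_zero_iff.2 fun i _ => (hpos i).ne'), one_mul]
    simp

lemma sum_castLE_eq {a b : ℕ} (h : a ≤ b) (f : Fin b → ℝ) (p : ℕ → Prop) [DecidablePred p] :
    ∑ k : Fin a with p k.val, f (k.castLE h) = ∑ k : Fin b with k.val < a ∧ p k.val, f k := by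
  refine Finset.sum_bij (fun k _ => k.castLE h) ?_ ?_ ?_ ?_
  · intro k hk; simpa using hk
  · intro k _ l _ hkl; exact Fin.castLE_injective h hkl
  · intro k hk
    simp only [Finset.mem_filter, Finset.mem_univ, true_and] at hk
    exact ⟨⟨k.val, hk.1⟩, by simpa using hk.2, rfl⟩
  · intros; rfl

lemma sum_castLE_eq_sum_lt {n : ℕ} (i : Fin n) (f : Fin n → ℝ) :
    ∑ k : Fin i.val, f (k.castLE i.isLt.le) = ∑ k with k < i, f k := by
  have h := sum_castLE_eq i.isLt.le f (fun _ => True)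
  simpa using h

lemma sum_castLE_eq_sum_val_lt {n : ℕ} (i : Fin n) (f : Fin n → ℝ) {l : ℕ} (hl : l ≤ i.val) :
    ∑ k : Fin i.val with k.val < l, f (k.castLE i.isLt.le) = ∑ k with k.val < l, f k := by
  rw [sum_castLE_eq i.isLt.le f (fun k => k < l)]
  congr 1
  ext k
  simp only [Finset.mem_filter, Finset.mem_univ, true_and, and_iff_right_iff_imp]
  omega

/-- `flSubDot_backward` for a substitution step that runs over the indices below `i`. -/
lemma flSubDot_castLE_backward {n : ℕ} (a : ℝ) (i : Fin n) (x y ε η : Fin n → ℝ) {u t : ℝ}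
    (hu : u ≤ 1 / 2) (hε : ∀ k, |ε k| ≤ u) (hη : ∀ k, |η k| ≤ u)
    (ht : ∀ l ≤ i.val, |∑ k with k.val < l, η k| ≤ t) :
    ∃ (ρ : ℝ) (θ : Fin n → ℝ), Real.exp (-t) ≤ ρ ∧ ρ ≤ Real.exp (t + (n - 1) * u ^ 2) ∧
      (∀ l, |θ l| ≤ Real.exp (t + u + n * u ^ 2) - 1) ∧
      flSubDot a (k := i.val) (fun k => x (k.castLE i.isLt.le)) (fun k => y (k.castLE i.isLt.le))
        (fun k => ε (k.castLE i.isLt.le)) (fun k => η (k.castLE i.isLt.le)) * ρ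
        = a - ∑ l with l < i, x l * y l * (1 + θ l) := by
  obtain ⟨ρ, θ, h1, h2, h3, h4⟩ := flSubDot_backward a
    (fun k : Fin i.val => x (k.castLE i.isLt.le)) (fun k => y (k.castLE i.isLt.le))
    (fun k => ε (k.castLE i.isLt.le)) (fun k => η (k.castLE i.isLt.le)) hu (fun _ => hε _)
    (fun _ => hη _) (t := t) (fun l hl => by rw [sum_castLE_eq_sum_val_lt i η hl]; exact ht l hl)
  have hi : (i.val : ℝ) ≤ n - 1 := by
    have : (i.val : ℝ) + 1 ≤ n := by exact_mod_cast i.isLt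
    linarith
  have hiu : (i.val : ℝ) * u ^ 2 ≤ (n - 1) * u ^ 2 := mul_le_mul_of_nonneg_right hi (sq_nonneg u)
  have ht0 : 0 ≤ t := (abs_nonneg _).trans (ht 0 (Nat.zero_le _))
  have hu0 : 0 ≤ u := (abs_nonneg _).trans (hε i)
  have hn : 0 ≤ (n : ℝ) * u ^ 2 := by positivity
  refine ⟨ρ, fun l => if h : l.val < i.val then θ ⟨l.val, h⟩ else 0, h1,
    h2.trans (Real.exp_le_exp.2 (by linarith)), fun l => ?_, ?_⟩
  · beta_reduce
    split_ifs with h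
    · refine (h3 _).trans (sub_le_sub_right (Real.exp_le_exp.2 ?_) 1)
      linarith
    · rw [abs_zero, sub_nonneg]
      exact Real.one_le_exp (by linarith)
  · rw [h4, ← sum_castLE_eq_sum_lt i]
    simp

end kernels

section substitution

open Matrix Finset

lemma inv_one_add_bounds {ζ u : ℝ} (hu : u ≤ 1 / 2) (hζ : |ζ| ≤ u) :
    Real.exp (-u) ≤ (1 + ζ)⁻¹ ∧ (1 + ζ)⁻¹ ≤ Real.exp (u + u ^ 2) := by
  obtain ⟨h1, h2⟩ := exp_le_one_add hu hζ
  have hpos := (Real.exp_pos _).trans_le h1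
  constructor
  · rw [Real.exp_neg]; exact inv_anti₀ hpos h2
  · rw [← neg_neg (u + u ^ 2), Real.exp_neg]; exact inv_anti₀ (Real.exp_pos _) h1

/-- The two facts about the rounding errors of a family of substitution steps that its backward
error analysis uses: every error is at most `u` in absolute value, and the initial sums of the
subtraction errors of the steps selected by `p` are at most `t`. -/
structure SubstErrors {a n : ℕ} (p : Fin a → Fin n → ℕ → Prop) (u t : ℝ)
    (ε η : Fin a → Fin n → Fin n → ℝ) (ζ : Fin a → Fin n → ℝ) : Prop where
  mul : ∀ i j k, |ε i j k| ≤ u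
  sub : ∀ i j k, |η i j k| ≤ u
  div : ∀ i j, |ζ i j| ≤ u
  sum : ∀ i j l, p i j l → |∑ k with k.val < l, η i j k| ≤ t

/-! ### Triangular systems -/

/-- The computed solution `Q` of `Q V = X` satisfies `|Q V - X| ≤ d |Q| |V|`. -/
lemma abs_flSolve_mul_sub_le {m n : ℕ} (X : Matrix (Fin m) (Fin n) ℝ)
    (V : Matrix (Fin n) (Fin n) ℝ) {ε η : Fin m → Fin n → Fin n → ℝ} {ζ : Fin m → Fin n → ℝ}
    {u t : ℝ} (hu : u ≤ 1 / 2) (H : SubstErrors (fun _ j l => l ≤ j.val) u t ε η ζ)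
    (hV : ∀ k j, j < k → V k j = 0) (hV0 : ∀ j, V j j ≠ 0) (i : Fin m) (j : Fin n) :
    |(flSolve X V ε η ζ * V - X) i j| ≤
      (Real.exp (t + u + n * u ^ 2) - 1) * ∑ k, |flSolve X V ε η ζ i k| * |V k j| := by
  set Q := flSolve X V ε η ζ with hQ
  obtain ⟨ρ, θ, h1, h2, h3, h4⟩ := flSubDot_castLE_backward (X i j) j (fun k => Q i k)
    (fun k => V k j) (ε i j) (η i j) hu (H.mul i j) (H.sub i j) (H.sum i j)
  have hent : Q i j = flSubDot (X i j) (k := j.val)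
      (fun k => Q i (k.castLE j.isLt.le)) (fun k => V (k.castLE j.isLt.le) j)
      (fun k => ε i j (k.castLE j.isLt.le)) (fun k => η i j (k.castLE j.isLt.le))
      / V j j * (1 + ζ i j) := by
    simp only [hQ, flSolve, Matrix.of_apply]
    rw [flSolveEntry]
  set s := flSubDot (X i j) (k := j.val)
      (fun k => Q i (k.castLE j.isLt.le)) (fun k => V (k.castLE j.isLt.le) j)
      (fun k => ε i j (k.castLE j.isLt.le)) (fun k => η i j (k.castLE j.isLt.le))
  obtain ⟨h5, h6⟩ := inv_one_add_bounds hu (H.div i j)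
  have hζ : 0 < 1 + ζ i j := by
    have := (Real.exp_pos _).trans_le h5
    simpa using this
  have hs : s = Q i j * V j j * (1 + ζ i j)⁻¹ := by
    rw [hent]; field_simp [hV0 j]
  rw [hs] at h4
  set θ' : Fin n → ℝ := fun k => if k < j then θ k else if k = j then (1 + ζ i j)⁻¹ * ρ - 1 else 0
  have hsum : ∑ k, Q i k * V k j * (1 + θ' k) = X i j := by
    have hsplit : ∑ k, Q i k * V k j * (1 + θ' k)
        = ∑ k, ((if k < j then Q i k * V k j * (1 + θ k) else 0)
          + if k = j then Q i j * V j j * ((1 + ζ i j)⁻¹ * ρ) else 0) := by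
      refine Finset.sum_congr rfl fun k _ => ?_
      rcases lt_trichotomy k j with h | h | h
      · simp [θ', h, h.ne]
      · subst h; simp [θ']
      · simp [hV k j h, h.not_gt, h.ne']
    rw [hsplit, Finset.sum_add_distrib, ← Finset.sum_filter]
    simp only [Finset.sum_ite_eq', Finset.mem_univ, if_true]
    linarith
  have ht0 : 0 ≤ t := (abs_nonneg _).trans (H.sum i j 0 (Nat.zero_le _))
  have hu0 : 0 ≤ u := (abs_nonneg _).trans (H.div i j)
  have hn1 : (1 : ℝ) ≤ n := by exact_mod_cast (Nat.succ_le_of_lt (Nat.zero_le _ |>.trans_lt j.isLt))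
  have hn : 0 ≤ (n : ℝ) * u ^ 2 := by positivity
  have hθ' : ∀ k, |θ' k| ≤ Real.exp (t + u + n * u ^ 2) - 1 := by
    intro k
    simp only [θ']
    split_ifs with h h'
    · exact h3 k
    · apply abs_sub_one_le_exp_sub_one
      · calc Real.exp (-(t + u + n * u ^ 2)) ≤ Real.exp (-u) * Real.exp (-t) := by
              rw [← Real.exp_add]; exact Real.exp_le_exp.2 (by linarith)
          _ ≤ _ := mul_le_mul h5 h1 (Real.exp_pos _).le (by positivity)
      · calc _ ≤ Real.exp (u + u ^ 2) * Real.exp (t + (n - 1) * u ^ 2) :=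
              mul_le_mul h6 h2 ((Real.exp_pos _).le.trans h1) (Real.exp_pos _).le
          _ = Real.exp (t + u + n * u ^ 2) := by rw [← Real.exp_add]; ring_nf
    · rw [abs_zero, sub_nonneg]
      exact Real.one_le_exp (by linarith)
  have heq : (Q * V - X) i j = -∑ k, Q i k * V k j * θ' k := by
    rw [Matrix.sub_apply, Matrix.mul_apply, ← hsum, ← Finset.sum_sub_distrib,
      ← Finset.sum_neg_distrib]
    exact Finset.sum_congr rfl fun k _ => by ring
  rw [heq, abs_neg, Finset.mul_sum]
  refine (Finset.abs_sum_le_sum_abs _ _).trans (Finset.sum_le_sum fun k _ => ?_)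
  rw [abs_mul, abs_mul, mul_comm]
  exact mul_le_mul_of_nonneg_right (hθ' k) (by positivity)

/-! ### Cholesky factorization -/

variable {n : ℕ}

lemma cholError_nonneg {ε η : Fin n → Fin n → Fin n → ℝ} {ζ : Fin n → Fin n → ℝ} {u t : ℝ}
    (H : SubstErrors (fun i j l => i ≤ j ∧ l ≤ i.val) u t ε η ζ) (i : Fin n) :
    0 ≤ t + u + n * u ^ 2 ∧ t + u + n * u ^ 2 ≤ t + 2 * u + (n + 1) * u ^ 2 := by
  have ht0 : 0 ≤ t := (abs_nonneg _).trans (H.sum i i 0 ⟨le_rfl, Nat.zero_le _⟩)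
  have hu0 : 0 ≤ u := (abs_nonneg _).trans (H.div i i)
  have hn : 0 ≤ (n : ℝ) * u ^ 2 := by positivity
  constructor
  · linarith
  · nlinarith [sq_nonneg u]

/-- The computed number whose square root is the `i`-th diagonal entry of the Cholesky factor. -/
noncomputable def cholPivot (A : Matrix (Fin n) (Fin n) ℝ) (ε η : Fin n → Fin n → Fin n → ℝ)
    (ζ : Fin n → Fin n → ℝ) (i : Fin n) : ℝ :=
  flSubDot (A i i) (k := i.val)
    (fun k => flChol A ε η ζ (k.castLE i.isLt.le) i)
    (fun k => flChol A ε η ζ (k.castLE i.isLt.le) i)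
    (fun k => ε i i (k.castLE i.isLt.le)) (fun k => η i i (k.castLE i.isLt.le))

section

variable (A : Matrix (Fin n) (Fin n) ℝ) {ε η : Fin n → Fin n → Fin n → ℝ}
  {ζ : Fin n → Fin n → ℝ} {u t : ℝ}

lemma flChol_lower {i j : Fin n} (h : j < i) : flChol A ε η ζ i j = 0 := by
  simp only [flChol, Matrix.of_apply]
  rw [flCholEntry, if_neg h.ne', dif_neg h.not_gt]

lemma flChol_diag (i : Fin n) :
    flChol A ε η ζ i i = √(cholPivot A ε η ζ i) * (1 + ζ i i) := by
  simp only [cholPivot, flChol, Matrix.of_apply]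
  rw [flCholEntry, if_pos rfl]

lemma flChol_upper {i j : Fin n} (h : i < j) :
    flChol A ε η ζ i j = flSubDot (A i j) (k := i.val)
      (fun k => flChol A ε η ζ (k.castLE i.isLt.le) i)
      (fun k => flChol A ε η ζ (k.castLE i.isLt.le) j)
      (fun k => ε i j (k.castLE i.isLt.le)) (fun k => η i j (k.castLE i.isLt.le))
      / flChol A ε η ζ i i * (1 + ζ i j) := by
  simp only [flChol, Matrix.of_apply]
  rw [flCholEntry, if_neg h.ne, dif_pos h]

variable (hu : u ≤ 1 / 2) (H : SubstErrors (fun i j l => i ≤ j ∧ l ≤ i.val) u t ε η ζ)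

include hu H

lemma flChol_diag_pos {i : Fin n} (hi : 0 < cholPivot A ε η ζ i) : 0 < flChol A ε η ζ i i := by
  rw [flChol_diag]
  have := (abs_le.1 (H.div i i)).1
  exact mul_pos (Real.sqrt_pos.2 hi) (by linarith)

/-- A failing pivot means that the diagonal entry of `A` is not much larger than the part of it
that the earlier rows account for. -/
lemma diag_le_of_cholPivot_nonpos {i : Fin n} (hi : cholPivot A ε η ζ i ≤ 0) :
    A i i ≤ Real.exp (t + 2 * u + (n + 1) * u ^ 2) *
      ∑ k with k < i, flChol A ε η ζ k i ^ 2 := by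
  obtain ⟨ρ, θ, h1, -, h3, h4⟩ := flSubDot_castLE_backward (A i i) i
    (fun k => flChol A ε η ζ k i) (fun k => flChol A ε η ζ k i) (ε i i) (η i i) hu (H.mul i i)
    (H.sub i i) (fun l hl => H.sum i i l ⟨le_rfl, hl⟩)
  have hρ : 0 < ρ := (Real.exp_pos _).trans_le h1
  have hle : A i i - ∑ l with l < i,
      flChol A ε η ζ l i * flChol A ε η ζ l i * (1 + θ l) ≤ 0 := by
    rw [← h4]; exact mul_nonpos_of_nonpos_of_nonneg hi hρ.le
  refine (sub_nonpos.1 hle).trans ?_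
  rw [Finset.mul_sum]
  refine Finset.sum_le_sum fun k _ => ?_
  have h5 := (abs_le.1 (h3 k)).2
  have h6 := Real.exp_le_exp.2 (cholError_nonneg H i).2
  nlinarith [sq_nonneg (flChol A ε η ζ k i)]

/-- Row `i` of the computed factor reproduces row `i` of the upper triangle of `A`. -/
lemma abs_sum_flChol_sub_le {i j : Fin n} (hij : i ≤ j) (hi : 0 < cholPivot A ε η ζ i) :
    |∑ k, flChol A ε η ζ k i * flChol A ε η ζ k j - A i j| ≤
      (Real.exp (t + 2 * u + (n + 1) * u ^ 2) - 1) *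
        ∑ k with k ≤ i, |flChol A ε η ζ k i| * |flChol A ε η ζ k j| := by
  set V := flChol A ε η ζ with hV
  obtain ⟨ρ, θ, h1, h2, h3, h4⟩ := flSubDot_castLE_backward (A i j) i (fun k => V k i)
    (fun k => V k j) (ε i j) (η i j) hu (H.mul i j) (H.sub i j)
    (fun l hl => H.sum i j l ⟨hij, hl⟩)
  obtain ⟨h5, h6⟩ := inv_one_add_bounds hu (H.div i j)
  have hVi : 0 < V i i := flChol_diag_pos A hu H hi
  have hρ : 0 < ρ := (Real.exp_pos _).trans_le h1
  obtain ⟨hd0, hd1⟩ := cholError_nonneg H i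
  have hu0 : 0 ≤ u := (abs_nonneg _).trans (H.div i j)
  have ht0 : 0 ≤ t := (abs_nonneg _).trans (H.sum i i 0 ⟨le_rfl, Nat.zero_le _⟩)
  have hn1 : 0 ≤ (n : ℝ) * u ^ 2 := by positivity
  have hlast : ∃ z : ℝ, |z - 1| ≤ Real.exp (t + 2 * u + (n + 1) * u ^ 2) - 1 ∧
      V i i * V i j * z = A i j - ∑ l with l < i, V l i * V l j * (1 + θ l) := by
    have hζ : 0 < 1 + ζ i j := by
      have := (Real.exp_pos _).trans_le h5
      simpa using this
    rcases hij.eq_or_lt with rfl | hlt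
    · have hVd : V i i = √(cholPivot A ε η ζ i) * (1 + ζ i i) := flChol_diag A i
      refine ⟨(1 + ζ i i)⁻¹ * (1 + ζ i i)⁻¹ * ρ, ?_, ?_⟩
      · apply abs_sub_one_le_exp_sub_one
        · calc Real.exp (-(t + 2 * u + (n + 1) * u ^ 2))
                ≤ Real.exp (-u) * Real.exp (-u) * Real.exp (-t) := by
                rw [← Real.exp_add, ← Real.exp_add]
                exact Real.exp_le_exp.2 (by nlinarith [sq_nonneg u])
            _ ≤ _ := by gcongr
        · calc _ ≤ Real.exp (u + u ^ 2) * Real.exp (u + u ^ 2)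
                  * Real.exp (t + (n - 1) * u ^ 2) := by gcongr
            _ = Real.exp (t + 2 * u + (n + 1) * u ^ 2) := by
                rw [← Real.exp_add, ← Real.exp_add]; ring_nf
      · rw [← h4, hVd]
        have hsq := Real.mul_self_sqrt hi.le
        have : √(cholPivot A ε η ζ i) * (1 + ζ i i) * (√(cholPivot A ε η ζ i) * (1 + ζ i i)) *
            ((1 + ζ i i)⁻¹ * (1 + ζ i i)⁻¹ * ρ)
            = √(cholPivot A ε η ζ i) * √(cholPivot A ε η ζ i) * ρ := by
          field_simp
        rw [this, hsq]
        rfl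
    · have hVu : V i j = _ := flChol_upper A hlt
      refine ⟨(1 + ζ i j)⁻¹ * ρ, ?_, ?_⟩
      · refine le_trans (abs_sub_one_le_exp_sub_one (y := t + u + n * u ^ 2) ?_ ?_)
          (sub_le_sub_right (Real.exp_le_exp.2 hd1) 1)
        · calc Real.exp (-(t + u + n * u ^ 2)) ≤ Real.exp (-u) * Real.exp (-t) := by
                rw [← Real.exp_add]; exact Real.exp_le_exp.2 (by linarith)
            _ ≤ _ := by gcongr
        · calc _ ≤ Real.exp (u + u ^ 2) * Real.exp (t + (n - 1) * u ^ 2) := by gcongr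
            _ = Real.exp (t + u + n * u ^ 2) := by rw [← Real.exp_add]; ring_nf
      · rw [← h4]
        simp only [← hV] at hVu
        set s := flSubDot (A i j) (k := i.val) (fun k => V (k.castLE i.isLt.le) i)
          (fun k => V (k.castLE i.isLt.le) j)
          (fun k => ε i j (k.castLE i.isLt.le)) (fun k => η i j (k.castLE i.isLt.le))
        rw [hVu]
        field_simp
  obtain ⟨z, hz, hzeq⟩ := hlast
  set θ' : Fin n → ℝ := fun k => if k = i then z - 1 else θ k
  have hIic : ({k | k ≤ i} : Finset (Fin n)) = insert i ({k | k < i} : Finset (Fin n)) := by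
    ext k; simp [le_iff_eq_or_lt]
  have hni : i ∉ ({k | k < i} : Finset (Fin n)) := by simp
  have hsumA : ∑ k with k ≤ i, V k i * V k j * (1 + θ' k) = A i j := by
    rw [hIic, Finset.sum_insert hni]
    have : ∑ k with k < i, V k i * V k j * (1 + θ' k)
        = ∑ k with k < i, V k i * V k j * (1 + θ k) := by
      refine Finset.sum_congr rfl fun k hk => ?_
      simp [θ', (Finset.mem_filter.1 hk).2.ne]
    rw [this]
    simp only [θ', if_true, add_sub_cancel]
    linarith
  have hsumV : ∑ k, V k i * V k j = ∑ k with k ≤ i, V k i * V k j := by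
    rw [Finset.sum_filter]
    refine Finset.sum_congr rfl fun k _ => ?_
    split_ifs with h
    · rfl
    · rw [hV, flChol_lower A (not_le.1 h), zero_mul]
  rw [hsumV, ← hsumA, ← Finset.sum_sub_distrib, Finset.mul_sum]
  refine (Finset.abs_sum_le_sum_abs _ _).trans (Finset.sum_le_sum fun k _ => ?_)
  have : V k i * V k j - V k i * V k j * (1 + θ' k) = -(θ' k * (V k i * V k j)) := by ring
  rw [this, abs_neg, abs_mul, abs_mul]
  refine mul_le_mul_of_nonneg_right ?_ (by positivity)
  simp only [θ']
  split_ifs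
  · exact hz
  · exact (h3 k).trans (sub_le_sub_right (Real.exp_le_exp.2 hd1) 1)

end

end substitution

section cholesky

open Matrix Finset

variable {n : ℕ}

lemma dotProduct_mulVec_eq_sum (M : Matrix (Fin n) (Fin n) ℝ) (v : Fin n → ℝ) :
    v ⬝ᵥ (M *ᵥ v) = ∑ j, ∑ l, v j * v l * M j l := by
  simp only [dotProduct, mulVec, Finset.mul_sum]
  exact Finset.sum_congr rfl fun j _ => Finset.sum_congr rfl fun l _ => by ring

/-- Lower bound for a quadratic form `N` that is close to `M`, with an error relative to the
diagonal of `N`.  The diagonal entry `N i i` has no upper bound; but it is at least `α`, the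
perturbed `M i i`, up to a relative error of order `b`, so that its excess over `α` pays for the
errors that are relative to it. -/
lemma quadForm_lower_bound {M N : Matrix (Fin n) (Fin n) ℝ} {v : Fin n → ℝ} {i : Fin n}
    {b h G μ α : ℝ} (hb0 : 0 ≤ b) (hh0 : 0 ≤ h) (hG0 : 0 ≤ G) (hM : ∀ i j, M i j = M j i)
    (hNsymm : ∀ j l, N j l = N l j) (hN0 : ∀ j, 0 ≤ N j j) (hsupp : ∀ k, i < k → v k = 0)
    (hpair : ∀ j l, j < i → l ≤ i → |N j l - M j l| ≤ h + b * (√(N j j) * √(N l l)))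
    (hNG : ∀ j < i, N j j ≤ G) (hα : -h ≤ α - M i i) (hAi : α ≤ G)
    (hNi : b * N i i - 2 * b * α ≤ N i i - α)
    (hμ : μ * vnorm v ^ 2 ≤ v ⬝ᵥ (M *ᵥ v)) :
    (μ - n * (h + 2 * b * G)) * vnorm v ^ 2 ≤ ∑ j, ∑ l, v j * v l * N j l := by
  set z : Fin n → ℝ := fun j => |v j| * √(N j j) with hz
  have hzi : z i ^ 2 = v i ^ 2 * N i i := by
    simp only [hz, mul_pow, sq_abs, Real.sq_sqrt (hN0 i)]
  have hquad : ∀ j l, v j * v l * M j l - h * (|v j| * |v l|) - b * (z j * z l)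
      + (if j = i ∧ l = i then 2 * b * (N i i - α) * v i ^ 2 else 0)
      ≤ v j * v l * N j l := by
    have hlt : ∀ j l, j < i → l ≤ i → v j * v l * M j l - h * (|v j| * |v l|) - b * (z j * z l)
        ≤ v j * v l * N j l := by
      intro j l hj hl
      have h1 := hpair j l hj hl
      have h2 : |v j * v l * (N j l - M j l)| ≤
          |v j| * |v l| * (h + b * (√(N j j) * √(N l l))) := by
        rw [abs_mul, abs_mul]
        exact mul_le_mul_of_nonneg_left h1 (by positivity)
      have h3 := (abs_le.1 h2).1
      simp only [hz]
      linarith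
    intro j l
    by_cases hji : i < j
    · simp [hsupp j hji, hz, hji.ne']
    by_cases hli : i < l
    · simp [hsupp l hli, hz, hli.ne']
    rcases (not_lt.1 hji).lt_or_eq with hj | rfl
    · rw [if_neg (fun h => hj.ne h.1), add_zero]
      exact hlt j l hj (not_lt.1 hli)
    · rcases (not_lt.1 hli).lt_or_eq with hl | rfl
      · rw [if_neg (fun h => hl.ne h.2), add_zero, hNsymm, hM j l, mul_comm (v j), mul_comm (z j),
          mul_comm |v j|]
        exact hlt l j hl le_rfl
      · rw [if_pos ⟨rfl, rfl⟩]
        have h1 := hα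
        have h2 : z l * z l = v l ^ 2 * N l l := by rw [← hzi]; ring
        rw [h2, ← abs_mul, abs_mul_self]
        nlinarith [mul_nonneg (sq_nonneg (v l))
          (show 0 ≤ N l l - α - (b * N l l - 2 * b * α) + (α - M l l + h) by linarith)]
  have hsum : v ⬝ᵥ (M *ᵥ v) - h * (∑ j, |v j|) ^ 2 - b * (∑ j, z j) ^ 2
      + 2 * b * (N i i - α) * v i ^ 2 ≤ ∑ j, ∑ l, v j * v l * N j l := by
    rw [dotProduct_mulVec_eq_sum]
    calc _ = ∑ j, ∑ l, (v j * v l * M j l - h * (|v j| * |v l|) - b * (z j * z l)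
      + (if j = i ∧ l = i then 2 * b * (N i i - α) * v i ^ 2 else 0)) := by
          simp only [Finset.sum_add_distrib, Finset.sum_sub_distrib, ← Finset.mul_sum,
            ← Finset.sum_mul, ite_and, sq]
          simp
      _ ≤ _ := Finset.sum_le_sum fun j _ => Finset.sum_le_sum fun l _ => hquad j l
  set S := ∑ j ∈ univ.erase i, |v j| with hS
  have hS0 : 0 ≤ S := Finset.sum_nonneg fun _ _ => abs_nonneg _
  have hvS : ∑ j, |v j| = |v i| + S := (Finset.add_sum_erase univ _ (mem_univ i)).symm
  have hzS : ∑ j, z j ≤ z i + √G * S := by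
    rw [← Finset.add_sum_erase univ z (mem_univ i), hS, Finset.mul_sum]
    refine add_le_add le_rfl (Finset.sum_le_sum fun j hj => ?_)
    rcases lt_trichotomy j i with h1 | h1 | h1
    · rw [mul_comm (√G)]
      exact mul_le_mul_of_nonneg_left (Real.sqrt_le_sqrt (hNG j h1)) (abs_nonneg _)
    · exact absurd h1 (Finset.ne_of_mem_erase hj)
    · simp [hz, hsupp j h1]
  have hz0 : 0 ≤ ∑ j, z j := Finset.sum_nonneg fun j _ => by positivity
  have hzsq : (∑ j, z j) ^ 2 ≤ 2 * (v i ^ 2 * N i i) + 2 * (G * S ^ 2) := by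
    have h1 := pow_le_pow_left₀ hz0 hzS 2
    have h2 := sq_nonneg (z i - √G * S)
    have h3 : (√G * S) ^ 2 = G * S ^ 2 := by rw [mul_pow, Real.sq_sqrt hG0]
    nlinarith
  have hvsq := sq_sum_abs_le v
  rw [hvS] at hvsq hsum
  have hsqi : v i ^ 2 = |v i| ^ 2 := (sq_abs _).symm
  have h1 : b * (∑ j, z j) ^ 2 ≤ b * (2 * (v i ^ 2 * N i i) + 2 * (G * S ^ 2)) :=
    mul_le_mul_of_nonneg_left hzsq hb0
  have h2 : 2 * b * α * v i ^ 2 ≤ 2 * b * G * v i ^ 2 := by gcongr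
  have h3 : (h + 2 * b * G) * (|v i| + S) ^ 2 ≤ (h + 2 * b * G) * (n * vnorm v ^ 2) :=
    mul_le_mul_of_nonneg_left hvsq (by positivity)
  have h4 : 2 * b * G * (v i ^ 2 + S ^ 2) ≤ 2 * b * G * (|v i| + S) ^ 2 := by
    refine mul_le_mul_of_nonneg_left ?_ (by positivity)
    rw [hsqi]
    nlinarith [mul_nonneg (abs_nonneg (v i)) hS0]
  have h5 := hμ
  linarith

/-- The Cholesky factorization of a small perturbation `A` of a positive definite matrix `M` runs
to completion.  If the pivot `i` were not positive, a null vector `v` of the rows of the factor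
computed so far would make the quadratic form of `M` at `v` too small.  In that case the column
`i` of the factor has no a priori bound; but a nonpositive pivot makes the
squared norm of this column exceed `A i i` up to rounding, which compensates its contribution. -/
theorem cholPivot_pos (A M : Matrix (Fin n) (Fin n) ℝ) {ε η : Fin n → Fin n → Fin n → ℝ}
    {ζ : Fin n → Fin n → ℝ} {u t b h G μ : ℝ} (hu : u ≤ 1 / 2)
    (H : SubstErrors (fun i j l => i ≤ j ∧ l ≤ i.val) u t ε η ζ)
    (hb : Real.exp (t + 2 * u + (n + 1) * u ^ 2) - 1 ≤ b) (hb2 : b ≤ 1 / 2)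
    (hM : ∀ i j, M i j = M j i) (hAM : ∀ i j, i ≤ j → |A i j - M i j| ≤ h)
    (hG : ∀ i, A i i ≤ (1 - b) * G) (hG0 : 0 ≤ G)
    (hμ : ∀ v, μ * vnorm v ^ 2 ≤ v ⬝ᵥ (M *ᵥ v)) (hμn : n * (h + 2 * b * G) < μ) (i : Fin n) :
    0 < cholPivot A ε η ζ i := by
  induction i using WellFoundedLT.induction with | ind i ih => ?_
  by_contra hcon
  have hfail := not_lt.1 hcon
  set V := flChol A ε η ζ with hV
  have hlow : ∀ {k j : Fin n}, j < k → V k j = 0 := fun h => flChol_lower A h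
  have hb0 : 0 ≤ b := by
    obtain ⟨h1, h2⟩ := cholError_nonneg H i
    have := Real.one_le_exp (h1.trans h2)
    linarith
  have hh0 : 0 ≤ h := (abs_nonneg _).trans (hAM i i le_rfl)
  -- A null vector of the first `i` rows, supported on the first `i + 1` coordinates.
  obtain ⟨v, hv0, hWv⟩ : ∃ v : Fin n → ℝ, v ≠ 0 ∧
      (Matrix.of fun k j => if k < i then V k j else if k = i then 0 else if k = j then 1 else 0 :
        Matrix (Fin n) (Fin n) ℝ) *ᵥ v = 0 := by
    rw [Matrix.exists_mulVec_eq_zero_iff]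
    exact Matrix.det_eq_zero_of_row_eq_zero i fun j => by simp
  have hVv : ∀ k < i, ∑ j, V k j * v j = 0 := fun k hk => by
    have := congrFun hWv k
    simpa [mulVec, dotProduct, hk] using this
  have hsupp : ∀ k, i < k → v k = 0 := fun k hk => by
    have := congrFun hWv k
    simpa [mulVec, dotProduct, hk.not_gt, hk.ne'] using this
  set N : Matrix (Fin n) (Fin n) ℝ := fun j l => ∑ k with k < i, V k j * V k l with hN
  have hN0 : ∀ j, 0 ≤ N j j := fun j => Finset.sum_nonneg fun k _ => mul_self_nonneg _
  have hNsymm : ∀ j l, N j l = N l j := fun j l => Finset.sum_congr rfl fun k _ => mul_comm _ _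
  have hNsum : ∑ j, ∑ l, v j * v l * N j l = 0 := by
    have : ∑ j, ∑ l, v j * v l * N j l
        = ∑ k with k < i, (∑ j, V k j * v j) * (∑ l, V k l * v l) := by
      simp only [hN, Finset.mul_sum, Finset.sum_mul]
      rw [Finset.sum_comm' (t' := univ) (s' := fun _ => univ) (by simp)]
      rw [Finset.sum_comm]
      simp_rw [Finset.sum_comm (t := ({k | k < i} : Finset (Fin n)))]
      refine Finset.sum_congr rfl fun k _ => ?_
      rw [Finset.sum_comm]
      exact Finset.sum_congr rfl fun j _ => Finset.sum_congr rfl fun l _ => by ring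
    rw [this]
    exact Finset.sum_eq_zero fun k hk => by rw [hVv k (Finset.mem_filter.1 hk).2, zero_mul]
  have hCS : ∀ j l, ∑ k with k < i, |V k j| * |V k l| ≤ √(N j j) * √(N l l) := fun j l => by
    rw [← Real.sqrt_mul (hN0 j)]
    refine Real.le_sqrt_of_sq_le ?_
    have := Finset.sum_mul_sq_le_sq_mul_sq ({k | k < i} : Finset (Fin n))
      (fun k => |V k j|) (fun k => |V k l|)
    simpa [hN, sq] using this
  -- Entries with a row index below `i` come from completed rows.
  have hentry : ∀ j l, j < i → j ≤ l → |N j l - A j l| ≤ b * (√(N j j) * √(N l l)) := by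
    intro j l hj hjl
    have h1 := abs_sum_flChol_sub_le A hu H hjl (ih j hj)
    have h2 : N j l = ∑ k, V k j * V k l := by
      simp only [hN]
      rw [Finset.sum_filter]
      refine Finset.sum_congr rfl fun k _ => ?_
      split_ifs with hk
      · rfl
      · rw [hlow (hj.trans_le (not_lt.1 hk)), zero_mul]
    rw [h2]
    refine h1.trans (mul_le_mul hb (le_trans ?_ (hCS j l)) (by positivity) hb0)
    exact Finset.sum_le_sum_of_subset_of_nonneg
      (fun k hk => by simp only [Finset.mem_filter, mem_univ, true_and] at hk ⊢
                      exact hk.trans_lt hj) (fun _ _ _ => by positivity)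
  have hpair : ∀ j l, j < i → l ≤ i →
      |N j l - M j l| ≤ h + b * (√(N j j) * √(N l l)) := by
    intro j l hj hl
    rcases le_total j l with hjl | hjl
    · have h1 := hentry j l hj hjl
      have h2 := hAM j l hjl
      calc |N j l - M j l| = |(A j l - M j l) + (N j l - A j l)| := by ring_nf
        _ ≤ _ := (abs_add_le _ _).trans (add_le_add h2 h1)
    · have h1 := hentry l j (hjl.trans_lt hj) hjl
      have h2 := hAM l j hjl
      rw [hNsymm j l, hM j l, mul_comm (√(N j j))]
      calc |N l j - M l j| = |(A l j - M l j) + (N l j - A l j)| := by ring_nf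
        _ ≤ _ := (abs_add_le _ _).trans (add_le_add h2 h1)
  have hNG : ∀ j < i, N j j ≤ G := fun j hj => by
    have h1 := (abs_le.1 (hentry j j hj le_rfl)).2
    rw [Real.mul_self_sqrt (hN0 j)] at h1
    have h2 := hG j
    have h3 : (1 - b) * N j j ≤ (1 - b) * G := by linarith
    exact le_of_mul_le_mul_left h3 (by linarith)
  have hNi : b * N i i - 2 * b * A i i ≤ N i i - A i i := by
    have h1 : A i i ≤ (1 + b) * N i i := by
      refine (diag_le_of_cholPivot_nonpos A hu H hfail).trans ?_
      have : N i i = ∑ k with k < i, V k i ^ 2 := by simp only [hN, sq]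
      rw [← this]
      exact mul_le_mul_of_nonneg_right (by linarith) (hN0 i)
    rcases le_total 0 (A i i) with h0 | h0
    · have h2 : (1 - b) * A i i ≤ (1 - b) * ((1 + b) * N i i) :=
        mul_le_mul_of_nonneg_left h1 (by linarith)
      have h3 : (1 + b) * ((1 - 2 * b) * A i i) ≤ (1 + b) * ((1 - b) * N i i) := by
        nlinarith [mul_nonneg (mul_nonneg hb0 hb0) h0]
      have := le_of_mul_le_mul_left h3 (by linarith)
      linarith
    · have h2 : (1 - 2 * b) * A i i ≤ 0 :=
        mul_nonpos_of_nonneg_of_nonpos (by linarith) h0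
      have h3 : 0 ≤ (1 - b) * N i i := mul_nonneg (by linarith) (hN0 i)
      linarith
  have hquad := quadForm_lower_bound hb0 hh0 hG0 hM hNsymm hN0 hsupp hpair hNG
    (abs_le.1 (hAM i i le_rfl)).1 ((hG i).trans (by nlinarith)) hNi (hμ v)
  rw [hNsum] at hquad
  exact hquad.not_gt (mul_pos (sub_pos.2 hμn) (pow_pos (vnorm_pos hv0) 2))

/-- Backward error of a completed Cholesky factorization, entrywise. -/
theorem abs_transpose_mul_flChol_sub_le (A M : Matrix (Fin n) (Fin n) ℝ)
    {ε η : Fin n → Fin n → Fin n → ℝ}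
    {ζ : Fin n → Fin n → ℝ} {u t b h G : ℝ} (hu : u ≤ 1 / 2)
    (H : SubstErrors (fun i j l => i ≤ j ∧ l ≤ i.val) u t ε η ζ)
    (hb : Real.exp (t + 2 * u + (n + 1) * u ^ 2) - 1 ≤ b) (hb2 : b ≤ 1 / 2)
    (hM : ∀ i j, M i j = M j i) (hAM : ∀ i j, i ≤ j → |A i j - M i j| ≤ h)
    (hG : ∀ i, A i i ≤ (1 - b) * G) (hpos : ∀ i, 0 < cholPivot A ε η ζ i) :
    (∀ j, vnorm ((flChol A ε η ζ).col j) ^ 2 ≤ G) ∧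
      ∀ i j, |((flChol A ε η ζ)ᵀ * flChol A ε η ζ - M) i j| ≤ h + b * G := by
  set V := flChol A ε η ζ with hV
  have hb0 : ∀ _ : Fin n, 0 ≤ b := fun i => by
    obtain ⟨h1, h2⟩ := cholError_nonneg H i
    have := Real.one_le_exp (h1.trans h2)
    linarith
  have hentry : ∀ i j, i ≤ j →
      |∑ k, V k i * V k j - A i j| ≤ b * (vnorm (V.col i) * vnorm (V.col j)) := by
    intro i j hij
    refine (abs_sum_flChol_sub_le A hu H hij (hpos i)).trans
      (mul_le_mul hb (le_trans ?_ (sum_abs_mul_abs_le (V.col i) (V.col j)))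
        (by positivity) (hb0 i))
    exact Finset.sum_le_sum_of_subset_of_nonneg (Finset.filter_subset _ _)
      fun _ _ _ => by positivity
  have hcol : ∀ j, vnorm (V.col j) ^ 2 ≤ G := by
    intro j
    have h1 := (abs_le.1 (hentry j j le_rfl)).2
    have h2 : ∑ k, V k j * V k j = vnorm (V.col j) ^ 2 := by
      rw [vnorm_sq]; simp [sq]
    rw [h2] at h1
    have h3 : (1 - b) * vnorm (V.col j) ^ 2 ≤ (1 - b) * G := by linarith [hG j]
    exact le_of_mul_le_mul_left h3 (by linarith)
  have hup : ∀ i j, i ≤ j → |(Vᵀ * V - M) i j| ≤ h + b * G := by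
    intro i j hij
    have hG0 : 0 ≤ G := (sq_nonneg _).trans (hcol i)
    have h1 : vnorm (V.col i) * vnorm (V.col j) ≤ G := by
      nlinarith [hcol i, hcol j, sq_nonneg (vnorm (V.col i) - vnorm (V.col j))]
    have h2 := (hentry i j hij).trans (mul_le_mul_of_nonneg_left h1 (hb0 i))
    have h3 : (Vᵀ * V - M) i j = (A i j - M i j) + (∑ k, V k i * V k j - A i j) := by
      simp [Matrix.mul_apply]
    rw [h3]
    exact (abs_add_le _ _).trans (add_le_add (hAM i j hij) h2)
  refine ⟨hcol, fun i j => ?_⟩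
  rcases le_total i j with hij | hij
  · exact hup i j hij
  · have h1 := hup j i hij
    have h2 : (Vᵀ * V - M) i j = (Vᵀ * V - M) j i := by
      simp only [Matrix.sub_apply, Matrix.mul_apply, Matrix.transpose_apply, hM i j]
      congr 1
      exact Finset.sum_congr rfl fun k _ => mul_comm _ _
    rw [h2]; exact h1

end cholesky

/-! ### Perturbation of one sweep -/

section perturbation

open Matrix Finset

variable {m n : ℕ}

lemma exists_mulVec_eq {V : Matrix (Fin n) (Fin n) ℝ} {c : ℝ} (hc : 0 < c)
    (h : ∀ v, c * vnorm v ≤ vnorm (V *ᵥ v)) (y : Fin n → ℝ) : ∃ v, V *ᵥ v = y := by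
  have hinj : Function.Injective (Matrix.toLin' V) := by
    rw [injective_iff_map_eq_zero]
    intro v hv
    by_contra hne
    have h1 := h v
    rw [Matrix.toLin'_apply] at hv
    rw [hv] at h1
    have h2 : vnorm (0 : Fin n → ℝ) = 0 := by simp [vnorm_eq_sqrt]
    have := mul_pos hc (vnorm_pos hne)
    linarith
  exact LinearMap.injective_iff_surjective.1 hinj y

/-- Congruence with a matrix that does not shrink vectors too much controls the Frobenius norm. -/
lemma normF_le_normF_congr {V : Matrix (Fin n) (Fin n) ℝ} {c : ℝ} (hc : 0 < c)
    (h : ∀ v, c * vnorm v ≤ vnorm (V *ᵥ v)) (M : Matrix (Fin n) (Fin n) ℝ) :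
    c ^ 2 * normF M ≤ normF (Vᵀ * M * V) := by
  choose W hW using exists_mulVec_eq hc h
  set Z : Matrix (Fin n) (Fin n) ℝ := Matrix.of fun i j => W (Pi.single j 1) i with hZ
  have hVZ : V * Z = 1 := by
    ext i j
    have := congrFun (hW (Pi.single j 1)) i
    rw [Matrix.one_apply, Matrix.mul_apply]
    simpa [mulVec, dotProduct, hZ, Pi.single_apply] using this
  have hn : norm2 Z ≤ c⁻¹ := by
    refine norm2_le (by positivity) fun y => ?_
    have h1 := h (Z *ᵥ y)
    rw [Matrix.mulVec_mulVec, hVZ, Matrix.one_mulVec] at h1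
    rw [inv_mul_eq_div, le_div_iff₀ hc, mul_comm]
    exact h1
  have hM : M = Zᵀ * (Vᵀ * M * V) * Z := by
    calc M = (V * Z)ᵀ * M * (V * Z) := by rw [hVZ]; simp
      _ = Zᵀ * (Vᵀ * M * V) * Z := by rw [Matrix.transpose_mul]; simp only [Matrix.mul_assoc]
  have h1 : normF M ≤ c⁻¹ * normF (Vᵀ * M * V) * c⁻¹ := by
    conv_lhs => rw [hM]
    refine (normF_mul_le_mul_norm2 _ _).trans ?_
    refine mul_le_mul ((normF_mul_le_norm2_mul _ _).trans ?_) hn (norm2_nonneg _)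
      (mul_nonneg (by positivity) (normF_nonneg _))
    rw [norm2_transpose]
    exact mul_le_mul_of_nonneg_right hn (normF_nonneg _)
  calc c ^ 2 * normF M ≤ c ^ 2 * (c⁻¹ * normF (Vᵀ * M * V) * c⁻¹) :=
        mul_le_mul_of_nonneg_left h1 (by positivity)
    _ = normF (Vᵀ * M * V) := by field_simp

/-- `Q (V v)` differs from `X v` by at most `‖Q V - X‖_F ‖v‖`. -/
lemma vnorm_mulVec_mulVec_bounds {Q X : Matrix (Fin m) (Fin n) ℝ} {V : Matrix (Fin n) (Fin n) ℝ}
    {ρ : ℝ} (h : normF (Q * V - X) ≤ ρ) (v : Fin n → ℝ) :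
    vnorm (Q *ᵥ (V *ᵥ v)) ≤ vnorm (X *ᵥ v) + ρ * vnorm v ∧
      vnorm (X *ᵥ v) ≤ vnorm (Q *ᵥ (V *ᵥ v)) + ρ * vnorm v := by
  have h1 : vnorm ((Q * V - X) *ᵥ v) ≤ ρ * vnorm v :=
    (vnorm_mulVec_le_normF _ v).trans (mul_le_mul_of_nonneg_right h (vnorm_nonneg v))
  have h2 : vnorm ((X - Q * V) *ᵥ v) ≤ ρ * vnorm v := by
    refine (vnorm_mulVec_le_normF _ v).trans (mul_le_mul_of_nonneg_right ?_ (vnorm_nonneg v))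
    rwa [← neg_sub, normF_neg]
  have e1 : Q *ᵥ (V *ᵥ v) = X *ᵥ v + (Q * V - X) *ᵥ v := by
    rw [Matrix.sub_mulVec, Matrix.mulVec_mulVec]; abel
  have e2 : X *ᵥ v = Q *ᵥ (V *ᵥ v) + (X - Q * V) *ᵥ v := by
    rw [Matrix.sub_mulVec, Matrix.mulVec_mulVec]; abel
  constructor
  · conv_lhs => rw [e1]
    exact (vnorm_add_le _ _).trans (by linarith)
  · conv_lhs => rw [e2]
    exact (vnorm_add_le _ _).trans (by linarith)

lemma le_mul_of_sq_le {x y c : ℝ} (hy : 0 ≤ y) (hc : 0 ≤ c) (h : x ^ 2 ≤ c ^ 2 * y ^ 2) :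
    x ≤ c * y :=
  le_of_sq_le_sq (by rwa [mul_pow]) (mul_nonneg hc hy)

/-- An injective square matrix `V` is surjective, so a bound for `Q` may be tested on the vectors
`V v`. -/
lemma norm2_le_of_forall_mulVec {Q : Matrix (Fin m) (Fin n) ℝ} {V : Matrix (Fin n) (Fin n) ℝ}
    {c r : ℝ} (hc : 0 < c) (hV : ∀ v, c * vnorm v ≤ vnorm (V *ᵥ v)) (hr : 0 ≤ r)
    (h : ∀ v, vnorm (Q *ᵥ (V *ᵥ v)) ≤ r * vnorm (V *ᵥ v)) : norm2 Q ≤ r := by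
  refine norm2_le hr fun y => ?_
  obtain ⟨v, rfl⟩ := exists_mulVec_eq hc hV y
  exact h v

section shifted

variable {T Q : Matrix (Fin m) (Fin n) ℝ} {V : Matrix (Fin n) (Fin n) ℝ} {E w : ℝ}

/-- The computed factor of the shifted sweep is bounded by its input. -/
lemma shifted_norm2_factor_le (hE : E ≤ 1 / 1100)
    (hup : ∀ v, vnorm (V *ᵥ v) ^ 2 ≤ vnorm (T *ᵥ v) ^ 2 + 14 * E * gNorm T ^ 2 * vnorm v ^ 2) :
    norm2 V ≤ 1.01 * norm2 T := by
  have hτ := norm2_nonneg T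
  refine norm2_le (by positivity) fun v => ?_
  refine le_of_sq_le_sq ?_ (mul_nonneg (by positivity) (vnorm_nonneg v))
  have h1 := pow_le_pow_left₀ (vnorm_nonneg _) (vnorm_mulVec_le T v) 2
  have h2 := pow_le_pow_left₀ (gNorm_nonneg T) (gNorm_le_norm2 T) 2
  have h3 : E * gNorm T ^ 2 * vnorm v ^ 2 ≤ 1 / 1100 * norm2 T ^ 2 * vnorm v ^ 2 := by gcongr
  have h4 : 0 ≤ norm2 T ^ 2 * vnorm v ^ 2 := by positivity
  have := hup v
  nlinarith

variable (hE0 : 0 < E) (hE : E ≤ 1 / 1100) (hwE : w ≤ E) (hg : 0 < gNorm T)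
  (hlow : ∀ v, vnorm (T *ᵥ v) ^ 2 + 8 * E * gNorm T ^ 2 * vnorm v ^ 2 ≤ vnorm (V *ᵥ v) ^ 2)
  (hVg : gNorm V ≤ 1.01 * gNorm T)
  (hD : normF (Q * V - T) ≤ 1.5 * w * (gNorm Q * gNorm V))

include hE0 hE hwE hg hlow hVg hD

lemma shifted_norm2_le : norm2 Q ≤ 1.02 := by
  have hq := norm2_nonneg Q
  have hgQ := gNorm_nonneg Q
  have hD' : normF (Q * V - T) ≤ 1.515 * norm2 Q * (E * gNorm T) := by
    refine hD.trans ?_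
    calc 1.5 * w * (gNorm Q * gNorm V) ≤ 1.5 * E * (norm2 Q * (1.01 * gNorm T)) := by
          have := gNorm_nonneg V
          have := gNorm_le_norm2 Q
          gcongr
      _ = 1.515 * norm2 Q * (E * gNorm T) := by ring
  have hEv : ∀ v, E * gNorm T * vnorm v ≤ 1 / 93 * vnorm (V *ᵥ v) := fun v => by
    refine le_mul_of_sq_le (vnorm_nonneg _) (by norm_num) ?_
    have h1 := hlow v
    have h2 : 8 * (E * gNorm T * vnorm v) ^ 2 = E * (8 * E * gNorm T ^ 2 * vnorm v ^ 2) := by ring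
    have h3 : E * (8 * E * gNorm T ^ 2 * vnorm v ^ 2) ≤ 1 / 1100 * vnorm (V *ᵥ v) ^ 2 := by
      have : 8 * E * gNorm T ^ 2 * vnorm v ^ 2 ≤ vnorm (V *ᵥ v) ^ 2 := by
        nlinarith [sq_nonneg (vnorm (T *ᵥ v))]
      gcongr
    nlinarith [sq_nonneg (vnorm (V *ᵥ v))]
  have key : norm2 Q ≤ 1 + 1.515 / 93 * norm2 Q := by
    refine norm2_le_of_forall_mulVec (c := 93 * (E * gNorm T)) (by positivity)
      (fun v => by have := hEv v; linarith) (by positivity) fun v => ?_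
    have h1 := (vnorm_mulVec_mulVec_bounds hD' v).1
    have h2 : vnorm (T *ᵥ v) ≤ vnorm (V *ᵥ v) := by
      refine le_of_sq_le_sq ?_ (vnorm_nonneg _)
      have h1 := hlow v
      have : 0 ≤ 8 * E * gNorm T ^ 2 * vnorm v ^ 2 := by positivity
      linarith
    have h3 := mul_le_mul_of_nonneg_left (hEv v) (show 0 ≤ 1.515 * norm2 Q by positivity)
    linarith
  linarith

/-- The condition on `κ₂(T)` makes `Q` well conditioned enough for the next sweep.  For `y = V v`,
`‖y‖²` is at most `‖T v‖²` plus a multiple of the shift, and after multiplication by `E (pRatio Q)²`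
both parts are small multiples of `‖T v‖²`, hence of `‖Q y‖²`. -/
lemma shifted_lower_bound
    (hup : ∀ v, vnorm (V *ᵥ v) ^ 2 ≤ vnorm (T *ᵥ v) ^ 2 + 14 * E * gNorm T ^ 2 * vnorm v ^ 2)
    (hκ : ∀ v, 86 * pRatio Q * E * gNorm T * vnorm v ≤ vnorm (T *ᵥ v)) (y : Fin n → ℝ) :
    320 * E * gNorm Q ^ 2 * vnorm y ^ 2 ≤ vnorm (Q *ᵥ y) ^ 2 := by
  have hq := shifted_norm2_le hE0 hE hwE hg hlow hVg hD
  have hq0 := norm2_nonneg Q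
  have hp0 := pRatio_nonneg Q
  have hp1 := pRatio_le_one Q
  have hgQ : gNorm Q ≤ 1.02 * pRatio Q := by
    rw [gNorm_eq_pRatio_mul, mul_comm]; gcongr
  have hVc : ∀ v, (√(8 * E) * gNorm T) * vnorm v ≤ vnorm (V *ᵥ v) := fun v => by
    refine le_of_sq_le_sq ?_ (vnorm_nonneg _)
    rw [mul_pow, mul_pow, Real.sq_sqrt (by positivity)]
    nlinarith [hlow v, sq_nonneg (vnorm (T *ᵥ v))]
  obtain ⟨v, rfl⟩ := exists_mulVec_eq (by positivity) hVc y
  set x := vnorm (T *ᵥ v) with hx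
  have hx0 : 0 ≤ x := vnorm_nonneg _
  have hv0 := vnorm_nonneg v
  have hκv := hκ v
  have hD' : normF (Q * V - T) ≤ 1.5453 * (pRatio Q * E * gNorm T) := by
    refine hD.trans ?_
    calc 1.5 * w * (gNorm Q * gNorm V) ≤ 1.5 * E * (1.02 * pRatio Q * (1.01 * gNorm T)) := by
          have := gNorm_nonneg V
          have := gNorm_nonneg Q
          gcongr
      _ = 1.5453 * (pRatio Q * E * gNorm T) := by ring
  have h1 := (vnorm_mulVec_mulVec_bounds hD' v).2
  have h2 : 0.982 * x ≤ vnorm (Q *ᵥ (V *ᵥ v)) := by linarith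
  have h3 := pow_le_pow_left₀ (by positivity) h2 2
  have h4 : E * gNorm Q ^ 2 * vnorm (V *ᵥ v) ^ 2 ≤
      E * (1.02 * pRatio Q) ^ 2 * (x ^ 2 + 14 * E * gNorm T ^ 2 * vnorm v ^ 2) := by
    have := gNorm_nonneg Q
    have := hup v
    gcongr
  have h5 : E * pRatio Q ^ 2 * x ^ 2 ≤ 1 / 1100 * 1 ^ 2 * x ^ 2 := by gcongr
  have h6 := pow_le_pow_left₀ (by positivity) hκv 2
  nlinarith [sq_nonneg x]

end shifted

section unshifted

variable {X Q : Matrix (Fin m) (Fin n) ℝ} {V : Matrix (Fin n) (Fin n) ℝ} {E w : ℝ}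

/-- One sweep without shift turns a moderately conditioned matrix into an almost orthonormal
one. -/
lemma second_sweep_bounds (hE0 : 0 < E) (hE : E ≤ 1 / 1100) (hwE : w ≤ E)
    (hg : 0 < gNorm X) (hX2 : norm2 X ≤ 1.02)
    (hX : ∀ v, 320 * E * gNorm X ^ 2 * vnorm v ^ 2 ≤ vnorm (X *ᵥ v) ^ 2)
    (hVX : ∀ v, |vnorm (V *ᵥ v) ^ 2 - vnorm (X *ᵥ v) ^ 2| ≤
      1.82 * E * gNorm X ^ 2 * vnorm v ^ 2)
    (hVg : gNorm V ≤ 1.005 * gNorm X)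
    (hD : normF (Q * V - X) ≤ 1.5 * w * (gNorm Q * gNorm V)) :
    norm2 V ≤ 1.03 ∧ norm2 Q ≤ 1.01 ∧ ∀ y, 0.99 * vnorm y ≤ vnorm (Q *ᵥ y) := by
  have hq := norm2_nonneg Q
  have hgQ := gNorm_nonneg Q
  have hD' : normF (Q * V - X) ≤ 1.5075 * norm2 Q * (E * gNorm X) := by
    refine hD.trans ?_
    calc 1.5 * w * (gNorm Q * gNorm V) ≤ 1.5 * E * (norm2 Q * (1.005 * gNorm X)) := by
          have := gNorm_nonneg V
          have := gNorm_le_norm2 Q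
          gcongr
      _ = 1.5075 * norm2 Q * (E * gNorm X) := by ring
  have hEv : ∀ v, E * gNorm X * vnorm v ≤ 1 / 593 * vnorm (X *ᵥ v) := fun v => by
    refine le_mul_of_sq_le (vnorm_nonneg _) (by norm_num) ?_
    have h2 : 320 * (E * gNorm X * vnorm v) ^ 2
        = E * (320 * E * gNorm X ^ 2 * vnorm v ^ 2) := by ring
    have h3 : E * (320 * E * gNorm X ^ 2 * vnorm v ^ 2) ≤ 1 / 1100 * vnorm (X *ᵥ v) ^ 2 := by
      have := hX v
      gcongr
    nlinarith [sq_nonneg (vnorm (X *ᵥ v))]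
  have hrel : ∀ v, vnorm (V *ᵥ v) ^ 2 ≤ 1.0057 * vnorm (X *ᵥ v) ^ 2 ∧
      0.9943 * vnorm (X *ᵥ v) ^ 2 ≤ vnorm (V *ᵥ v) ^ 2 := fun v => by
    have h1 := abs_le.1 (hVX v)
    have h2 := hX v
    constructor <;> linarith
  have hXV : ∀ v, vnorm (X *ᵥ v) ≤ 1.003 * vnorm (V *ᵥ v) := fun v => by
    refine le_mul_of_sq_le (vnorm_nonneg _) (by norm_num) ?_
    nlinarith [(hrel v).2, sq_nonneg (vnorm (V *ᵥ v))]
  have hVX' : ∀ v, vnorm (V *ᵥ v) ≤ 1.00285 * vnorm (X *ᵥ v) := fun v => by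
    refine le_mul_of_sq_le (vnorm_nonneg _) (by norm_num) ?_
    nlinarith [(hrel v).1, sq_nonneg (vnorm (X *ᵥ v))]
  have hc : ∀ v, (500 * (E * gNorm X)) * vnorm v ≤ vnorm (V *ᵥ v) := fun v => by
    have h1 := hEv v
    have h2 := hXV v
    have h3 := vnorm_nonneg (V *ᵥ v)
    linarith
  have hρv : ∀ v, 1.5075 * norm2 Q * (E * gNorm X) * vnorm v
      ≤ 0.00255 * norm2 Q * vnorm (X *ᵥ v) := fun v => by
    have h1 := mul_le_mul_of_nonneg_left (hEv v) (show 0 ≤ 1.5075 * norm2 Q by positivity)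
    have h2 := mul_nonneg hq (vnorm_nonneg (X *ᵥ v))
    linarith
  have key : norm2 Q ≤ 1.003 * (1 + 0.00255 * norm2 Q) := by
    refine norm2_le_of_forall_mulVec (by positivity) hc (by positivity) fun v => ?_
    have h1 := (vnorm_mulVec_mulVec_bounds hD' v).1
    have h2 := mul_le_mul_of_nonneg_left (hXV v) (show 0 ≤ 1 + 0.00255 * norm2 Q by positivity)
    linarith [hρv v]
  have hq2 : norm2 Q ≤ 1.01 := by linarith
  refine ⟨?_, hq2, fun y => ?_⟩
  · refine norm2_le (by norm_num) fun v => ?_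
    have h1 := hVX' v
    have h2 := vnorm_mulVec_le X v
    have h3 := mul_le_mul_of_nonneg_right hX2 (vnorm_nonneg v)
    have h4 := vnorm_nonneg v
    linarith
  · obtain ⟨v, rfl⟩ := exists_mulVec_eq (by positivity) hc y
    have h1 := (vnorm_mulVec_mulVec_bounds hD' v).2
    have h2 := hρv v
    have h3 := mul_le_mul_of_nonneg_right hq2 (vnorm_nonneg (X *ᵥ v))
    have h4 := hVX' v
    have h5 := vnorm_nonneg (X *ᵥ v)
    linarith

/-- One sweep on an almost orthonormal matrix leaves an orthogonality error that is proportional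
to the rounding errors. -/
lemma third_sweep_bounds (hE0 : 0 < E) (hE : E ≤ 1 / 1100) (hwE : w ≤ E)
    (hX2 : norm2 X ≤ 1.01) (hg : 0.99 ≤ gNorm X)
    (hX : ∀ v, 0.99 * vnorm v ≤ vnorm (X *ᵥ v))
    (hVX : normF (Vᵀ * V - Xᵀ * X) ≤ 1.82 * E * gNorm X ^ 2)
    (hVX' : ∀ v, |vnorm (V *ᵥ v) ^ 2 - vnorm (X *ᵥ v) ^ 2| ≤
      1.82 * E * gNorm X ^ 2 * vnorm v ^ 2)
    (hVg : gNorm V ≤ 1.005 * gNorm X)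
    (hD : normF (Q * V - X) ≤ 1.5 * w * (gNorm Q * gNorm V)) :
    norm2 Q ≤ 1.01 ∧ normF (Qᵀ * Q - 1) ≤ 6 * pRatio X ^ 2 * E := by
  have hq := norm2_nonneg Q
  have hgQ := gNorm_nonneg Q
  have hg1 : gNorm X ≤ 1.01 := (gNorm_le_norm2 X).trans hX2
  have hEg : 1.82 * E * gNorm X ^ 2 ≤ 0.0017 := by
    calc 1.82 * E * gNorm X ^ 2 ≤ 1.82 * (1 / 1100) * 1.01 ^ 2 := by gcongr
      _ ≤ 0.0017 := by norm_num
  have hEgv : ∀ v, |vnorm (V *ᵥ v) ^ 2 - vnorm (X *ᵥ v) ^ 2| ≤ 0.0017 * vnorm v ^ 2 := fun v =>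
    (hVX' v).trans (mul_le_mul_of_nonneg_right hEg (sq_nonneg _))
  have hVc : ∀ v, 0.989 * vnorm v ≤ vnorm (V *ᵥ v) := fun v => by
    refine le_of_sq_le_sq ?_ (vnorm_nonneg _)
    have h1 := pow_le_pow_left₀ (mul_nonneg (by norm_num) (vnorm_nonneg v)) (hX v) 2
    have h2 := abs_le.1 (hEgv v)
    nlinarith [sq_nonneg (vnorm v)]
  have hXV : ∀ v, vnorm (X *ᵥ v) ≤ 1.001 * vnorm (V *ᵥ v) := fun v => by
    refine le_mul_of_sq_le (vnorm_nonneg _) (by norm_num) ?_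
    have h1 := pow_le_pow_left₀ (mul_nonneg (by norm_num) (vnorm_nonneg v)) (hVc v) 2
    have h2 := abs_le.1 (hEgv v)
    nlinarith [sq_nonneg (vnorm v)]
  have hDq : normF (Q * V - X) ≤ 1.5075 * norm2 Q * (E * gNorm X) := by
    refine hD.trans ?_
    calc 1.5 * w * (gNorm Q * gNorm V) ≤ 1.5 * E * (norm2 Q * (1.005 * gNorm X)) := by
          have := gNorm_nonneg V
          have := gNorm_le_norm2 Q
          gcongr
      _ = 1.5075 * norm2 Q * (E * gNorm X) := by ring
  have hEg' : E * gNorm X ≤ 0.00092 := by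
    calc E * gNorm X ≤ 1 / 1100 * 1.01 := by
          have := gNorm_nonneg X
          gcongr
      _ ≤ 0.00092 := by norm_num
  have hEg0 : 0 ≤ E * gNorm X := mul_nonneg hE0.le (gNorm_nonneg X)
  have hq2 : norm2 Q ≤ 1.01 := by
    have key : norm2 Q ≤ 1.001 + 0.0015 * norm2 Q := by
      refine norm2_le_of_forall_mulVec (by norm_num) hVc (by positivity) fun v => ?_
      have h1 := (vnorm_mulVec_mulVec_bounds hDq v).1
      have h2 := hXV v
      have h3 : 1.5075 * norm2 Q * (E * gNorm X) * vnorm v ≤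
          1.5075 * norm2 Q * 0.00092 * (1 / 0.989 * vnorm (V *ᵥ v)) := by
        have h4 : vnorm v ≤ 1 / 0.989 * vnorm (V *ᵥ v) := by linarith [hVc v]
        have := vnorm_nonneg v
        gcongr
      have h5 := mul_nonneg hq (vnorm_nonneg (V *ᵥ v))
      linarith
    linarith
  refine ⟨hq2, ?_⟩
  set D := Q * V - X with hDdef
  have hDn : normF D ≤ 1.5226 * (E * gNorm X) := by
    refine hDq.trans ?_
    have := mul_le_mul_of_nonneg_right hq2 hEg0
    linarith
  have hcongr : Vᵀ * (Qᵀ * Q - 1) * V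
      = Xᵀ * D + Dᵀ * X + Dᵀ * D + -(Vᵀ * V - Xᵀ * X) := by
    have hQV : Q * V = X + D := by rw [hDdef]; abel
    calc Vᵀ * (Qᵀ * Q - 1) * V = (Q * V)ᵀ * (Q * V) - Vᵀ * V := by
          rw [Matrix.transpose_mul, Matrix.mul_sub, Matrix.sub_mul, Matrix.mul_one]
          simp only [Matrix.mul_assoc]
      _ = _ := by
          rw [hQV, Matrix.transpose_add, Matrix.add_mul, Matrix.mul_add, Matrix.mul_add]; abel
  have hD0 := normF_nonneg D
  have h1 : normF (Xᵀ * D) ≤ 1.01 * normF D := by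
    refine (normF_mul_le_norm2_mul _ _).trans ?_
    rw [norm2_transpose]
    exact mul_le_mul_of_nonneg_right hX2 hD0
  have h2 : normF (Dᵀ * X) ≤ 1.01 * normF D := by
    have : Dᵀ * X = (Xᵀ * D)ᵀ := by rw [Matrix.transpose_mul, Matrix.transpose_transpose]
    rw [this, normF_transpose]; exact h1
  have h3 : normF (Dᵀ * D) ≤ normF D * normF D := by
    refine (normF_mul_le _ _).trans_eq ?_
    rw [normF_transpose]
  have h4 : normF (Vᵀ * (Qᵀ * Q - 1) * V)
      ≤ 2.02 * normF D + normF D * normF D + 1.82 * E * gNorm X ^ 2 := by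
    rw [hcongr]
    refine (normF_add_le _ _).trans ?_
    rw [normF_neg]
    have h5 := normF_add_le (Xᵀ * D + Dᵀ * X) (Dᵀ * D)
    have h6 := normF_add_le (Xᵀ * D) (Dᵀ * X)
    linarith
  have h5 := normF_le_normF_congr (by norm_num : (0 : ℝ) < 0.989) hVc (Qᵀ * Q - 1)
  have h6 : E * gNorm X ≤ 1 / 0.99 * (E * gNorm X ^ 2) := by
    have := mul_le_mul_of_nonneg_left hg hEg0
    nlinarith
  have h7 : normF D * normF D ≤ 0.0015 * normF D := by
    refine mul_le_mul_of_nonneg_right ?_ hD0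
    linarith
  have h8 : gNorm X ^ 2 ≤ 1.0201 * pRatio X ^ 2 := by
    rw [gNorm_eq_pRatio_mul, mul_pow, mul_comm]
    have := pow_le_pow_left₀ (norm2_nonneg X) hX2 2
    refine mul_le_mul_of_nonneg_right (this.trans (by norm_num)) (sq_nonneg _)
  have h9 := mul_le_mul_of_nonneg_left h8 hE0.le
  nlinarith [normF_nonneg (Qᵀ * Q - 1)]

end unshifted

/-- The residual of the three sweeps, from the errors of the triangular solves and of the products
of the triangular factors. -/
lemma residual_le {T Q Q₁ Q₂ : Matrix (Fin m) (Fin n) ℝ}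
    {V V₁ V₂ V₃ V₄ : Matrix (Fin n) (Fin n) ℝ} {w : ℝ} (hw : 0 ≤ w) (hw1 : w ≤ 1 / 2200)
    (hV2 : norm2 V ≤ 1.01 * norm2 T) (hVg : gNorm V ≤ 1.01 * gNorm T)
    (hQ2 : norm2 Q ≤ 1.02) (hV₁2 : norm2 V₁ ≤ 1.03) (hV₁g : gNorm V₁ ≤ 1.005 * gNorm Q)
    (hQ₁2 : norm2 Q₁ ≤ 1.01) (hV₃g : gNorm V₃ ≤ 1.005 * gNorm Q₁) (hQ₂2 : norm2 Q₂ ≤ 1.01)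
    (hD : normF (Q * V - T) ≤ 1.5 * w * (gNorm Q * gNorm V))
    (hD₁ : normF (Q₁ * V₁ - Q) ≤ 1.5 * w * (gNorm Q₁ * gNorm V₁))
    (hD₂ : normF (Q₂ * V₃ - Q₁) ≤ 1.5 * w * (gNorm Q₂ * gNorm V₃))
    (hF₂ : normF (V₂ - V₁ * V) ≤ 1.5 * w * (gNorm V₁ * gNorm V))
    (hF₄ : normF (V₄ - V₃ * V₂) ≤ 1.5 * w * (gNorm V₃ * gNorm V₂)) :
    normF (Q₂ * V₄ - T) ≤ phi1 (pRatio T) (pRatio Q) (pRatio Q₁) * w * norm2 T := by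
  have hτ := norm2_nonneg T
  have hp₁ := pRatio_nonneg T
  have hp₂ := pRatio_nonneg Q
  have hp₂1 := pRatio_le_one Q
  have hp₃ := pRatio_nonneg Q₁
  have hgT := gNorm_eq_pRatio_mul T
  have hgTτ := gNorm_le_norm2 T
  have hgT0 := gNorm_nonneg T
  have hgV0 := gNorm_nonneg V
  have hgV₁0 := gNorm_nonneg V₁
  have hgV₂0 := gNorm_nonneg V₂
  have hgV₃0 := gNorm_nonneg V₃
  have hgQ0 := gNorm_nonneg Q
  have hgQ₁0 := gNorm_nonneg Q₁
  have hgQ₂0 := gNorm_nonneg Q₂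
  have hgQ₁1 : gNorm Q₁ ≤ 1.01 := (gNorm_le_norm2 Q₁).trans hQ₁2
  have hgQ₂1 : gNorm Q₂ ≤ 1.01 := (gNorm_le_norm2 Q₂).trans hQ₂2
  have hgQ : gNorm Q ≤ 1.02 * pRatio Q := by
    rw [gNorm_eq_pRatio_mul, mul_comm]; gcongr
  have hgQ₁ : gNorm Q₁ ≤ 1.01 * pRatio Q₁ := by
    rw [gNorm_eq_pRatio_mul, mul_comm]; gcongr
  have hgV₁ : gNorm V₁ ≤ 1.0251 * pRatio Q := hV₁g.trans (by linarith)
  have hgV₁1 : gNorm V₁ ≤ 1.0251 := hgV₁.trans (by linarith)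
  have hgV₃ : gNorm V₃ ≤ 1.01505 * pRatio Q₁ := hV₃g.trans (by linarith)
  have hF₂T : normF (V₂ - V₁ * V) ≤ 0.001 * gNorm T := by
    refine hF₂.trans ?_
    calc 1.5 * w * (gNorm V₁ * gNorm V) ≤ 1.5 * (1 / 2200) * (1.0251 * (1.01 * gNorm T)) := by
          gcongr
      _ ≤ 0.001 * gNorm T := by linarith
  have hV₂eq : V₂ = V₁ * V + (V₂ - V₁ * V) := by abel
  have hV₂2 : norm2 V₂ ≤ 1.05 * norm2 T := by
    rw [hV₂eq]
    refine (norm2_add_le _ _).trans ?_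
    have h1 := norm2_mul_le V₁ V
    have h2 := norm2_le_normF (V₂ - V₁ * V)
    have h3 : norm2 V₁ * norm2 V ≤ 1.03 * (1.01 * norm2 T) := by
      have := norm2_nonneg V
      gcongr
    linarith
  have hV₂g : gNorm V₂ ≤ 1.05 * gNorm T := by
    rw [hV₂eq]
    refine (gNorm_add_le _ _).trans ?_
    have h1 := gNorm_mul_le V₁ V
    have h2 := gNorm_le_normF (V₂ - V₁ * V)
    have h3 : norm2 V₁ * gNorm V ≤ 1.03 * (1.01 * gNorm T) := by gcongr
    linarith
  have hdec : Q₂ * V₄ - T = (Q * V - T) + (Q₁ * V₁ - Q) * V + Q₁ * (V₂ - V₁ * V)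
      + (Q₂ * V₃ - Q₁) * V₂ + Q₂ * (V₄ - V₃ * V₂) := by
    simp only [Matrix.sub_mul, Matrix.mul_sub, Matrix.mul_assoc]
    abel
  have t₁ : normF (Q * V - T) ≤ 1.56 * (pRatio T * pRatio Q * (w * norm2 T)) := by
    refine hD.trans ?_
    calc 1.5 * w * (gNorm Q * gNorm V)
        ≤ 1.5 * w * (1.02 * pRatio Q * (1.01 * (pRatio T * norm2 T))) := by
          rw [← hgT]; gcongr
      _ ≤ 1.56 * (pRatio T * pRatio Q * (w * norm2 T)) := by
          have : 0 ≤ pRatio T * pRatio Q * (w * norm2 T) := by positivity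
          linarith
  have t₂ : normF ((Q₁ * V₁ - Q) * V) ≤ 1.6 * (pRatio Q * (w * norm2 T)) := by
    refine (normF_mul_le_mul_norm2 _ _).trans ?_
    calc normF (Q₁ * V₁ - Q) * norm2 V
        ≤ (1.5 * w * (1.01 * (1.0251 * pRatio Q))) * (1.01 * norm2 T) := by
          have h : normF (Q₁ * V₁ - Q) ≤ 1.5 * w * (1.01 * (1.0251 * pRatio Q)) :=
            hD₁.trans (by gcongr)
          have := norm2_nonneg V
          gcongr
      _ ≤ 1.6 * (pRatio Q * (w * norm2 T)) := by
          have : 0 ≤ pRatio Q * (w * norm2 T) := by positivity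
          linarith
  have t₃ : normF (Q₁ * (V₂ - V₁ * V)) ≤ 1.6 * (pRatio T * pRatio Q * (w * norm2 T)) := by
    refine (normF_mul_le_norm2_mul _ _).trans ?_
    calc norm2 Q₁ * normF (V₂ - V₁ * V)
        ≤ 1.01 * (1.5 * w * (1.0251 * pRatio Q * (1.01 * (pRatio T * norm2 T)))) := by
          rw [← hgT]
          have h : normF (V₂ - V₁ * V) ≤ 1.5 * w * (1.0251 * pRatio Q * (1.01 * gNorm T)) :=
            hF₂.trans (by gcongr)
          have := normF_nonneg (V₂ - V₁ * V)
          gcongr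
      _ ≤ 1.6 * (pRatio T * pRatio Q * (w * norm2 T)) := by
          have : 0 ≤ pRatio T * pRatio Q * (w * norm2 T) := by positivity
          linarith
  have t₄ : normF ((Q₂ * V₃ - Q₁) * V₂) ≤ 1.7 * (pRatio Q₁ * (w * norm2 T)) := by
    refine (normF_mul_le_mul_norm2 _ _).trans ?_
    calc normF (Q₂ * V₃ - Q₁) * norm2 V₂
        ≤ (1.5 * w * (1.01 * (1.01505 * pRatio Q₁))) * (1.05 * norm2 T) := by
          have h : normF (Q₂ * V₃ - Q₁) ≤ 1.5 * w * (1.01 * (1.01505 * pRatio Q₁)) :=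
            hD₂.trans (by gcongr)
          have := norm2_nonneg V₂
          gcongr
      _ ≤ 1.7 * (pRatio Q₁ * (w * norm2 T)) := by
          have : 0 ≤ pRatio Q₁ * (w * norm2 T) := by positivity
          linarith
  have t₅ : normF (Q₂ * (V₄ - V₃ * V₂)) ≤ 1.7 * (pRatio T * pRatio Q₁ * (w * norm2 T)) := by
    refine (normF_mul_le_norm2_mul _ _).trans ?_
    calc norm2 Q₂ * normF (V₄ - V₃ * V₂)
        ≤ 1.01 * (1.5 * w * (1.01505 * pRatio Q₁ * (1.05 * (pRatio T * norm2 T)))) := by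
          rw [← hgT]
          have h : normF (V₄ - V₃ * V₂) ≤ 1.5 * w * (1.01505 * pRatio Q₁ * (1.05 * gNorm T)) :=
            hF₄.trans (by gcongr)
          have := normF_nonneg (V₄ - V₃ * V₂)
          gcongr
      _ ≤ 1.7 * (pRatio T * pRatio Q₁ * (w * norm2 T)) := by
          have : 0 ≤ pRatio T * pRatio Q₁ * (w * norm2 T) := by positivity
          linarith
  have hsum : normF (Q₂ * V₄ - T) ≤ normF (Q * V - T) + normF ((Q₁ * V₁ - Q) * V)
      + normF (Q₁ * (V₂ - V₁ * V)) + normF ((Q₂ * V₃ - Q₁) * V₂)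
      + normF (Q₂ * (V₄ - V₃ * V₂)) := by
    rw [hdec]
    refine (normF_add_le _ _).trans (add_le_add_left ?_ _)
    refine (normF_add_le _ _).trans (add_le_add_left ?_ _)
    refine (normF_add_le _ _).trans (add_le_add_left ?_ _)
    exact normF_add_le _ _
  -- Since `pRatio Q ≤ 1`, the term of `phi1` in `pRatio T` alone also covers multiples of
  -- `pRatio T * pRatio Q`.
  have hx : 0 ≤ w * norm2 T := by positivity
  have e₁ : 0 ≤ pRatio T * (w * norm2 T) := by positivity
  have e₂ : pRatio T * pRatio Q * (w * norm2 T) ≤ pRatio T * (w * norm2 T) := by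
    have := mul_le_mul_of_nonneg_left hp₂1 e₁
    linarith
  have e₃ : 0 ≤ pRatio Q * (w * norm2 T) := by positivity
  have e₄ : 0 ≤ pRatio Q₁ * (w * norm2 T) := by positivity
  have e₅ : 0 ≤ pRatio T * pRatio Q₁ * (w * norm2 T) := by positivity
  have e₆ : 0 ≤ pRatio T * pRatio Q * (w * norm2 T) := by positivity
  unfold phi1
  linarith

end perturbation

/-! ### Backward errors of the steps of the algorithm -/

section steps

open Matrix Finset

variable {m n : ℕ}

/-- The properties of the rounding errors from which the error bounds follow deterministically:
all errors are at most `u` in absolute value, the tail sums of the addition errors of every inner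
product, and the initial sums of the subtraction errors of every substitution step, are at most
`tm` (for Gram matrices) or `tn` (for all other operations). -/
structure GoodErrors (u tm tn : ℝ) (e : Op m n → ℝ) : Prop where
  bound : ∀ o, |e o| ≤ u
  gram_sum : ∀ c (i j : Fin n), i ≤ j → ∀ k : Fin m,
    |∑ l with k ≤ l ∧ 0 < l.val, e (.gramAdd c i j l)| ≤ tm
  chol_sum : ∀ c (i j : Fin n), i ≤ j → ∀ l < i, |∑ k with k ≤ l, e (.cholSub c i j k)| ≤ tn
  solve_sum : ∀ c (r : Fin m) (j : Fin n), ∀ l < j, |∑ k with k ≤ l, e (.solveSub c r j k)| ≤ tn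
  tri_sum : ∀ c (i j k : Fin n), |∑ l with k ≤ l ∧ 0 < l.val, e (.triAdd c i j l)| ≤ tn

lemma abs_sum_val_lt_le {f : Fin n → ℝ} {t : ℝ} {j : Fin n} (ht : 0 ≤ t)
    (h : ∀ l < j, |∑ k with k ≤ l, f k| ≤ t) {l : ℕ} (hl : l ≤ j.val) :
    |∑ k with k.val < l, f k| ≤ t := by
  rcases l with _ | l
  · simpa using ht
  · have hlj : l < j.val := hl
    have := h ⟨l, hlj.trans j.isLt⟩ hlj
    convert this using 4
    rw [Fin.le_def]
    exact Nat.lt_succ_iff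

namespace GoodErrors

variable {u tm tn : ℝ} {e : Op m n → ℝ}

lemma cholErrors (H : GoodErrors u tm tn e) (ht : 0 ≤ tn) (c : Fin 3) :
    SubstErrors (fun (i j : Fin n) l => i ≤ j ∧ l ≤ i.val) u tn
      (fun i j k => e (.cholMul c i j k)) (fun i j k => e (.cholSub c i j k))
      (fun i j => e (.cholRootDiv c i j)) where
  mul _ _ _ := H.bound _
  sub _ _ _ := H.bound _
  div _ _ := H.bound _
  sum i j _ hl := abs_sum_val_lt_le ht (H.chol_sum c i j hl.1) hl.2

lemma solveErrors (H : GoodErrors u tm tn e) (ht : 0 ≤ tn) (c : Fin 3) :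
    SubstErrors (fun (_ : Fin m) (j : Fin n) l => l ≤ j.val) u tn
      (fun i j k => e (.solveMul c i j k)) (fun i j k => e (.solveSub c i j k))
      (fun i j => e (.solveDiv c i j)) where
  mul _ _ _ := H.bound _
  sub _ _ _ := H.bound _
  div _ _ := H.bound _
  sum i j _ hl := abs_sum_val_lt_le ht (H.solve_sum c i j) hl

variable (H : GoodErrors u tm tn e) (hu : u ≤ 1 / 2)

include H hu

lemma abs_gram_sub_le {a : ℝ} (ha : Real.exp (tm + u + (m + 1) * u ^ 2) - 1 ≤ a) (ha0 : 0 ≤ a)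
    (c : Fin 3) (X : Matrix (Fin m) (Fin n) ℝ) {i j : Fin n} (hij : i ≤ j) :
    |gram e c X i j - (Xᵀ * X) i j| ≤ a * gNorm X ^ 2 := by
  refine (abs_flMul_sub_le Xᵀ X _ _ hu i j (fun _ => H.bound _) (fun _ => H.bound _)
    (H.gram_sum c i j hij)).trans ?_
  refine mul_le_mul ha ((sum_abs_mul_abs_le (X.col i) (X.col j)).trans ?_)
    (Finset.sum_nonneg fun _ _ => by positivity) ha0
  rw [sq]
  exact mul_le_mul (vnorm_col_le_gNorm X i) (vnorm_col_le_gNorm X j) (vnorm_nonneg _)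
    (gNorm_nonneg X)

lemma normF_triProd_sub_le {d : ℝ} (hd : Real.exp (tn + u + (n + 1) * u ^ 2) - 1 ≤ d)
    (hd0 : 0 ≤ d) (c : Fin 2) (X Y : Matrix (Fin n) (Fin n) ℝ) :
    normF (triProd e c X Y - X * Y) ≤ n * d * (gNorm X * gNorm Y) := by
  refine normF_le_gNorm_of_abs_le_mul hd0 fun i j => ?_
  refine (abs_flMul_sub_le X Y _ _ hu i j (fun _ => H.bound _) (fun _ => H.bound _)
    (H.tri_sum c i j)).trans ?_
  exact mul_le_mul_of_nonneg_right hd (Finset.sum_nonneg fun _ _ => by positivity)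

variable (ht : 0 ≤ tn)

include ht

lemma normF_solve_mul_sub_le {d : ℝ} (hd : Real.exp (tn + u + (n + 1) * u ^ 2) - 1 ≤ d)
    (hd0 : 0 ≤ d) (c : Fin 3) (X : Matrix (Fin m) (Fin n) ℝ) (A : Matrix (Fin n) (Fin n) ℝ)
    (hA : Completes e c A) :
    normF (solve e c X (chol e c A) * chol e c A - X)
      ≤ n * d * (gNorm (solve e c X (chol e c A)) * gNorm (chol e c A)) := by
  refine normF_le_gNorm_of_abs_le_mul hd0 fun i j => ?_
  refine (abs_flSolve_mul_sub_le X (chol e c A) hu (H.solveErrors ht c)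
    (fun k j hkj => flChol_lower A hkj)
    (fun j => (flChol_diag_pos A hu (H.cholErrors ht c) (hA j)).ne') i j).trans ?_
  refine mul_le_mul_of_nonneg_right (le_trans (sub_le_sub_right (Real.exp_le_exp.2 ?_) 1) hd)
    (Finset.sum_nonneg fun _ _ => by positivity)
  nlinarith [sq_nonneg u]

/-- The Cholesky factorization of a sweep with input `X` and shift `s`: it completes, and the
Gram matrix of its factor is close to `Xᵀ X + s I`. -/
lemma chol_step {b h G μ s : ℝ} (hb : Real.exp (tn + 2 * u + (n + 1) * u ^ 2) - 1 ≤ b)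
    (hb0 : 0 ≤ b) (hb2 : b ≤ 1 / 2) (c : Fin 3) (X : Matrix (Fin m) (Fin n) ℝ)
    (A : Matrix (Fin n) (Fin n) ℝ) (hh : 0 ≤ h)
    (hAM : ∀ i j, i ≤ j → |A i j - (Xᵀ * X + s • (1 : Matrix (Fin n) (Fin n) ℝ)) i j| ≤ h)
    (hG : ∀ i, A i i ≤ (1 - b) * G) (hG0 : 0 ≤ G)
    (hμ : ∀ v, μ * vnorm v ^ 2 ≤ vnorm (X *ᵥ v) ^ 2 + s * vnorm v ^ 2)
    (hμn : n * (h + 2 * b * G) < μ) :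
    Completes e c A ∧ (∀ j, vnorm ((chol e c A).col j) ^ 2 ≤ G) ∧
      normF ((chol e c A)ᵀ * chol e c A - (Xᵀ * X + s • (1 : Matrix (Fin n) (Fin n) ℝ)))
        ≤ n * (h + b * G) ∧
      ∀ v, |vnorm (chol e c A *ᵥ v) ^ 2 - (vnorm (X *ᵥ v) ^ 2 + s * vnorm v ^ 2)|
        ≤ n * (h + b * G) * vnorm v ^ 2 := by
  set M := Xᵀ * X + s • (1 : Matrix (Fin n) (Fin n) ℝ) with hMdef
  have hM : ∀ i j, M i j = M j i := fun i j => by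
    have : Mᵀ = M := by simp [hMdef]
    exact congrFun (congrFun this.symm i) j
  have hquad : ∀ (k : ℕ) (Y : Matrix (Fin k) (Fin n) ℝ) (v : Fin n → ℝ),
      v ⬝ᵥ ((Yᵀ * Y) *ᵥ v) = vnorm (Y *ᵥ v) ^ 2 := fun k Y v => by
    rw [vnorm_sq_eq_dotProduct, ← Matrix.mulVec_mulVec, Matrix.dotProduct_mulVec,
      Matrix.vecMul_transpose]
  have hMv : ∀ v, v ⬝ᵥ (M *ᵥ v) = vnorm (X *ᵥ v) ^ 2 + s * vnorm v ^ 2 := fun v => by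
    rw [hMdef, Matrix.add_mulVec, dotProduct_add, hquad, Matrix.smul_mulVec, Matrix.one_mulVec,
      dotProduct_smul, vnorm_sq_eq_dotProduct v, smul_eq_mul]
  have hcomp : Completes e c A := fun i =>
    cholPivot_pos A M hu (H.cholErrors ht c) hb hb2 hM hAM hG hG0
      (fun v => (hμ v).trans_eq (hMv v).symm) hμn i
  obtain ⟨h1, h2⟩ := abs_transpose_mul_flChol_sub_le A M hu (H.cholErrors ht c) hb hb2 hM hAM hG
    hcomp
  have h3 : normF ((chol e c A)ᵀ * chol e c A - M) ≤ n * (h + b * G) :=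
    normF_le_of_forall_abs_le h2 (by positivity)
  refine ⟨hcomp, h1, h3, fun v => ?_⟩
  set V := chol e c A
  have h4 : vnorm (V *ᵥ v) ^ 2 - (vnorm (X *ᵥ v) ^ 2 + s * vnorm v ^ 2)
      = v ⬝ᵥ ((Vᵀ * V - M) *ᵥ v) := by
    rw [Matrix.sub_mulVec, dotProduct_sub, hquad, hMv]
  rw [h4]
  have h5 : |v ⬝ᵥ ((Vᵀ * V - M) *ᵥ v)| ≤ vnorm v * vnorm ((Vᵀ * V - M) *ᵥ v) := by
    refine le_trans ?_ (sum_abs_mul_abs_le _ _)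
    simp only [dotProduct, ← abs_mul]
    exact Finset.abs_sum_le_sum_abs _ _
  refine h5.trans ?_
  have h6 := (vnorm_mulVec_le_normF (Vᵀ * V - M) v).trans
    (mul_le_mul_of_nonneg_right h3 (vnorm_nonneg v))
  calc vnorm v * vnorm ((Vᵀ * V - M) *ᵥ v) ≤ vnorm v * (n * (h + b * G) * vnorm v) :=
        mul_le_mul_of_nonneg_left h6 (vnorm_nonneg v)
    _ = n * (h + b * G) * vnorm v ^ 2 := by ring

end GoodErrors

/-! ### Size of the backward error constants -/

lemma exp_sub_one_le {y z c : ℝ} (hy0 : 0 ≤ y) (hy : y ≤ c * z) (hz : z ≤ 1 / 2200)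
    (hc0 : 0 ≤ c) (hc : c ≤ 2) : Real.exp y - 1 ≤ 1.001 * c * z := by
  have hy1 : y ≤ 0.001 := by nlinarith
  have h1 := Real.abs_exp_sub_one_sub_id_le (x := y) (by rw [abs_of_nonneg hy0]; linarith)
  have h2 := (abs_le.1 h1).2
  nlinarith

lemma sqrt_add_one_le {r : ℝ} (hr : 1 ≤ r) : √(r - 1) + 1 ≤ 1.415 * √r := by
  have h1 := Real.sq_sqrt (show 0 ≤ r - 1 by linarith)
  have h2 := Real.sq_sqrt (show 0 ≤ r by linarith)
  refine le_of_sq_le_sq ?_ (by positivity)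
  nlinarith [sq_nonneg (√(r - 1) - 1)]

lemma sqrt_add_two_le {r : ℝ} (hr : 1 ≤ r) : √(r - 1) + 2 ≤ 1.733 * √(r + 1) := by
  have h1 := Real.sq_sqrt (show 0 ≤ r - 1 by linarith)
  have h2 := Real.sq_sqrt (show 0 ≤ r + 1 by linarith)
  refine le_of_sq_le_sq ?_ (by positivity)
  nlinarith [sq_nonneg (2 * √(r - 1) - 2)]

/-- Backward error constant of an operation with one error outside the controlled sum `t`; the
factor `k` comes from the passage from entries to matrices. -/
lemma exp_sub_one_le_of_one {r u lam t k : ℝ} (hr : 1 ≤ r) (hk : 1 ≤ k) (hu0 : 0 ≤ u)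
    (hlam : 1 ≤ lam) (ht0 : 0 ≤ t) (ht : t ≤ lam * √(r - 1) * u) (hru : (r + 1) * u ≤ 1 / 1000)
    (hz : lam * √r * k * u ≤ 1 / 2200) :
    k * (Real.exp (t + u + (r + 1) * u ^ 2) - 1) ≤ 1.5 * (lam * √r * k * u) := by
  have hs1 : 1 ≤ √r := Real.one_le_sqrt.2 hr
  have hls : 1 ≤ lam * √r := by nlinarith
  have hz' : lam * √r * u ≤ 1 / 2200 := by
    refine le_trans ?_ hz
    have : 0 ≤ lam * √r * u := by positivity
    nlinarith
  have hy : t + u + (r + 1) * u ^ 2 ≤ 1.42 * (lam * √r * u) := by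
    have h1 := mul_le_mul_of_nonneg_right (sqrt_add_one_le hr)
      (show 0 ≤ lam * u by positivity)
    have h2 : (r + 1) * u ^ 2 ≤ 1 / 1000 * u := by nlinarith
    have h3 : u ≤ lam * √r * u := by nlinarith
    have h4 : u ≤ lam * u := by nlinarith
    linarith
  have h5 := exp_sub_one_le (by positivity) hy hz' (by norm_num) (by norm_num)
  calc k * (Real.exp (t + u + (r + 1) * u ^ 2) - 1) ≤ k * (1.001 * 1.42 * (lam * √r * u)) :=
        mul_le_mul_of_nonneg_left h5 (by linarith)
    _ ≤ 1.5 * (lam * √r * k * u) := by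
        have : 0 ≤ lam * √r * k * u := by positivity
        linarith

/-- Backward error constant of the Cholesky factorization, whose square roots count twice. -/
lemma exp_sub_one_le_of_two {r u lam t k : ℝ} (hr : 1 ≤ r) (hk : 1 ≤ k) (hu0 : 0 ≤ u)
    (hlam : 1 ≤ lam) (ht0 : 0 ≤ t) (ht : t ≤ lam * √(r - 1) * u) (hru : (r + 1) * u ≤ 1 / 1000)
    (hz : lam * √(r + 1) * k * u ≤ 1 / 2200) :
    k * (Real.exp (t + 2 * u + (r + 1) * u ^ 2) - 1) ≤ 1.8 * (lam * √(r + 1) * k * u) := by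
  have hs1 : 1 ≤ √(r + 1) := Real.one_le_sqrt.2 (by linarith)
  have hls : 1 ≤ lam * √(r + 1) := by nlinarith
  have hz' : lam * √(r + 1) * u ≤ 1 / 2200 := by
    refine le_trans ?_ hz
    have : 0 ≤ lam * √(r + 1) * u := by positivity
    nlinarith
  have hy : t + 2 * u + (r + 1) * u ^ 2 ≤ 1.74 * (lam * √(r + 1) * u) := by
    have h1 := mul_le_mul_of_nonneg_right (sqrt_add_two_le hr)
      (show 0 ≤ lam * u by positivity)
    have h2 : (r + 1) * u ^ 2 ≤ 1 / 1000 * u := by nlinarith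
    have h3 : u ≤ lam * √(r + 1) * u := by nlinarith
    have h4 : u ≤ lam * u := by nlinarith
    linarith
  have h5 := exp_sub_one_le (by positivity) hy hz' (by norm_num) (by norm_num)
  calc k * (Real.exp (t + 2 * u + (r + 1) * u ^ 2) - 1)
        ≤ k * (1.001 * 1.74 * (lam * √(r + 1) * u)) :=
        mul_le_mul_of_nonneg_left h5 (by linarith)
    _ ≤ 1.8 * (lam * √(r + 1) * k * u) := by
        have : 0 ≤ lam * √(r + 1) * k * u := by positivity
        linarith

end steps

/-! ### The deterministic error bounds -/

section deterministic

open Matrix Finset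

variable {m n : ℕ}

lemma gNorm_pos {T : Matrix (Fin m) (Fin n) ℝ} (hn : 1 ≤ n) (hT : T.rank = n) : 0 < gNorm T := by
  have h1 := sigmaMin_pos hn hT
  have h2 := sigmaMin_mul_vnorm_le T (Pi.single (⟨0, hn⟩ : Fin n) 1)
  rw [vnorm_single, mul_one, ← vnorm_col_eq] at h2
  exact h1.trans_le (h2.trans (vnorm_col_le_gNorm T _))

lemma gram_diag_le_gNorm (X : Matrix (Fin m) (Fin n) ℝ) (i : Fin n) :
    (Xᵀ * X) i i ≤ gNorm X ^ 2 := by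
  have h1 := pow_le_pow_left₀ (vnorm_nonneg _) (vnorm_col_le_gNorm X i) 2
  rw [vnorm_sq] at h1
  simpa [Matrix.mul_apply, sq] using h1

lemma gNorm_le_mul_of_sq_le {V : Matrix (Fin n) (Fin n) ℝ} {g c C : ℝ} (hg : 0 ≤ g) (hc : 0 ≤ c)
    (hC : C ≤ c ^ 2) (h : ∀ j, vnorm (V.col j) ^ 2 ≤ C * g ^ 2) : gNorm V ≤ c * g :=
  gNorm_le (mul_nonneg hc hg) fun j => le_mul_of_sq_le hg hc
    ((h j).trans (mul_le_mul_of_nonneg_right hC (sq_nonneg g)))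

/-- The size of the backward errors of the operations of the algorithm, as consumed by the
analysis of the sweeps.  `a`, `b`, `d` are the relative backward errors of an entry of a Gram
matrix, of a Cholesky factorization, and of a triangular solve or product. -/
structure ErrorConstants (m n : ℕ) (u tm tn a b d A B w : ℝ) : Prop where
  u_nonneg : 0 ≤ u
  u_le : u ≤ 1 / 2200
  tn_nonneg : 0 ≤ tn
  gram_le : Real.exp (tm + u + (m + 1) * u ^ 2) - 1 ≤ a
  chol_le : Real.exp (tn + 2 * u + (n + 1) * u ^ 2) - 1 ≤ b
  tri_le : Real.exp (tn + u + (n + 1) * u ^ 2) - 1 ≤ d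
  a_nonneg : 0 ≤ a
  b_nonneg : 0 ≤ b
  d_nonneg : 0 ≤ d
  a_le : n * a ≤ 1.5 * A
  b_le : n * b ≤ 1.8 * B
  d_le : n * d ≤ 1.5 * w
  u_le_B : n * u ≤ B
  w_nonneg : 0 ≤ w
  w_le : w ≤ B
  A_pos : 0 < A
  A_le : A ≤ 1 / 2200
  B_le : B ≤ 1 / 2200
  one_le : 1 ≤ n

namespace ErrorConstants

variable {u tm tn a b d A B w : ℝ} {e : Op m n → ℝ}

section

variable (C : ErrorConstants m n u tm tn a b d A B w)

include C

lemma one_le_cast : (1 : ℝ) ≤ n := by exact_mod_cast C.one_le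

lemma a_small : a ≤ 0.0007 := by
  have := mul_le_mul_of_nonneg_right C.one_le_cast C.a_nonneg
  linarith [C.a_le, C.A_le]

lemma b_small : b ≤ 0.0009 := by
  have := mul_le_mul_of_nonneg_right C.one_le_cast C.b_nonneg
  linarith [C.b_le, C.B_le]

lemma B_nonneg : 0 ≤ B := C.w_nonneg.trans C.w_le

lemma E_pos : 0 < A + B := add_pos_of_pos_of_nonneg C.A_pos C.B_nonneg

lemma E_le : A + B ≤ 1 / 1100 := by linarith [C.A_le, C.B_le]

lemma w_le_E : w ≤ A + B := by linarith [C.w_le, C.A_pos]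

lemma u_le_half : u ≤ 1 / 2 := C.u_le.trans (by norm_num)

variable (H : GoodErrors u tm tn e)

include H

lemma solve_bound (c : Fin 3) (X : Matrix (Fin m) (Fin n) ℝ) (A' : Matrix (Fin n) (Fin n) ℝ)
    (hA : Completes e c A') :
    normF (solve e c X (chol e c A') * chol e c A' - X)
      ≤ 1.5 * w * (gNorm (solve e c X (chol e c A')) * gNorm (chol e c A')) :=
  (H.normF_solve_mul_sub_le C.u_le_half C.tn_nonneg C.tri_le C.d_nonneg c X A' hA).trans
    (mul_le_mul_of_nonneg_right C.d_le (mul_nonneg (gNorm_nonneg _) (gNorm_nonneg _)))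

lemma triProd_bound (c : Fin 2) (X Y : Matrix (Fin n) (Fin n) ℝ) :
    normF (triProd e c X Y - X * Y) ≤ 1.5 * w * (gNorm X * gNorm Y) :=
  (H.normF_triProd_sub_le C.u_le_half C.tri_le C.d_nonneg c X Y).trans
    (mul_le_mul_of_nonneg_right C.d_le (mul_nonneg (gNorm_nonneg _) (gNorm_nonneg _)))

/-- The Cholesky factorization of the shifted sweep. -/
lemma shifted_chol (T : Matrix (Fin m) (Fin n) ℝ) {s : ℝ} (hs : s = 11 * (A + B) * gNorm T ^ 2)
    (hg : 0 < gNorm T) :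
    Completes e 0 (addShift e s (gram e 0 T)) ∧
      gNorm (chol e 0 (addShift e s (gram e 0 T))) ≤ 1.01 * gNorm T ∧
      ∀ v, vnorm (T *ᵥ v) ^ 2 + 8 * (A + B) * gNorm T ^ 2 * vnorm v ^ 2
          ≤ vnorm (chol e 0 (addShift e s (gram e 0 T)) *ᵥ v) ^ 2 ∧
        vnorm (chol e 0 (addShift e s (gram e 0 T)) *ᵥ v) ^ 2
          ≤ vnorm (T *ᵥ v) ^ 2 + 14 * (A + B) * gNorm T ^ 2 * vnorm v ^ 2 := by
  set g := gNorm T with hgdef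
  have ha := C.a_small
  have hb := C.b_small
  have ha0 := C.a_nonneg
  have hb0 := C.b_nonneg
  have hu0 := C.u_nonneg
  have hu1 := C.u_le
  have hE0 := C.E_pos
  have hg2 : 0 < g ^ 2 := by positivity
  have hs0 : 0 ≤ s := by rw [hs]; positivity
  have hs1 : s ≤ 0.01 * g ^ 2 := by
    rw [hs]
    have := mul_le_mul_of_nonneg_right C.E_le hg2.le
    linarith
  have hd0 : ∀ i, 0 ≤ (Tᵀ * T) i i := fun i => by
    rw [Matrix.mul_apply]
    exact Finset.sum_nonneg fun k _ => mul_self_nonneg _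
  set h : ℝ := (a + 1.02 * u) * g ^ 2 with hh
  have hh0 : 0 ≤ h := by positivity
  have hh1 : h ≤ 0.0012 * g ^ 2 := mul_le_mul_of_nonneg_right (by linarith) hg2.le
  have hAM : ∀ i j, i ≤ j → |addShift e s (gram e 0 T) i j
      - (Tᵀ * T + s • (1 : Matrix (Fin n) (Fin n) ℝ)) i j| ≤ h := by
    intro i j hij
    have h1 := H.abs_gram_sub_le C.u_le_half C.gram_le C.a_nonneg 0 T hij
    rcases eq_or_ne i j with rfl | hne
    · have hr := H.bound (.shiftAdd i)
      have h2 := gram_diag_le_gNorm T i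
      have h3 := hd0 i
      obtain ⟨h4, h5⟩ := abs_le.1 h1
      have hag : a * g ^ 2 ≤ 0.0007 * g ^ 2 := mul_le_mul_of_nonneg_right ha hg2.le
      have h6 : |gram e 0 T i i + s| ≤ 1.02 * g ^ 2 := by
        rw [abs_le]; constructor <;> linarith
      have h7 : addShift e s (gram e 0 T) i i
          - (Tᵀ * T + s • (1 : Matrix (Fin n) (Fin n) ℝ)) i i
          = (gram e 0 T i i - (Tᵀ * T) i i) + (gram e 0 T i i + s) * e (.shiftAdd i) := by
        simp [addShift]; ring
      rw [h7, hh]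
      refine (abs_add_le _ _).trans ?_
      rw [abs_mul]
      have h8 : |gram e 0 T i i + s| * |e (.shiftAdd i)| ≤ 1.02 * g ^ 2 * u :=
        mul_le_mul h6 hr (abs_nonneg _) (by positivity)
      linarith
    · have h7 : addShift e s (gram e 0 T) i j
          - (Tᵀ * T + s • (1 : Matrix (Fin n) (Fin n) ℝ)) i j
          = gram e 0 T i j - (Tᵀ * T) i j := by
        simp [addShift, hne]
      rw [h7, hh]
      refine h1.trans (mul_le_mul_of_nonneg_right (by linarith) hg2.le)
  have hnh : n * h ≤ (1.5 * A + 1.02 * B) * g ^ 2 := by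
    rw [hh, ← mul_assoc]
    refine mul_le_mul_of_nonneg_right ?_ hg2.le
    linarith [C.a_le, C.u_le_B]
  have hnb : n * (b * (1.02 * g ^ 2)) ≤ 1.836 * B * g ^ 2 := by
    have := mul_le_mul_of_nonneg_right C.b_le (show 0 ≤ 1.02 * g ^ 2 by positivity)
    linarith
  have hAg : 0 ≤ A * g ^ 2 := mul_nonneg C.A_pos.le hg2.le
  have hAg' : 0 < A * g ^ 2 := mul_pos C.A_pos hg2
  have hBg : 0 ≤ B * g ^ 2 := mul_nonneg C.B_nonneg hg2.le
  obtain ⟨h1, h2, -, h4⟩ := H.chol_step C.u_le_half C.tn_nonneg C.chol_le hb0 (by linarith) 0 T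
    (addShift e s (gram e 0 T)) (h := h) (G := 1.02 * g ^ 2) (μ := s) (s := s) hh0 hAM
    (fun i => by
      have h1 := (abs_le.1 (hAM i i le_rfl)).2
      have h2 := gram_diag_le_gNorm T i
      simp only [Matrix.add_apply, Matrix.smul_apply, Matrix.one_apply_eq, smul_eq_mul,
        mul_one] at h1
      have h3 : b * (1.02 * g ^ 2) ≤ 0.0009 * (1.02 * g ^ 2) := by gcongr
      linarith)
    (by positivity)
    (fun v => by linarith [sq_nonneg (vnorm (T *ᵥ v))])
    (by rw [hs]; linarith)
  refine ⟨h1, gNorm_le_mul_of_sq_le hg.le (by norm_num) (by norm_num) h2, fun v => ?_⟩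
  have h5 := abs_le.1 (h4 v)
  have h6 : n * (h + b * (1.02 * g ^ 2)) * vnorm v ^ 2
      ≤ 3 * (A + B) * g ^ 2 * vnorm v ^ 2 :=
    mul_le_mul_of_nonneg_right (by linarith) (sq_nonneg _)
  have h7 : 0 ≤ (A + B) * g ^ 2 * vnorm v ^ 2 := by positivity
  have h8 : s * vnorm v ^ 2 = 11 * (A + B) * g ^ 2 * vnorm v ^ 2 := by rw [hs]
  constructor <;> linarith

/-- The Cholesky factorization of a sweep without shift. -/
lemma unshifted_chol (c : Fin 3) (X : Matrix (Fin m) (Fin n) ℝ) (hg : 0 < gNorm X)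
    (hX : ∀ v, 5 * (A + B) * gNorm X ^ 2 * vnorm v ^ 2 ≤ vnorm (X *ᵥ v) ^ 2) :
    Completes e c (gram e c X) ∧
      gNorm (chol e c (gram e c X)) ≤ 1.005 * gNorm X ∧
      normF ((chol e c (gram e c X))ᵀ * chol e c (gram e c X) - Xᵀ * X)
        ≤ 1.82 * (A + B) * gNorm X ^ 2 ∧
      ∀ v, |vnorm (chol e c (gram e c X) *ᵥ v) ^ 2 - vnorm (X *ᵥ v) ^ 2|
        ≤ 1.82 * (A + B) * gNorm X ^ 2 * vnorm v ^ 2 := by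
  set g := gNorm X with hgdef
  have ha := C.a_small
  have hb := C.b_small
  have ha0 := C.a_nonneg
  have hb0 := C.b_nonneg
  have hg2 : 0 < g ^ 2 := by positivity
  have hAM : ∀ i j, i ≤ j → |gram e c X i j
      - (Xᵀ * X + (0 : ℝ) • (1 : Matrix (Fin n) (Fin n) ℝ)) i j| ≤ a * g ^ 2 := by
    intro i j hij
    simpa using H.abs_gram_sub_le C.u_le_half C.gram_le C.a_nonneg c X hij
  have hnh : n * (a * g ^ 2) ≤ 1.5 * A * g ^ 2 := by
    rw [← mul_assoc]
    exact mul_le_mul_of_nonneg_right C.a_le hg2.le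
  have hnb : n * (b * (1.01 * g ^ 2)) ≤ 1.818 * B * g ^ 2 := by
    have := mul_le_mul_of_nonneg_right C.b_le (show 0 ≤ 1.01 * g ^ 2 by positivity)
    linarith
  have hAg : 0 < A * g ^ 2 := mul_pos C.A_pos hg2
  have hBg : 0 ≤ B * g ^ 2 := mul_nonneg C.B_nonneg hg2.le
  obtain ⟨h1, h2, h3, h4⟩ := H.chol_step C.u_le_half C.tn_nonneg C.chol_le hb0 (by linarith) c X
    (gram e c X) (h := a * g ^ 2) (G := 1.01 * g ^ 2) (μ := 5 * (A + B) * g ^ 2) (s := 0)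
    (by positivity) hAM
    (fun i => by
      have h1 := (abs_le.1 (hAM i i le_rfl)).2
      have h2 := gram_diag_le_gNorm X i
      simp only [zero_smul, add_zero] at h1
      have h3 : b * (1.01 * g ^ 2) ≤ 0.0009 * (1.01 * g ^ 2) := by gcongr
      have h4 : a * g ^ 2 ≤ 0.0007 * g ^ 2 := by gcongr
      linarith)
    (by positivity) (fun v => by simpa using hX v) (by linarith)
  simp only [zero_smul, add_zero, zero_mul] at h3 h4
  have hκ : n * (a * g ^ 2 + b * (1.01 * g ^ 2)) ≤ 1.82 * (A + B) * g ^ 2 := by linarith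
  exact ⟨h1, gNorm_le_mul_of_sq_le hg.le (by norm_num) (by norm_num) h2, h3.trans hκ,
    fun v => (h4 v).trans (mul_le_mul_of_nonneg_right hκ (sq_nonneg _))⟩

/-- The error bounds of Shifted CholeskyQR3 for rounding errors with small sums. -/
theorem sCholeskyQR3_bounds (T : Matrix (Fin m) (Fin n) ℝ) (hT : T.rank = n) {s : ℝ}
    (hs : s = 11 * (A + B) * gNorm T ^ 2) :
    Completes e 0 (sCholeskyQR3 T s e).A ∧
      (kappa2 T ≤ 1 / (86 * pRatio T * pRatio (sCholeskyQR3 T s e).Q * (A + B)) →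
        Completes e 1 (sCholeskyQR3 T s e).U₁ ∧ Completes e 2 (sCholeskyQR3 T s e).U₂ ∧
        normF ((sCholeskyQR3 T s e).Q₂ᵀ * (sCholeskyQR3 T s e).Q₂ - 1)
          ≤ 6 * pRatio (sCholeskyQR3 T s e).Q₁ ^ 2 * (A + B) ∧
        normF ((sCholeskyQR3 T s e).Q₂ * (sCholeskyQR3 T s e).V₄ - T)
          ≤ phi1 (pRatio T) (pRatio (sCholeskyQR3 T s e).Q) (pRatio (sCholeskyQR3 T s e).Q₁)
            * w * norm2 T) := by
  have hE0 := C.E_pos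
  have hE1 := C.E_le
  have hwE := C.w_le_E
  have hg := gNorm_pos C.one_le hT
  obtain ⟨hc0, hVg, hV⟩ := C.shifted_chol H T hs hg
  refine ⟨hc0, fun hκ => ?_⟩
  simp only [sCholeskyQR3] at hκ ⊢
  set A' := addShift e s (gram e 0 T)
  set V := chol e 0 A'
  set Q := solve e 0 T V with hQdef
  have hD : normF (Q * V - T) ≤ 1.5 * w * (gNorm Q * gNorm V) := C.solve_bound H 0 T A' hc0
  -- The bound on the condition number, as a lower bound for `T`.  It forces `pRatio Q` to be
  -- positive, for otherwise its right-hand side is the quotient `1 / 0 = 0`.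
  have hσ := sigmaMin_pos C.one_le hT
  have hT2 : 0 < norm2 T := hg.trans_le (gNorm_le_norm2 T)
  have hκ0 : 0 < kappa2 T := div_pos hT2 hσ
  have hK : 0 < 86 * pRatio T * pRatio Q * (A + B) := one_div_pos.1 (hκ0.trans_le hκ)
  have hp2 : 0 < pRatio Q := by
    rcases (pRatio_nonneg Q).eq_or_lt with h | h
    · rw [← h] at hK; simp at hK
    · exact h
  have hκv : ∀ v, 86 * pRatio Q * (A + B) * gNorm T * vnorm v ≤ vnorm (T *ᵥ v) := fun v => by
    refine le_trans (mul_le_mul_of_nonneg_right ?_ (vnorm_nonneg v)) (sigmaMin_mul_vnorm_le T v)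
    have h1 : norm2 T / sigmaMin T ≤ 1 / (86 * pRatio T * pRatio Q * (A + B)) := hκ
    rw [div_le_div_iff₀ hσ hK, one_mul] at h1
    rw [gNorm_eq_pRatio_mul T]
    linarith
  have hQ2 : norm2 Q ≤ 1.02 :=
    shifted_norm2_le hE0 hE1 hwE hg (fun v => (hV v).1) hVg hD
  have hQlow := shifted_lower_bound hE0 hE1 hwE hg (fun v => (hV v).1) hVg hD
    (fun v => (hV v).2) hκv
  have hgQ : 0 < gNorm Q := by
    have h : norm2 Q ≠ 0 := fun h => by simp [pRatio, h] at hp2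
    rw [gNorm_eq_pRatio_mul]
    exact mul_pos hp2 (lt_of_le_of_ne (norm2_nonneg Q) h.symm)
  obtain ⟨hc1, hV₁g, -, hV₁⟩ := C.unshifted_chol H 1 Q hgQ fun v => by
    have : 0 ≤ (A + B) * gNorm Q ^ 2 * vnorm v ^ 2 := by positivity
    linarith [hQlow v]
  set V₁ := chol e 1 (gram e 1 Q)
  set Q₁ := solve e 1 Q V₁
  have hD₁ : normF (Q₁ * V₁ - Q) ≤ 1.5 * w * (gNorm Q₁ * gNorm V₁) := C.solve_bound H 1 Q _ hc1
  obtain ⟨hV₁2, hQ₁2, hQ₁⟩ := second_sweep_bounds hE0 hE1 hwE hgQ hQ2 hQlow hV₁ hV₁g hD₁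
  have hgQ₁ : 0.99 ≤ gNorm Q₁ := by
    have h1 := hQ₁ (Pi.single (⟨0, C.one_le⟩ : Fin n) 1)
    rw [vnorm_single, ← vnorm_col_eq] at h1
    linarith [vnorm_col_le_gNorm Q₁ ⟨0, C.one_le⟩]
  have hgQ₁1 : gNorm Q₁ ≤ 1.01 := (gNorm_le_norm2 Q₁).trans hQ₁2
  obtain ⟨hc2, hV₃g, hV₃F, hV₃⟩ := C.unshifted_chol H 2 Q₁ (by linarith) fun v => by
    have h1 := pow_le_pow_left₀ (mul_nonneg (by norm_num) (vnorm_nonneg v)) (hQ₁ v) 2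
    have h2 : 5 * (A + B) * gNorm Q₁ ^ 2 * vnorm v ^ 2 ≤
        5 * (1 / 1100) * 1.01 ^ 2 * vnorm v ^ 2 := by
      have := gNorm_nonneg Q₁
      gcongr
    linarith [sq_nonneg (vnorm v)]
  set V₃ := chol e 2 (gram e 2 Q₁)
  set Q₂ := solve e 2 Q₁ V₃
  have hD₂ : normF (Q₂ * V₃ - Q₁) ≤ 1.5 * w * (gNorm Q₂ * gNorm V₃) := C.solve_bound H 2 Q₁ _ hc2
  obtain ⟨hQ₂2, horth⟩ := third_sweep_bounds hE0 hE1 hwE hQ₁2 hgQ₁ hQ₁ hV₃F hV₃ hV₃g hD₂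
  refine ⟨hc1, hc2, horth, ?_⟩
  exact residual_le C.w_nonneg (C.w_le.trans C.B_le)
    (shifted_norm2_factor_le hE1 fun v => (hV v).2) hVg hQ2 hV₁2 hV₁g hQ₁2 hV₃g hQ₂2 hD hD₁ hD₂
    (C.triProd_bound H 0 V₁ V) (C.triProd_bound H 1 V₃ _)

end

end ErrorConstants

end deterministic

/-! ### Sums of independent rounding errors -/

section probability_bounds

open MeasureTheory ProbabilityTheory Finset

section independent_errors

variable {Ω : Type*} [MeasurableSpace Ω] {μ : Measure Ω} [IsProbabilityMeasure μ]
  {ι : Type*} {δ : ι → Ω → ℝ} {u lam : ℝ}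

/-- Hoeffding's inequality for at most `N` independent rounding errors. -/
lemma measureReal_lt_abs_sum_le (hu : 0 < u) (hu1 : u ≤ 1) (hlam : 0 ≤ lam)
    (hδ_meas : ∀ o, Measurable (δ o)) (hδ_indep : iIndepFun δ μ)
    (hδ_mean : ∀ o, ∫ ω, δ o ω ∂μ = 0) (hδ_bound : ∀ o, ∀ᵐ ω ∂μ, |δ o ω| ≤ u)
    (S : Finset ι) {N : ℝ} (hN : #S ≤ N) :
    μ.real {ω | lam * (1 - u) * √N * u < |∑ o ∈ S, δ o ω|}
      ≤ 2 * Real.exp (-(lam ^ 2 * (1 - u) ^ 2) / 2) := by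
  set t := lam * (1 - u) * √N * u with ht
  have hu1' : 0 ≤ 1 - u := by linarith
  have ht0 : 0 ≤ t := by positivity
  rcases S.eq_empty_or_nonempty with rfl | hS
  · have : {ω : Ω | t < |∑ o ∈ (∅ : Finset ι), δ o ω|} = ∅ := by
      ext ω; simpa using ht0
    rw [this, measureReal_empty]; positivity
  have hS0 : (0 : ℝ) < #S := by exact_mod_cast hS.card_pos
  have hexp : ∀ X : ι → Ω → ℝ, iIndepFun X μ → (∀ o, Measurable (X o)) →
      (∀ o, ∫ ω, X o ω ∂μ = 0) → (∀ o, ∀ᵐ ω ∂μ, |X o ω| ≤ u) →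
      μ.real {ω | t ≤ ∑ o ∈ S, X o ω} ≤ Real.exp (-(lam ^ 2 * (1 - u) ^ 2) / 2) := by
    intro X hi hm h0 hb
    refine (HasSubgaussianMGF.measure_sum_ge_le_of_iIndepFun hi (s := S)
      (c := fun _ => (‖u - -u‖₊ / 2) ^ 2) (fun o _ => ?_) ht0).trans (Real.exp_le_exp.2 ?_)
    · refine hasSubgaussianMGF_of_mem_Icc_of_integral_eq_zero (hm o).aemeasurable ?_ (h0 o)
      filter_upwards [hb o] with ω hω using abs_le.1 hω
    · have hc : ((((‖u - -u‖₊ / 2) ^ 2 : NNReal)) : ℝ) = u ^ 2 := by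
        push_cast
        rw [Real.norm_eq_abs, abs_of_nonneg (by linarith)]
        ring
      rw [Finset.sum_const, nsmul_eq_mul, NNReal.coe_mul, hc, NNReal.coe_natCast, neg_div,
        neg_div, neg_le_neg_iff]
      rw [div_le_div_iff₀ (by norm_num) (by positivity)]
      have hsq : √N ^ 2 = N := Real.sq_sqrt (hS0.le.trans hN)
      have ht2 : t ^ 2 = lam ^ 2 * (1 - u) ^ 2 * u ^ 2 * N := by
        calc t ^ 2 = lam ^ 2 * (1 - u) ^ 2 * u ^ 2 * √N ^ 2 := by rw [ht]; ring
          _ = _ := by rw [hsq]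
      rw [ht2]
      have := mul_le_mul_of_nonneg_left hN
        (show 0 ≤ lam ^ 2 * (1 - u) ^ 2 * u ^ 2 by positivity)
      linarith
  have h1 := hexp δ hδ_indep hδ_meas hδ_mean hδ_bound
  have h2 := hexp (fun o ω => -δ o ω) (hδ_indep.comp (fun _ x => -x) fun _ => measurable_neg)
    (fun o => (hδ_meas o).neg) (fun o => by rw [integral_neg, hδ_mean, neg_zero])
    (fun o => by simpa using hδ_bound o)
  have hsub : {ω | t < |∑ o ∈ S, δ o ω|} ⊆
      {ω | t ≤ ∑ o ∈ S, δ o ω} ∪ {ω | t ≤ ∑ o ∈ S, -δ o ω} := by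
    intro ω hω
    have hω : t < |∑ o ∈ S, δ o ω| := hω
    rcases lt_abs.1 hω with h | h
    · exact Or.inl h.le
    · refine Or.inr ?_
      simpa using h.le
  calc _ ≤ _ := measureReal_mono hsub
    _ ≤ _ := measureReal_union_le _ _
    _ ≤ _ := by linarith

/-- Events that belong to disjoint groups of independent random variables are independent. -/
lemma measure_biInter_eq_prod_of_groups {γ : Type*} [DecidableEq γ] (g : ι → γ)
    (hδ_meas : ∀ o, Measurable (δ o)) (hδ_indep : iIndepFun δ μ) {B : γ → Set Ω}
    (hB : ∀ c, MeasurableSet[⨆ o ∈ g ⁻¹' {c}, MeasurableSpace.comap (δ o) inferInstance] (B c))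
    (s : Finset γ) : μ (⋂ c ∈ s, B c) = ∏ c ∈ s, μ (B c) := by
  have hle : ∀ o, MeasurableSpace.comap (δ o) inferInstance ≤ ‹MeasurableSpace Ω› :=
    fun o => (hδ_meas o).comap_le
  induction s using Finset.induction_on with
  | empty => simp
  | insert c s hc ih =>
    rw [Finset.set_biInter_insert, Finset.prod_insert hc, ← ih]
    have hdisj : Disjoint (g ⁻¹' {c}) (g ⁻¹' (s : Set γ)) :=
      Disjoint.preimage g (by simpa using hc)
    have hind := indep_iSup_of_disjoint hle hδ_indep.iIndep hdisj
    refine (Indep_iff _ _ μ).1 hind _ _ (hB c) ?_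
    refine Finset.measurableSet_biInter s fun c' hc' => ?_
    refine (iSup₂_mono' fun o ho => ⟨o, ?_, le_rfl⟩ :
      (⨆ o ∈ g ⁻¹' {c'}, MeasurableSpace.comap (δ o) inferInstance) ≤ _) _ (hB c')
    have : g o = c' := ho
    simpa [this] using hc'

/-- The probability that finitely many sums of rounding errors are all small: within a group
`c` of sums the failure probabilities add up, and the groups are independent. -/
lemma prod_le_measureReal_forall {γ : Type*} [Fintype γ] [DecidableEq γ] (g : ι → γ)
    (hδ_meas : ∀ o, Measurable (δ o)) (hδ_indep : iIndepFun δ μ) {K : γ → Type*}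
    [∀ c, Fintype (K c)] (S : ∀ c, K c → Finset ι) (hS : ∀ c κ, ∀ o ∈ S c κ, g o = c)
    (t : ∀ c, K c → ℝ) {β : ℝ}
    (hβ : ∀ c κ, μ.real {ω | t c κ < |∑ o ∈ S c κ, δ o ω|} ≤ β)
    (hpos : ∀ c, 0 ≤ 1 - Fintype.card (K c) * β) :
    ∏ c, (1 - Fintype.card (K c) * β)
      ≤ μ.real {ω | ∀ c κ, |∑ o ∈ S c κ, δ o ω| ≤ t c κ} := by
  set B : γ → Set Ω := fun c => {ω | ∀ κ, |∑ o ∈ S c κ, δ o ω| ≤ t c κ} with hBdef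
  have hB : ∀ c, MeasurableSet[⨆ o ∈ g ⁻¹' {c}, MeasurableSpace.comap (δ o) inferInstance]
      (B c) := by
    intro c
    have hset : B c = ⋂ κ, {ω | |∑ o ∈ S c κ, δ o ω| ≤ t c κ} := by
      ext ω; simp [hBdef]
    rw [hset]
    refine MeasurableSet.iInter fun κ => ?_
    have hm : ∀ o ∈ S c κ,
        Measurable[⨆ o ∈ g ⁻¹' {c}, MeasurableSpace.comap (δ o) inferInstance] (δ o) := by
      intro o ho
      refine (comap_measurable (δ o)).mono ?_ le_rfl
      exact le_iSup₂_of_le o (hS c κ o ho) le_rfl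
    have hsum := Finset.measurable_fun_sum (S c κ) hm
    exact hsum (measurableSet_Icc (a := -(t c κ)) (b := t c κ)) |> fun h => by
      convert h using 1
      ext ω
      simp [abs_le]
  have hle : ∀ c, (⨆ o ∈ g ⁻¹' {c}, MeasurableSpace.comap (δ o) inferInstance)
      ≤ ‹MeasurableSpace Ω› := fun c => iSup₂_le fun o _ => (hδ_meas o).comap_le
  have hset : {ω | ∀ c κ, |∑ o ∈ S c κ, δ o ω| ≤ t c κ} = ⋂ c ∈ (univ : Finset γ), B c := by
    ext ω; simp [hBdef]
  rw [hset, measureReal_def, measure_biInter_eq_prod_of_groups g hδ_meas hδ_indep hB univ,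
    ENNReal.toReal_prod]
  refine Finset.prod_le_prod (fun c _ => hpos c) fun c _ => ?_
  have hcompl : (B c)ᶜ = ⋃ κ, {ω | t c κ < |∑ o ∈ S c κ, δ o ω|} := by
    ext ω; simp [hBdef]
  have h1 : μ.real (B c)ᶜ ≤ Fintype.card (K c) * β := by
    rw [hcompl]
    refine (measureReal_iUnion_fintype_le _).trans ?_
    refine (Finset.sum_le_sum fun κ _ => hβ c κ).trans_eq ?_
    simp
  rw [probReal_compl_eq_one_sub (hle c _ (hB c))] at h1
  rw [← measureReal_def]
  linarith

end independent_errors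

/-! ### The rounding errors of the algorithm -/

variable {m n : ℕ}

instance : Countable (Op m n) := by
  let f : Op m n → ℕ × ℕ × ℕ × ℕ × ℕ := fun
    | .gramMul c i j k => (0, c, i, j, k)
    | .gramAdd c i j k => (1, c, i, j, k)
    | .shiftAdd i => (2, i, 0, 0, 0)
    | .cholMul c i j k => (3, c, i, j, k)
    | .cholSub c i j k => (4, c, i, j, k)
    | .cholRootDiv c i j => (5, c, i, j, 0)
    | .solveMul c i j k => (6, c, i, j, k)
    | .solveSub c i j k => (7, c, i, j, k)
    | .solveDiv c i j => (8, c, i, j, 0)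
    | .triMul c i j k => (9, c, i, j, k)
    | .triAdd c i j k => (10, c, i, j, k)
  have hf : Function.Injective f := by
    intro a b h
    cases a <;> cases b <;> simp_all [f, Fin.ext_iff]
  exact hf.countable

/-- The groups into which the operations are divided, in this order: the Gram matrix, the shift and
the triangular solve of a sweep; the Cholesky factorization of a sweep; a product of triangular
factors. -/
abbrev OpGroup : Type := Fin 3 ⊕ Fin 3 ⊕ Fin 2

/-- The group of an operation. -/
def Op.group : Op m n → OpGroup
  | .gramMul c _ _ _ => .inl c
  | .gramAdd c _ _ _ => .inl c
  | .shiftAdd _ => .inl 0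
  | .cholMul c _ _ _ => .inr (.inl c)
  | .cholSub c _ _ _ => .inr (.inl c)
  | .cholRootDiv c _ _ => .inr (.inl c)
  | .solveMul c _ _ _ => .inl c
  | .solveSub c _ _ _ => .inl c
  | .solveDiv c _ _ => .inl c
  | .triMul c _ _ _ => .inr (.inr c)
  | .triAdd c _ _ _ => .inr (.inr c)

/-- The sums of rounding errors that are controlled in a group.  Only the upper triangle of a Gram
matrix matters, and the step `j` of a triangular solve involves `j` sums; so a sweep needs
exactly `m n²` sums for both. -/
abbrev SumIndex (m n : ℕ) : OpGroup → Type
  | .inl _ => ({p : Fin n × Fin n // p.1 ≤ p.2} × Fin m) ⊕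
      (Fin m × {p : Fin n × Fin n // ¬ p.1 ≤ p.2})
  | .inr (.inl _) => Σ j : Fin n, Σ i : Fin (j.val + 1), Fin i.val
  | .inr (.inr _) => Fin n × Fin n × Fin n

instance : ∀ c, Fintype (SumIndex m n c)
  | .inl _ => inferInstanceAs (Fintype (_ ⊕ _))
  | .inr (.inl _) => inferInstanceAs (Fintype (Sigma _))
  | .inr (.inr _) => inferInstanceAs (Fintype (_ × _))

/-- The operations whose errors enter a controlled sum. -/
def sumOps (m n : ℕ) : ∀ c : OpGroup, SumIndex m n c → Finset (Op m n)
  | .inl c, .inl (p, k) => ({l | k ≤ l ∧ 0 < l.val} : Finset (Fin m)).map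
      ⟨fun l => .gramAdd c p.1.1 p.1.2 l, fun _ _ h => by injection h⟩
  | .inl c, .inr (r, p) => ({k | k ≤ p.1.2} : Finset (Fin n)).map
      ⟨fun k => .solveSub c r p.1.1 k, fun _ _ h => by injection h⟩
  | .inr (.inl c), ⟨j, i, l⟩ => ({k | k.val ≤ l.val} : Finset (Fin n)).map
      ⟨fun k => .cholSub c (i.castLE j.isLt) j k, fun _ _ h => by injection h⟩
  | .inr (.inr c), (i, j, k) => ({l | k ≤ l ∧ 0 < l.val} : Finset (Fin n)).map
      ⟨fun l => .triAdd c i j l, fun _ _ h => by injection h⟩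

/-- The bound on a controlled sum: `tm` for the sums of a Gram matrix, `tn` for all others. -/
def sumBound (tm tn : ℝ) : ∀ c : OpGroup, SumIndex m n c → ℝ
  | .inl _, .inl _ => tm
  | .inl _, .inr _ => tn
  | .inr _, _ => tn

lemma group_eq_of_mem_sumOps : ∀ (c : OpGroup) (κ : SumIndex m n c), ∀ o ∈ sumOps m n c κ,
    o.group = c
  | .inl c, .inl (p, k), o, ho => by
    obtain ⟨l, -, rfl⟩ := Finset.mem_map.1 ho; rfl
  | .inl c, .inr (r, p), o, ho => by
    obtain ⟨l, -, rfl⟩ := Finset.mem_map.1 ho; rfl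
  | .inr (.inl c), ⟨j, i, l⟩, o, ho => by
    obtain ⟨l, -, rfl⟩ := Finset.mem_map.1 ho; rfl
  | .inr (.inr c), (i, j, k), o, ho => by
    obtain ⟨l, -, rfl⟩ := Finset.mem_map.1 ho; rfl

lemma card_tail_le {k : ℕ} (i : Fin k) :
    (#({l | i ≤ l ∧ 0 < l.val} : Finset (Fin k)) : ℝ) ≤ k - 1 := by
  have h : #({l | i ≤ l ∧ 0 < l.val} : Finset (Fin k)) < k := by
    refine (Finset.card_lt_univ_of_notMem (x := ⟨0, i.pos⟩) (by simp)).trans_eq (by simp)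
  have : (#({l | i ≤ l ∧ 0 < l.val} : Finset (Fin k)) : ℝ) + 1 ≤ k := by exact_mod_cast h
  linarith

lemma card_init_le {k l : ℕ} (h : l + 1 < k) :
    (#({i | i.val ≤ l} : Finset (Fin k)) : ℝ) ≤ k - 1 := by
  have h : #({i | i.val ≤ l} : Finset (Fin k)) < k := by
    refine (Finset.card_lt_univ_of_notMem (x := ⟨l + 1, h⟩) (by simp)).trans_eq (by simp)
  have : (#({i | i.val ≤ l} : Finset (Fin k)) : ℝ) + 1 ≤ k := by exact_mod_cast h
  linarith

/-- A controlled sum of a Gram matrix has at most `m - 1` terms, any other at most `n - 1`. -/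
lemma exists_card_sumOps_le (m n : ℕ) (C : ℝ) (u : ℝ) : ∀ (c : OpGroup) (κ : SumIndex m n c),
    ∃ N : ℝ, #(sumOps m n c κ) ≤ N ∧
      sumBound (C * √((m : ℝ) - 1) * u) (C * √((n : ℝ) - 1) * u) c κ = C * √N * u
  | .inl c, .inl (p, k) => ⟨m - 1, by rw [sumOps, card_map]; exact card_tail_le k, rfl⟩
  | .inl c, .inr (r, p) => ⟨n - 1, by
      rw [sumOps, card_map]
      have h := not_le.1 p.2
      exact card_init_le (k := n) (l := p.1.2.val) (by have := p.1.1.isLt; omega), rfl⟩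
  | .inr (.inl c), ⟨j, i, l⟩ => ⟨n - 1, by
      rw [sumOps, card_map]
      exact card_init_le (by have := j.isLt; have := i.isLt; have := l.isLt; omega), rfl⟩
  | .inr (.inr c), (i, j, k) => ⟨n - 1, by rw [sumOps, card_map]; exact card_tail_le k, rfl⟩

lemma goodErrors_of_sums {u tm tn : ℝ} {e : Op m n → ℝ} (hb : ∀ o, |e o| ≤ u)
    (h : ∀ c κ, |∑ o ∈ sumOps m n c κ, e o| ≤ sumBound tm tn c κ) : GoodErrors u tm tn e where
  bound := hb
  gram_sum c i j hij k := by
    have := h (.inl c) (.inl (⟨(i, j), hij⟩, k))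
    simp only [sumOps, Finset.sum_map] at this
    exact this
  chol_sum c i j hij l hl := by
    have := h (.inr (.inl c)) ⟨j, ⟨i.val, Nat.lt_succ_of_le hij⟩, ⟨l.val, hl⟩⟩
    simp only [sumOps, Finset.sum_map] at this
    exact this
  solve_sum c r j l hl := by
    have := h (.inl c) (.inr (r, ⟨(j, l), not_le.2 hl⟩))
    simp only [sumOps, Finset.sum_map] at this
    exact this
  tri_sum c i j k := by
    have := h (.inr (.inr c)) (i, j, k)
    simp only [sumOps, Finset.sum_map] at this
    exact this

lemma card_sumIndex_inl (c : Fin 3) : Fintype.card (SumIndex m n (.inl c)) = m * n ^ 2 := by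
  have h : Fintype.card {p : Fin n × Fin n // p.1 ≤ p.2}
      + Fintype.card {p : Fin n × Fin n // ¬ p.1 ≤ p.2} = n ^ 2 := by
    rw [← Fintype.card_sum, Fintype.card_congr (Equiv.sumCompl _)]
    simp [sq]
  have h2 : Fintype.card (SumIndex m n (.inl c))
      = Fintype.card {p : Fin n × Fin n // p.1 ≤ p.2} * m
        + m * Fintype.card {p : Fin n × Fin n // ¬ p.1 ≤ p.2} := by
    refine (Fintype.card_sum ..).trans ?_
    rw [Fintype.card_prod, Fintype.card_prod, Fintype.card_fin]
  rw [h2, ← h]; ring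

lemma card_sumIndex_chol_le (c : Fin 3) : (Fintype.card (SumIndex m n (.inr (.inl c))) : ℝ)
    ≤ (n : ℝ) ^ 3 / 6 + (n : ℝ) ^ 2 / 2 + (n : ℝ) / 3 := by
  have h1 : Fintype.card (SumIndex m n (.inr (.inl c)))
      = ∑ j ∈ range n, ∑ i ∈ range (j + 1), i := by
    refine (Fintype.card_sigma ..).trans ?_
    rw [← Fin.sum_univ_eq_sum_range (fun j => ∑ i ∈ range (j + 1), i) n]
    refine Finset.sum_congr rfl fun j _ => ?_
    rw [Fintype.card_sigma, ← Fin.sum_univ_eq_sum_range (fun i => i) (j.val + 1)]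
    simp
  have h2 : ∀ k : ℕ, ((∑ i ∈ range (k + 1), i : ℕ) : ℝ) = (k : ℝ) * (k + 1) / 2 := fun k => by
    induction k with
    | zero => simp
    | succ k ih => rw [Finset.sum_range_succ]; push_cast at ih ⊢; rw [ih]; ring
  have h3 : ∀ k : ℕ, ((∑ j ∈ range k, ∑ i ∈ range (j + 1), i : ℕ) : ℝ)
      = ((k : ℝ) ^ 3 - k) / 6 := fun k => by
    induction k with
    | zero => simp
    | succ k ih => rw [Finset.sum_range_succ, Nat.cast_add, ih, h2]; push_cast; ring
  rw [h1, h3]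
  have : (0 : ℝ) ≤ n := Nat.cast_nonneg n
  nlinarith [sq_nonneg (n : ℝ)]

lemma card_sumIndex_tri (c : Fin 2) : Fintype.card (SumIndex m n (.inr (.inr c))) = n ^ 3 := by
  refine (Fintype.card_prod ..).trans ?_
  rw [Fintype.card_prod, Fintype.card_fin]; ring

end probability_bounds

/-! ### Constants and probabilities of the theorem -/

section theorem_bounds

open MeasureTheory ProbabilityTheory Finset

variable {m n : ℕ}

/-- If the probability bound for one sum is positive, then `λ` is at least one. -/
lemma one_le_of_two_mul_exp_lt_one {u lam : ℝ} (hu : 0 ≤ u) (hu1 : u ≤ 1) (hlam : 0 ≤ lam)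
    (h : 2 * Real.exp (-(lam ^ 2 * (1 - u) ^ 2) / 2) < 1) : 1 ≤ lam := by
  have h1 := Real.add_one_le_exp (-(lam ^ 2 * (1 - u) ^ 2) / 2)
  have h2 : 1 < (lam * (1 - u)) ^ 2 := by rw [mul_pow]; linarith
  have h3 : 1 < lam * (1 - u) := by
    by_contra! hc
    have h0 : 0 ≤ lam * (1 - u) := mul_nonneg hlam (by linarith)
    exact absurd (pow_le_one₀ (n := 2) h0 hc) (not_le.2 h2)
  nlinarith

lemma errorConstants_of_size_le {u lam : ℝ} (hn : 1 ≤ n) (hm : 1 ≤ m) (hu : 0 < u)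
    (hlam : 1 ≤ lam) (hm1 : lam * √(m : ℝ) * n * u ≤ 1 / 2200) (hm2 : (m : ℝ) * n * u ≤ 1 / 2200)
    (hn1 : lam * √((n : ℝ) + 1) * n * u ≤ 1 / 2200) (hn2 : (n : ℝ) * (n + 1) * u ≤ 1 / 2200) :
    ErrorConstants m n u (lam * (1 - u) * √((m : ℝ) - 1) * u) (lam * (1 - u) * √((n : ℝ) - 1) * u)
      (Real.exp (lam * (1 - u) * √((m : ℝ) - 1) * u + u + (m + 1) * u ^ 2) - 1)
      (Real.exp (lam * (1 - u) * √((n : ℝ) - 1) * u + 2 * u + (n + 1) * u ^ 2) - 1)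
      (Real.exp (lam * (1 - u) * √((n : ℝ) - 1) * u + u + (n + 1) * u ^ 2) - 1)
      (lam * √(m : ℝ) * n * u) (lam * √((n : ℝ) + 1) * n * u) (lam * √(n : ℝ) * n * u) := by
  have hn' : (1 : ℝ) ≤ n := by exact_mod_cast hn
  have hm' : (1 : ℝ) ≤ m := by exact_mod_cast hm
  have hmn : (m : ℝ) * u ≤ 1 / 2200 := by
    refine le_trans ?_ hm2
    have : 0 ≤ (m : ℝ) * u := by positivity
    nlinarith
  have hnn : ((n : ℝ) + 1) * u ≤ 1 / 2200 := by
    refine le_trans ?_ hn2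
    have : 0 ≤ ((n : ℝ) + 1) * u := by positivity
    nlinarith
  have hu1 : u ≤ 1 / 2200 := by nlinarith
  have h1u : 0 ≤ 1 - u := by linarith
  have ht0 : ∀ r : ℝ, 0 ≤ lam * (1 - u) * √(r - 1) * u := fun r => by positivity
  have ht : ∀ r : ℝ, lam * (1 - u) * √(r - 1) * u ≤ lam * √(r - 1) * u := fun r => by
    gcongr
    exact mul_le_of_le_one_right (by linarith) (by linarith)
  have hw : lam * √(n : ℝ) * n * u ≤ lam * √((n : ℝ) + 1) * n * u := by
    gcongr
    linarith
  have hexp : ∀ y : ℝ, 0 ≤ y → 0 ≤ Real.exp y - 1 := fun y hy => by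
    linarith [Real.one_le_exp hy]
  refine ⟨hu.le, hu1, ht0 n, le_rfl, le_rfl, le_rfl, ?_, ?_, ?_,
    exp_sub_one_le_of_one hm' hn' hu.le hlam (ht0 m) (ht m) (by linarith) hm1,
    exp_sub_one_le_of_two hn' hn' hu.le hlam (ht0 n) (ht n) (by linarith) hn1,
    exp_sub_one_le_of_one hn' hn' hu.le hlam (ht0 n) (ht n) (by linarith) (hw.trans hn1),
    ?_, by positivity, hw, by positivity, hm1, hn1, hn⟩
  · exact hexp _ (add_nonneg (add_nonneg (ht0 m) hu.le) (by positivity))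
  · exact hexp _ (add_nonneg (add_nonneg (ht0 n) (by linarith)) (by positivity))
  · exact hexp _ (add_nonneg (add_nonneg (ht0 n) hu.le) (by positivity))
  · have h1 : 1 ≤ √((n : ℝ) + 1) := Real.one_le_sqrt.2 (by linarith)
    have h2 : 1 ≤ lam * √((n : ℝ) + 1) := by nlinarith
    rw [mul_assoc]
    exact le_mul_of_one_le_left (by positivity) h2

/-- The probability that all controlled sums of rounding errors are small. -/
lemma probQ_le_measureReal_sums {Ω : Type*} [MeasurableSpace Ω] {μ : Measure Ω}
    [IsProbabilityMeasure μ] {u lam : ℝ} (hn : 1 ≤ n) (hnm : n ≤ m) (hu : 0 < u) (hu1 : u ≤ 1)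
    (hlam : 0 ≤ lam) (hQ : 0 < probQ u lam ((m : ℝ) * n ^ 2))
    {δ : Op m n → Ω → ℝ} (hδ_meas : ∀ o, Measurable (δ o)) (hδ_indep : iIndepFun δ μ)
    (hδ_mean : ∀ o, ∫ ω, δ o ω ∂μ = 0) (hδ_bound : ∀ o, ∀ᵐ ω ∂μ, |δ o ω| ≤ u) :
    (probQ u lam ((m : ℝ) * n ^ 2) * probQ u lam ((n : ℝ) ^ 3 / 6 + (n : ℝ) ^ 2 / 2 + (n : ℝ) / 3)
          * probQ u lam ((n : ℝ) * (n + 1) / 2)) ^ 3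
        * probQ u lam ((n : ℝ) ^ 3) ^ 2
      ≤ μ.real {ω | ∀ c κ, |∑ o ∈ sumOps m n c κ, δ o ω|
          ≤ sumBound (lam * (1 - u) * √((m : ℝ) - 1) * u) (lam * (1 - u) * √((n : ℝ) - 1) * u)
            c κ} := by
  set β := 2 * Real.exp (-(lam ^ 2 * (1 - u) ^ 2) / 2) with hβdef
  have hβ : 0 ≤ β := by positivity
  have hprobQ : ∀ N, probQ u lam N = 1 - N * β := fun N => by rw [probQ, probP, ← hβdef]; ring
  simp only [hprobQ] at hQ ⊢
  have hn' : (1 : ℝ) ≤ n := by exact_mod_cast hn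
  have hnm' : (n : ℝ) ≤ m := by exact_mod_cast hnm
  have hn2 : (n : ℝ) ≤ (n : ℝ) ^ 2 := by nlinarith
  have hn3 : (n : ℝ) ^ 2 ≤ (n : ℝ) ^ 3 := by nlinarith
  have hmn3 : (n : ℝ) ^ 3 ≤ (m : ℝ) * n ^ 2 := by
    rw [pow_succ']
    gcongr
  have hsmall : ∀ N : ℝ, N ≤ (m : ℝ) * n ^ 2 → 0 ≤ 1 - N * β := fun N hN => by
    have := mul_le_mul_of_nonneg_right hN hβ
    linarith
  have key := prod_le_measureReal_forall (Op.group (m := m) (n := n)) hδ_meas hδ_indep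
    (sumOps m n) group_eq_of_mem_sumOps
    (sumBound (lam * (1 - u) * √((m : ℝ) - 1) * u) (lam * (1 - u) * √((n : ℝ) - 1) * u))
    (β := β) (fun c κ => by
      obtain ⟨N, hN, hb⟩ := exists_card_sumOps_le m n (lam * (1 - u)) u c κ
      rw [hb]
      exact measureReal_lt_abs_sum_le hu hu1 hlam hδ_meas hδ_indep hδ_mean hδ_bound _ hN)
    (fun c => hsmall _ <| match c with
      | .inl c => by rw [card_sumIndex_inl]; push_cast; exact le_rfl
      | .inr (.inl c) => by linarith [card_sumIndex_chol_le (m := m) (n := n) c]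
      | .inr (.inr c) => by rw [card_sumIndex_tri]; push_cast; exact hmn3)
  refine le_trans ?_ key
  clear_value β
  rw [Fintype.prod_sum_type, Fintype.prod_sum_type,
    Fintype.prod_congr _ (fun _ => 1 - (m : ℝ) * n ^ 2 * β)
      (fun c => by rw [card_sumIndex_inl]; push_cast; rfl),
    Fintype.prod_congr (fun c : Fin 2 => 1 - (Fintype.card (SumIndex m n (.inr (.inr c))) : ℝ) * β)
      (fun _ => 1 - (n : ℝ) ^ 3 * β) (fun c => by rw [card_sumIndex_tri]; push_cast; rfl)]
  have h1 := hsmall ((n : ℝ) ^ 3 / 6 + (n : ℝ) ^ 2 / 2 + (n : ℝ) / 3) (by linarith)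
  have hchol : (1 - ((n : ℝ) ^ 3 / 6 + (n : ℝ) ^ 2 / 2 + (n : ℝ) / 3) * β) ^ 3
      ≤ ∏ c : Fin 3, (1 - (Fintype.card (SumIndex m n (.inr (.inl c))) : ℝ) * β) := by
    rw [← Fin.prod_const 3]
    refine Finset.prod_le_prod (fun _ _ => h1) fun c _ => ?_
    have := mul_le_mul_of_nonneg_right (card_sumIndex_chol_le (m := m) (n := n) c) hβ
    linarith
  rw [Fin.prod_const, Fin.prod_const, mul_pow, mul_pow, ← mul_assoc]
  -- No sum is charged to the factors for `n (n + 1) / 2` sums; they are at most one.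
  have h2 := hsmall ((n : ℝ) * (n + 1) / 2) (by nlinarith)
  have h3 : (1 - (n : ℝ) * (n + 1) / 2 * β) ^ 3 ≤ 1 := by
    refine pow_le_one₀ h2 ?_
    have : 0 ≤ (n : ℝ) * (n + 1) / 2 * β := by positivity
    linarith
  refine mul_le_mul_of_nonneg_right ?_ (sq_nonneg _)
  exact (mul_le_of_le_one_right (mul_nonneg (pow_nonneg hQ.le 3) (pow_nonneg h1 3)) h3).trans
    (mul_le_mul_of_nonneg_left hchol (pow_nonneg hQ.le 3))

end theorem_bounds

end CholQR

open CholQR MeasureTheory ProbabilityTheory in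
theorem theorem4p6
    {Ω : Type*} [MeasurableSpace Ω] (μ : Measure Ω) [IsProbabilityMeasure μ]
    {m n : ℕ} (hn : 1 ≤ n)
    (u lam s : ℝ) (hu : 0 < u) (hlam : 0 < lam)
    -- general settings on the size of the problem
    (hm_size : max (lam * √(m : ℝ) * n * u) ((m : ℝ) * n * u) ≤ 1 / 2200)
    (hn_size : max (lam * √((n : ℝ) + 1) * n * u) ((n : ℝ) * (n + 1) * u) ≤ 1 / 2200)
    -- the smallest of the probability bounds `Q(λ, ·)` below is positive (hence all of them are)
    (hQ : 0 < probQ u lam ((m : ℝ) * n ^ 2))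
    (T : Matrix (Fin m) (Fin n) ℝ) (hT : T.rank = n)
    -- the rounding errors: independent, of mean zero, bounded by the unit roundoff
    (δ : Op m n → Ω → ℝ) (hδ_meas : ∀ o, Measurable (δ o)) (hδ_indep : iIndepFun δ μ)
    (hδ_mean : ∀ o, ∫ ω, δ o ω ∂μ = 0) (hδ_bound : ∀ o, ∀ᵐ ω ∂μ, |δ o ω| ≤ u)
    (hs : s = 11 * lam * (√(m : ℝ) * n * u + √((n : ℝ) + 1) * n * u) * gNorm T ^ 2) :
    (probQ u lam ((m : ℝ) * n ^ 2) * probQ u lam ((n : ℝ) ^ 3 / 6 + (n : ℝ) ^ 2 / 2 + (n : ℝ) / 3)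
          * probQ u lam ((n : ℝ) * (n + 1) / 2)) ^ 3
        * probQ u lam ((n : ℝ) ^ 3) ^ 2
      ≤ μ.real {ω |
          let e : Op m n → ℝ := fun o => δ o ω
          let R := sCholeskyQR3 T s e
          let p₁ := pRatio T
          let p₂ := pRatio R.Q
          let p₃ := pRatio R.Q₁
          Completes e 0 R.A ∧
          (kappa2 T ≤ 1 / (86 * lam * p₁ * p₂ * (√(m : ℝ) * n * u + √((n : ℝ) + 1) * n * u)) →
            Completes e 1 R.U₁ ∧ Completes e 2 R.U₂ ∧
            normF (R.Q₂.transpose * R.Q₂ - 1)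
              ≤ 6 * lam * p₃ ^ 2 * (√(m : ℝ) * n * u + √((n : ℝ) + 1) * n * u) ∧
            normF (R.Q₂ * R.V₄ - T)
              ≤ phi1 p₁ p₂ p₃ * lam * (n * √(n : ℝ)) * u * norm2 T)} := by
  have hnm : n ≤ m := hT ▸ T.rank_le_height
  have hn' : (1 : ℝ) ≤ n := by exact_mod_cast hn
  have hm' : (1 : ℝ) ≤ m := by exact_mod_cast hn.trans hnm
  obtain ⟨hm1, hm2⟩ := max_le_iff.1 hm_size
  obtain ⟨hn1, hn2⟩ := max_le_iff.1 hn_size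
  have hmn : (1 : ℝ) ≤ m * n := by nlinarith
  have hu1 : u ≤ 1 := by nlinarith
  have hlam1 : 1 ≤ lam := by
    refine one_le_of_two_mul_exp_lt_one hu.le hu1 hlam.le ?_
    have hβ : 0 < Real.exp (-(lam ^ 2 * (1 - u) ^ 2) / 2) := Real.exp_pos _
    have hmn2 : (1 : ℝ) ≤ m * n ^ 2 := by nlinarith
    rw [probQ, probP] at hQ
    nlinarith
  have C := errorConstants_of_size_le hn (hn.trans hnm) hu hlam1 hm1 hm2 hn1 hn2
  refine (probQ_le_measureReal_sums hn hnm hu hu1 hlam.le hQ hδ_meas hδ_indep hδ_mean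
    hδ_bound).trans ?_
  rw [measureReal_def, measureReal_def]
  refine ENNReal.toReal_mono (measure_ne_top _ _) (measure_mono_ae ?_)
  filter_upwards [ae_all_iff.2 hδ_bound] with ω hω hsum
  have hs' : s = 11 * (lam * √(m : ℝ) * n * u + lam * √((n : ℝ) + 1) * n * u) * gNorm T ^ 2 := by
    rw [hs]; ring
  obtain ⟨h0, h1⟩ := C.sCholeskyQR3_bounds (goodErrors_of_sums hω hsum) T hT hs'
  refine ⟨h0, fun hκ => ?_⟩
  obtain ⟨hc1, hc2, horth, hres⟩ := h1 (hκ.trans_eq (by ring_nf))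
  exact ⟨hc1, hc2, horth.trans_eq (by ring), hres.trans_eq (by ring)⟩
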